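/- **Theorem (time scale of free turbulence on $\mathbb{T}^3$).** *Setting.* Let $\mathbb{T}^3=\mathbb{R}^3/(L\mathbb{Z})^3$ with $L>0$, so $\mathrm{Vol}(\mathbb{T}^3)=L^3$; let $\nu>0$ be the kinematic viscosity and $\rho>0$ the constant density (for instance $\rho=\mathrm{Vol}(\mathbb{T}^3)^{-1}$). Let $u$ be a Leray solution on $\mathbb{R}_+\times\mathbb{T}^3$ of $$\partial_t u-\nu\Delta u+(u\cdot\nabla)u=-\nabla\Pi,\qquad \operatorname{div}u=0,\qquad u_{|t=0}=u_0,$$ that is, $u_0\in L^2$ is divergence-free, $u\in L^\infty(\mathbb{R}_+;L^2)\cap L^2(\mathbb{R}_+;\dot H^1)$ is a weak solution, and, for $t'=0$ (with $u(0)=u_0$) and for almost every $t'>0$, $\|u(t)\|_{L^2}^2+2\nu\int_{t'}^t\|\nabla u\|_{L^2}^2\,d\tau\le\|u(t')\|_{L^2}^2$ for a.e. $t>t'$. Assume $\int_{\mathbb{T}^3}\rho u_0=0$. Let $0\le T_0<T_1$, and let a bar (or $\langle\cdot\rangle$) denote the time average over $[T_0,T_1]$. Put $E(t)=\rho\|u(t)\|_{L^2}^2$,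 $E_0=\rho\|u_0\|_{L^2}^2$, $\varepsilon(t)=2\rho\nu\|\nabla u(t)\|_{L^2}^2$, and let $\omega=(\partial_iu_j-\partial_ju_i)_{1\le i,j\le3}$ be the vorticity matrix, with $|\omega|^2=\sum_{i,j}|\omega_{ij}|^2$. *Spectrum.* Let $\hat u(t,\mathbf k)=\int_{\mathbb{T}^3}e^{-i\mathbf k\cdot x}u(t,x)\,dx$, $\Sigma=\{|\mathbf k|:\mathbf k\in(2\pi L^{-1}\mathbb{Z})^3\}$, $\Sigma^\ast=\Sigma\setminus\{0\}$, $$E^\dagger(K,t)=(2\pi)^{-2}\rho\,\frac KL\sum_{|\mathbf k|=K}|\hat u(t,\mathbf k)|^2,\qquad \mu=\frac{2\pi}{L}\sum_{K\in\Sigma^\ast}\frac{2\pi}{KL}\,\delta_K,\qquad V=\mathrm{Vol}(u;[T_0,T_1])=\frac{\langle\|u\|_{L^1}^2\rangle}{\langle\|u\|_{L^2}^2\rangle}.$$ Assume that $u$ is a K41-function on $[T_0,T_1]$: for some $C\in(1,2)$, $$\int_{\Sigma}K^2\bar E^\dagger(K)\,d\mu(K)\le C\int_{\{K\in\Sigma:\,K\ge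 V^{-1/3}\}}K^2\bar E^\dagger(K)\,d\mu(K).$$ Let $[K_-,K_+]$ be an inertial range of $u$, that is: $K_-<K_+$ and $K_+\in\Sigma$; $K_-=2\pi L^{-1}$ if $V/\mathrm{Vol}(\mathbb{T}^3)\ge(2\pi)^{-3}$, and $2\pi L^{-1}\le K_-\le V^{-1/3}$ otherwise; $\int_\Sigma K^2\bar E^\dagger\,d\mu\le(1+C)\int_{[K_-,K_+]}K^2\bar E^\dagger\,d\mu$; and $\bar E^\dagger(K)>0$ for all $K\in\Sigma\cap[K_-,K_+]$. Its parameters are $$\Re=\Big(\frac{K_+}{K_-}\Big)^{4/3},\qquad \gamma=\max\left|\frac{\log\big(\bar E^\dagger(K')/\bar E^\dagger(K)\big)}{\log(K'/K)}+\frac53\right|,$$ where the maximum is over consecutive elements $K<K'$ of $\Sigma$ in $[K_-,K_+]$ (and is $0$ if there are none). Finally set $$\alpha=\frac{\bar E^\dagger(K_+)}{\bar\varepsilon^{2/3}K_+^{-5/3}},\qquad \mathcal T(u_0;\omega)=\frac{\alpha^3\nu^2}{\rho}\,\frac{\int_{T_0}^{T_1}\|\omega(t)\|_{L^2}^2\,dt}{\|u_0\|_{L^2}^4},\qquad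 C(n_-)=\frac{\operatorname{Card}\{z\in\mathbb{Z}^3:|z|^2=n_-\}}{8\pi^3\sqrt{n_-}},\quad n_-=\Big(\frac{LK_-}{2\pi}\Big)^2.$$ *Conclusion.* There are positive functions $C_1,C_2,C_3,C_4$ of $(\Re,\gamma)$ alone, independent of $L,\rho,\nu,u_0,u,T_0,T_1,C$ and of the inertial range, with $C_j(\Re,\gamma)\to1$ as $\Re\to\infty$ and $\gamma\log\Re\to0$, such that in every such situation $$\frac{3375}{2048}\,C_1(\Re,\gamma)\,\Re\,\mathcal T(u_0;\omega)\le T_1-T_0\le\frac{128\,C_2(\Re,\gamma)}{3375\,\pi^4}\,\frac{1}{\Re\,\mathcal T(u_0;\omega)}\,\frac{\mathrm{Vol}(\mathbb{T}^3)^{4/3}}{\nu^2},$$ and, if moreover $C(n_-)<1$, $$\frac{3375}{2048}\,C_3(\Re,\gamma)\le\Big(\frac{\bar E}{E_0}\Big)^2\frac{T_1-T_0}{\Re\,\mathcal T(u_0;\omega)}\le\frac{864\,C_4(\Re,\gamma)}{(1-C(n_-))^2}.$$ -/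

import Mathlib

open MeasureTheory Set Filter Topology

namespace K41

noncomputable section

/-! ### The torus `𝕋³ = ℝ³ / (Lℤ)³` and weak derivatives -/

/-- The three-dimensional torus of side `L`. It carries the product of the measures of total
mass `L` on the circles `ℝ / Lℤ`. -/
abbrev Torus (L : ℝ) : Type := Fin 3 → AddCircle L

/-- `ℝ³` with its Euclidean norm. -/
abbrev E3 : Type := EuclideanSpace ℝ (Fin 3)

variable {L : ℝ} [Fact (0 < L)]

/-- The volume of the torus. -/
def torusVolume (L : ℝ) [Fact (0 < L)] : ℝ := (volume : Measure (Torus L)).real univ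

/-- The classical partial derivative `∂ᵢψ` of a function on the torus. -/
def torusPartial (i : Fin 3) (ψ : Torus L → ℝ) (x : Torus L) : ℝ :=
  deriv (fun s : ℝ => ψ (x + Pi.single i (s : AddCircle L))) 0

/-- A function on the torus is smooth if its periodic lift to `ℝ³` is `C^∞`. -/
def IsSmoothOnTorus (ψ : Torus L → ℝ) : Prop :=
  ContDiff ℝ (⊤ : ℕ∞) (fun y : Fin 3 → ℝ => ψ (fun i => (y i : AddCircle L)))

/-- `g` is the weak (distributional) derivative `∂ᵢf` on the torus. -/
def IsWeakPartial (i : Fin 3) (f g : Torus L → ℝ) : Prop :=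
  ∀ ψ : Torus L → ℝ, IsSmoothOnTorus ψ →
    ∫ x, f x * torusPartial i ψ x = - ∫ x, g x * ψ x

/-- `f` has a square-integrable weak derivative `∂ᵢf`. -/
def HasWeakPartial (i : Fin 3) (f : Torus L → ℝ) : Prop :=
  ∃ g : Torus L → ℝ, MemLp g 2 ∧ IsWeakPartial i f g

open Classical in
/-- The square-integrable weak derivative `∂ᵢf` (unique up to a null set), and `0` if there is
none. -/
def weakPartial (i : Fin 3) (f : Torus L → ℝ) : Torus L → ℝ :=
  if h : HasWeakPartial i f then h.choose else 0

/-- `div v = 0` in the sense of distributions. -/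
def IsDivFree (v : Torus L → E3) : Prop :=
  ∀ ψ : Torus L → ℝ, IsSmoothOnTorus ψ → ∫ x, ∑ i, v x i * torusPartial i ψ x = 0

/-- `‖v‖²` in `L²(𝕋³)`. -/
def normSq (v : Torus L → E3) : ℝ := ∫ x, ‖v x‖ ^ 2

/-- `‖∇v‖²` in `L²(𝕋³)`. -/
def gradSq (v : Torus L → E3) : ℝ :=
  ∑ i, ∑ j, ∫ x, (weakPartial i (fun y => v y j) x) ^ 2

/-- `‖ω‖²` in `L²(𝕋³)`, where `ω` is the vorticity matrix `(∂ᵢvⱼ - ∂ⱼvᵢ)` for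
`1 ≤ i, j ≤ 3`. -/
def vorticitySq (v : Torus L → E3) : ℝ :=
  ∑ i, ∑ j, ∫ x, (weakPartial i (fun y => v y j) x - weakPartial j (fun y => v y i) x) ^ 2

/-! ### Leray solutions of the Navier-Stokes equations -/

/-- The Leray space `L^∞(ℝ₊; L²(𝕋³)) ∩ L²(ℝ₊; H¹(𝕋³))`. -/
structure MemLeraySpace (u : ℝ → Torus L → E3) : Prop where
  measurable : AEStronglyMeasurable (fun p : ℝ × Torus L => u p.1 p.2)
    ((volume.restrict (Ioi (0 : ℝ))).prod volume)
  bounded : ∃ M : ℝ, ∀ᵐ t ∂(volume.restrict (Ioi (0 : ℝ))), MemLp (u t) 2 ∧ normSq (u t) ≤ M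
  weakDiff : ∀ᵐ t ∂(volume.restrict (Ioi (0 : ℝ))),
    ∀ i j, HasWeakPartial i (fun x => u t x j)
  grad_integrable : IntegrableOn (fun t => gradSq (u t)) (Ioi 0)

/-- Smooth divergence-free vector fields on `ℝ × 𝕋³` that vanish for large times. -/
structure IsTestField (φ : ℝ → Torus L → Fin 3 → ℝ) : Prop where
  smooth : ∀ j, ContDiff ℝ (⊤ : ℕ∞)
    (fun p : ℝ × (Fin 3 → ℝ) => φ p.1 (fun i => (p.2 i : AddCircle L)) j)
  vanish : ∃ R : ℝ, ∀ t, R ≤ t → φ t = 0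
  divFree : ∀ t x, ∑ i, torusPartial i (fun y => φ t y i) x = 0

/-- The weak form of `∂ₜu - νΔu + (u·∇)u = -∇Π` with initial data `u₀`. -/
def IsWeakSolutionNS (ν : ℝ) (u₀ : Torus L → E3) (u : ℝ → Torus L → E3) : Prop :=
  ∀ φ : ℝ → Torus L → Fin 3 → ℝ, IsTestField φ →
    (∫ t in Ioi (0 : ℝ), ∫ x, ∑ j,
      (u t x j * deriv (fun s => φ s x j) t
        + ν * (u t x j * ∑ i, torusPartial i (torusPartial i (fun y => φ t y j)) x)
        + ∑ i, u t x i * u t x j * torusPartial i (fun y => φ t y j) x))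
      + ∫ x, ∑ j, u₀ x j * φ 0 x j = 0

/-- Leray solutions: weak solutions in the Leray space that satisfy the energy inequality from
the initial time and from almost every later time. -/
structure IsLeraySolution (ν : ℝ) (u₀ : Torus L → E3) (u : ℝ → Torus L → E3) : Prop where
  initial_memLp : MemLp u₀ 2
  initial_divFree : IsDivFree u₀
  leraySpace : MemLeraySpace u
  divFree : ∀ᵐ t ∂(volume.restrict (Ioi (0 : ℝ))), IsDivFree (u t)
  weakSolution : IsWeakSolutionNS ν u₀ u
  energy_initial : ∀ᵐ t ∂(volume.restrict (Ioi (0 : ℝ))),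
    normSq (u t) + 2 * ν * ∫ τ in (0 : ℝ)..t, gradSq (u τ) ≤ normSq u₀
  energy : ∀ᵐ s ∂(volume.restrict (Ioi (0 : ℝ))), ∀ᵐ t ∂(volume.restrict (Ioi s)),
    normSq (u t) + 2 * ν * ∫ τ in s..t, gradSq (u τ) ≤ normSq (u s)

/-! ### The energy spectrum -/

/-- `f̂(𝐤) = ∫ e^{-i𝐤·x} f(x) dx` for the frequency `𝐤 = 2πL⁻¹k`, `k ∈ ℤ³`. -/
def fourierCoef (f : Torus L → ℝ) (k : Fin 3 → ℤ) : ℂ :=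
  ∫ x, (∏ i, fourier (-(k i)) (x i)) * (f x : ℂ)

/-- `|𝐤|` for the frequency `𝐤 = 2πL⁻¹k`, `k ∈ ℤ³`. -/
def freqNorm (L : ℝ) (k : Fin 3 → ℤ) : ℝ :=
  2 * Real.pi / L * Real.sqrt (∑ i, (k i : ℝ) ^ 2)

/-- `Σ = {|𝐤| : 𝐤 ∈ (2πL⁻¹ℤ)³}`, the spectrum of the square root of the Stokes operator. -/
def stokesSpectrum (L : ℝ) : Set ℝ := range (freqNorm L)

/-- `Σ* = Σ \ {0}`. -/
def stokesSpectrumStar (L : ℝ) : Set ℝ := stokesSpectrum L \ {0}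

/-- The energy spectrum `E†(K) = (2π)⁻² ρ (K/L) ∑_{|𝐤| = K} |v̂(𝐤)|²` of a field `v`. -/
def energySpectrum (ρ : ℝ) (v : Torus L → E3) (K : ℝ) : ℝ :=
  1 / (2 * Real.pi) ^ 2 * ρ * (K / L) *
    ∑' k : {k : Fin 3 → ℤ // freqNorm L k = K},
      ∑ j, ‖fourierCoef (fun x => v x j) k‖ ^ 2

/-- The measure `μ = 2πL⁻¹ ∑_{K ∈ Σ*} (2π/(KL)) δ_K`. -/
def spectralMeasure (L : ℝ) : Measure ℝ :=
  Measure.sum fun K : stokesSpectrumStar L =>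
    ENNReal.ofReal (2 * Real.pi / L * (2 * Real.pi / ((K : ℝ) * L))) • Measure.dirac (K : ℝ)

/-! ### Time averages -/

/-- The average of `f` over `[T₀, T₁]`. -/
def timeAverage (T₀ T₁ : ℝ) (f : ℝ → ℝ) : ℝ := 1 / (T₁ - T₀) * ∫ t in T₀..T₁, f t

/-- The mean energy, with `E(t) = ρ ‖u(t)‖²`. -/
def meanEnergy (ρ : ℝ) (u : ℝ → Torus L → E3) (T₀ T₁ : ℝ) : ℝ :=
  timeAverage T₀ T₁ fun t => ρ * normSq (u t)

/-- The mean dissipation rate, with `ε(t) = 2ρν ‖∇u(t)‖²`. -/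
def meanDissipation (ρ ν : ℝ) (u : ℝ → Torus L → E3) (T₀ T₁ : ℝ) : ℝ :=
  timeAverage T₀ T₁ fun t => 2 * ρ * ν * gradSq (u t)

/-- The mean energy spectrum. -/
def meanSpectrum (ρ : ℝ) (u : ℝ → Torus L → E3) (T₀ T₁ K : ℝ) : ℝ :=
  timeAverage T₀ T₁ fun t => energySpectrum ρ (u t) K

/-- The average volume `Vol(u; [T₀, T₁])`: the average of `‖u‖²` in `L¹` divided by the average of
`‖u‖²` in `L²`. -/
def meanVolume (u : ℝ → Torus L → E3) (T₀ T₁ : ℝ) : ℝ :=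
  timeAverage T₀ T₁ (fun t => (∫ x, ‖u t x‖) ^ 2) / timeAverage T₀ T₁ (fun t => normSq (u t))

/-! ### K41-functions, inertial ranges and their parameters -/

/-- The integral of `K² Ē†(K) dμ(K)` over the set of frequencies `S`. -/
def meanEnstrophy (ρ : ℝ) (u : ℝ → Torus L → E3) (T₀ T₁ : ℝ) (S : Set ℝ) : ENNReal :=
  ∫⁻ K in S, ENNReal.ofReal (K ^ 2 * meanSpectrum ρ u T₀ T₁ K) ∂(spectralMeasure L)

/-- `u` is a K41-function on `[T₀, T₁]`, with the constant `C ∈ (1, 2)`. -/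
structure IsK41Function (ρ : ℝ) (u : ℝ → Torus L → E3) (T₀ T₁ C : ℝ) : Prop where
  leraySpace : MemLeraySpace u
  one_lt : 1 < C
  lt_two : C < 2
  enstrophy_le : meanEnstrophy ρ u T₀ T₁ (stokesSpectrum L) ≤ ENNReal.ofReal C *
    meanEnstrophy ρ u T₀ T₁
      {K | K ∈ stokesSpectrum L ∧ (meanVolume u T₀ T₁) ^ (-(1 / 3) : ℝ) ≤ K}

/-- `[K₋, K₊]` is an inertial range on `[T₀, T₁]` of a K41-function with constant `C`. The end
`K₊`, at which the spectrum is evaluated, is an element of the discrete spectrum `Σ`; the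
logarithm of the mean spectrum is defined on the whole range. -/
structure IsInertialRange (ρ : ℝ) (u : ℝ → Torus L → E3) (T₀ T₁ C Kminus Kplus : ℝ) : Prop where
  lt : Kminus < Kplus
  mem : Kplus ∈ stokesSpectrum L
  lower_of_large : 1 / (2 * Real.pi) ^ 3 ≤ meanVolume u T₀ T₁ / torusVolume L →
    Kminus = 2 * Real.pi / L
  lower_of_small : meanVolume u T₀ T₁ / torusVolume L < 1 / (2 * Real.pi) ^ 3 →
    2 * Real.pi / L ≤ Kminus ∧ Kminus ≤ (meanVolume u T₀ T₁) ^ (-(1 / 3) : ℝ)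
  enstrophy_le : meanEnstrophy ρ u T₀ T₁ (stokesSpectrum L) ≤
    ENNReal.ofReal (1 + C) * meanEnstrophy ρ u T₀ T₁ (Icc Kminus Kplus)
  spectrum_pos : ∀ K ∈ stokesSpectrum L, Kminus ≤ K → K ≤ Kplus →
    0 < meanSpectrum ρ u T₀ T₁ K

/-- The spectral Reynolds number `(K₊/K₋)^{4/3}`. -/
def reynolds (Kminus Kplus : ℝ) : ℝ := (Kplus / Kminus) ^ (4 / 3 : ℝ)

/-- The spectral precision: the maximum, over consecutive `K < K'` of `Σ` in `[K₋, K₊]`, of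
`|log(Ē†(K')/Ē†(K)) / log(K'/K) + 5/3|` (and `0` if there is no such pair). -/
def spectralPrecision (ρ : ℝ) (u : ℝ → Torus L → E3) (T₀ T₁ Kminus Kplus : ℝ) : ℝ :=
  sSup {g : ℝ | ∃ K ∈ stokesSpectrum L, ∃ K' ∈ stokesSpectrum L,
    Kminus ≤ K ∧ K < K' ∧ K' ≤ Kplus ∧ (∀ κ ∈ stokesSpectrum L, ¬(K < κ ∧ κ < K')) ∧
    g = |Real.log (meanSpectrum ρ u T₀ T₁ K' / meanSpectrum ρ u T₀ T₁ K) / Real.log (K' / K)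
      + 5 / 3|}

/-- The Kolmogorov constant `α = Ē†(K₊) / (ε̄^{2/3} K₊^{-5/3})`. -/
def kolmogorovConstant (ρ ν : ℝ) (u : ℝ → Torus L → E3) (T₀ T₁ Kplus : ℝ) : ℝ :=
  meanSpectrum ρ u T₀ T₁ Kplus /
    ((meanDissipation ρ ν u T₀ T₁) ^ (2 / 3 : ℝ) * Kplus ^ (-(5 / 3) : ℝ))

/-- The transfer time `𝒯(u₀; ω) = (α³ν²/ρ) ∫_{T₀}^{T₁} ‖ω(t)‖² dt / ‖u₀‖⁴`. -/
def transferTime (ρ ν : ℝ) (u₀ : Torus L → E3) (u : ℝ → Torus L → E3) (T₀ T₁ Kplus : ℝ) : ℝ :=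
  (kolmogorovConstant ρ ν u T₀ T₁ Kplus) ^ 3 * ν ^ 2 / ρ *
    ((∫ t in T₀..T₁, vorticitySq (u t)) / (normSq u₀) ^ 2)

/-- `n₋ = (L K₋ / 2π)²`. -/
def nMinus (L Kminus : ℝ) : ℝ := (L * Kminus / (2 * Real.pi)) ^ 2

/-- `C(n) = Card {z ∈ ℤ³ : |z|² = n} / (8π³√n)`. -/
def latticeConstant (n : ℝ) : ℝ :=
  ({z : Fin 3 → ℤ | ∑ i, (z i : ℝ) ^ 2 = n}.ncard : ℝ) / (8 * Real.pi ^ 3 * Real.sqrt n)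

/-- The asymptotic regime `Re → ∞`, `γ log Re → 0` for pairs `(Re, γ)`. -/
def k41Regime : Filter (ℝ × ℝ) :=
  comap (fun p => p.1) atTop ⊓ comap (fun p => p.2 * Real.log p.1) (𝓝 0)

end

end K41

/-! Group the Fourier modes into shells `|k|² = n`, with `n` a sum of three squares, and let `e(n)`
be the mean energy of a shell. With `κ = 2π/L`, Parseval turns the mean energy into `∑ e(n)` and the
mean of `ρ‖∇u‖²` into `D = ∑ κ² n e(n)`, while `Ē†(κ√n) = (√n/κ) e(n)`. The law `K^(-5/3)` is thus
`e(n) ∼ n^(-4/3)`. By the definition of `γ`, summed over consecutive shells, `e(n) n^(4/3)` stays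
within a factor `G = Re^(3γ/4)` of its value `p` at `K₊` (`MemLeraySpace.shellEnergy_bounds`).

Let the inertial range be `m ≤ n ≤ N`, so that `Re = (N/m)^(2/3)`. Up to `G`, its energy is `p ∑
n^(-4/3) ≍ p m^(-1/3)` and its enstrophy is `p ∑ n^(-1/3) ≍ p N^(2/3)`. Lower bounds with explicit
constants need enough sums of three squares: it suffices that all integers in the five classes 1, 2,
3, 5, 6 modulo 8 are such sums (`exists_sum_three_sq_of_mod_eight`, `window_bounds`).

The range controls the rest of the spectrum. Its enstrophy is at least a third of the total, as `1 +
C < 3`. The energy beyond `N` is at most the remaining enstrophy divided by `N`, in units of `κ²`.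
The energy below `m` is at most an eighth of the total: each mode is bounded by `‖u‖²` in `L¹`,
there are at most `27 m^(3/2)` modes, and `K₋ ≤ V^(-1/3)`; when `K₋ = 2π/L` only the mode 0 is left,
and the mean of `u` vanishes. Eliminating `p` through the definition of `α`, one finds `Ē²`
comparable to `Re α³ ν ε̄`, and `α³ ν³ Re³` bounded by a multiple of `L⁴ ε̄`
(`IsInertialRange.estimates`).

Since `‖ω‖² = 2‖∇u‖²` for divergence-free fields, `𝒯 = α³ ν ε̄ (T₁ - T₀) / E₀²`. The comparison of
`Ē²` is then the second conclusion. The first follows with `Ē ≤ E₀` and `ε̄ (T₁ - T₀) ≤ E₀`, two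
consequences of the energy inequality. -/

/-! ### Sums of three squares -/

theorem exists_int_vec_sum_sq_lt_two (M : Matrix (Fin 3) (Fin 3) ℝ) (hM : M.det = 1) :
    ∃ v : Fin 3 → ℤ, v ≠ 0 ∧ ∑ i, (M.mulVec (fun j => (v j : ℝ))) i ^ 2 < 2 := by
  classical
  set T : Set (Fin 3 → ℝ) := {w | ∑ i, w i ^ 2 < 2} with hT
  have hTball : (WithLp.ofLp : EuclideanSpace ℝ (Fin 3) → (Fin 3 → ℝ)) ⁻¹' T
      = Metric.ball (0 : EuclideanSpace ℝ (Fin 3)) (Real.sqrt 2) := by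
    ext w
    simp only [hT, mem_preimage, mem_ofPred_eq, mem_ball_zero_iff, EuclideanSpace.norm_eq,
      Real.norm_eq_abs, sq_abs]
    rw [Real.sqrt_lt_sqrt_iff (Finset.sum_nonneg fun i _ => sq_nonneg _)]
  have hTopen : IsOpen T := isOpen_lt (by fun_prop) continuous_const
  have hTvol : volume T = ENNReal.ofReal (Real.sqrt 2) ^ 3 * ENNReal.ofReal (Real.pi * 4 / 3) := by
    rw [← (EuclideanSpace.volume_preserving_symm_measurableEquiv_toLp (Fin 3)).measure_preimage
      hTopen.measurableSet.nullMeasurableSet]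
    exact (congrArg volume hTball).trans (EuclideanSpace.volume_ball_fin_three 0 _)
  have hTconv : Convex ℝ T := by
    have : T = (EuclideanSpace.equiv (Fin 3) ℝ).symm.toLinearMap ⁻¹'
        Metric.ball (0 : EuclideanSpace ℝ (Fin 3)) (Real.sqrt 2) := by
      rw [← hTball]; rfl
    rw [this]
    exact (convex_ball _ _).linear_preimage _
  set s : Set (Fin 3 → ℝ) := (Matrix.toLin' M) ⁻¹' T with hs
  have hsvol : volume s = volume T := by
    rw [hs, Measure.addHaar_preimage_linearMap]
    · simp [hM]
    · simp [hM]
  have hsconv : Convex ℝ s := hTconv.linear_preimage _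
  have hsymm : ∀ x ∈ s, -x ∈ s := by
    intro x hx
    simp only [hs, hT, mem_preimage, mem_ofPred_eq, map_neg, Pi.neg_apply, neg_sq] at hx ⊢
    exact hx
  have hfund := ZSpan.isAddFundamentalDomain' (Pi.basisFun ℝ (Fin 3)) volume
  have : Countable (Submodule.span ℤ (range (Pi.basisFun ℝ (Fin 3)))).toAddSubgroup :=
    inferInstanceAs (Countable (Submodule.span ℤ (range (Pi.basisFun ℝ (Fin 3)))))
  -- Minkowski's theorem applies because the ball of radius `√2` has volume `(4π/3)·2√2 > 8 = 2³`,
  -- and `M` preserves volume.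
  obtain ⟨x, hx0, hx⟩ := exists_ne_zero_mem_lattice_of_measure_mul_two_pow_lt_measure
    hfund hsymm hsconv (by
      rw [ZSpan.fundamentalDomain_pi_basisFun, hsvol, hTvol, Real.volume_pi_Ico]
      simp only [sub_zero, ENNReal.ofReal_one, Finset.prod_const_one, one_mul,
        Module.finrank_fin_fun]
      rw [← ENNReal.ofReal_pow (Real.sqrt_nonneg 2), ← ENNReal.ofReal_mul (by positivity)]
      rw [ENNReal.lt_ofReal_iff_toReal_lt (by simp)]
      have h3 := Real.pi_gt_three
      have h2 : (1.414 : ℝ) < Real.sqrt 2 := Real.lt_sqrt_of_sq_lt (by norm_num)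
      have h4 : Real.sqrt 2 ^ 3 = 2 * Real.sqrt 2 := by
        rw [pow_succ, Real.sq_sqrt (by norm_num)]
      rw [h4]
      norm_num
      nlinarith)
  have hmem : (x : Fin 3 → ℝ) ∈ Submodule.span ℤ (range (Pi.basisFun ℝ (Fin 3))) := x.2
  rw [(Pi.basisFun ℝ (Fin 3)).mem_span_iff_repr_mem ℤ _] at hmem
  simp only [Pi.basisFun_repr, Set.mem_range] at hmem
  choose v hv using hmem
  have hxv : (x : Fin 3 → ℝ) = fun j => (v j : ℝ) := by
    ext j; rw [← hv j]; rfl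
  refine ⟨v, ?_, ?_⟩
  · rintro rfl
    apply hx0
    ext j
    simp [hxv]
  · rw [hxv] at hx
    exact hx

/-- The hypothesis makes `-1` a square modulo `q`, so `q` is a sum of two squares; the factor `g²`
is absorbed. -/
theorem isSumSq_of_mul_sub_sq_eq_one {g q c b : ℤ} (hq : 0 ≤ q) (h : q * c - b ^ 2 = 1) :
    ∃ x y : ℤ, g ^ 2 * q = x ^ 2 + y ^ 2 := by
  obtain ⟨q, rfl⟩ := Int.eq_ofNat_of_zero_le hq
  have h1 : IsSquare (-1 : ZMod q) := by
    refine ⟨(b : ZMod q), ?_⟩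
    have := congrArg (Int.cast : ℤ → ZMod q) h
    push_cast at this
    simp only [CharP.cast_eq_zero, zero_mul, zero_sub] at this
    rw [← this]; ring
  obtain ⟨x, y, hxy⟩ := Nat.eq_sq_add_sq_of_isSquare_mod_neg_one h1
  refine ⟨g * x, g * y, ?_⟩
  rw [hxy]; push_cast; ring

/-- The form with Gram matrix `[[a, b, 1], [b, c, 0], [1, 0, n]]` has leading minors `a`, `d` and
`nd - c = 1`, so it is positive definite of determinant 1, and it takes the value `n` at the third
basis vector. Minkowski gives an integer vector of value 1, which splits off orthogonally; on the
complement the form has determinant 1 and represents only sums of two squares. -/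
theorem exists_sum_three_sq_of_form {a b c n d : ℤ} (ha : 0 < a) (hd : 0 < d)
    (habc : a * c - b ^ 2 = d) (hn : n * d - c = 1) :
    ∃ x y z : ℤ, n = x ^ 2 + y ^ 2 + z ^ 2 := by
  have haR : (0 : ℝ) < a := by exact_mod_cast ha
  have hdR : (0 : ℝ) < d := by exact_mod_cast hd
  have habcR : (a : ℝ) * c - b ^ 2 = d := by exact_mod_cast habc
  have hnR : (n : ℝ) * d - c = 1 := by exact_mod_cast hn
  -- the form in diagonal shape
  have hdiag : ∀ x y z : ℝ, a * x ^ 2 + 2 * b * x * y + c * y ^ 2 + 2 * x * z + n * z ^ 2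
      = (a * x + b * y + z) ^ 2 / a + (d * y - b * z) ^ 2 / (a * d) + z ^ 2 / d := by
    intro x y z
    have hc : (c : ℝ) = (d + b ^ 2) / a := by field_simp; linarith
    have hn' : (n : ℝ) = (1 + c) / d := by field_simp; linarith
    rw [hn', hc]
    field_simp
    ring
  set sa := Real.sqrt a
  set sd := Real.sqrt d
  have hsa : sa ^ 2 = a := Real.sq_sqrt haR.le
  have hsd : sd ^ 2 = d := Real.sq_sqrt hdR.le
  have hsa0 : sa ≠ 0 := (Real.sqrt_pos.2 haR).ne'
  have hsd0 : sd ≠ 0 := (Real.sqrt_pos.2 hdR).ne'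
  -- The triangular matrix is the square root of the Gram matrix read off from `hdiag`, so the
  -- squared length of its image of `v` is `Q v`.
  obtain ⟨v, hv0, hv⟩ := exists_int_vec_sum_sq_lt_two
    !![sa, b / sa, 1 / sa; 0, sd / sa, - b / (sa * sd); 0, 0, 1 / sd] (by
      rw [Matrix.det_fin_three]; simp; field_simp)
  set Q : ℤ → ℤ → ℤ → ℤ := fun x y z =>
    a * x ^ 2 + 2 * b * x * y + c * y ^ 2 + 2 * x * z + n * z ^ 2 with hQ
  have hQpos : ∀ x y z : ℤ, 0 ≤ Q x y z := by
    intro x y z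
    have : (0 : ℝ) ≤ (Q x y z : ℤ) := by
      simp only [hQ]; push_cast
      rw [hdiag]; positivity
    exact_mod_cast this
  have hQ2 : Q (v 0) (v 1) (v 2) < 2 := by
    have : ((Q (v 0) (v 1) (v 2) : ℤ) : ℝ) < 2 := by
      refine lt_of_eq_of_lt ?_ hv
      simp only [hQ, Fin.sum_univ_three, Matrix.mulVec, dotProduct]
      simp
      rw [hdiag, ← hsa, ← hsd]
      field_simp
      ring
    exact_mod_cast this
  have hQne : Q (v 0) (v 1) (v 2) ≠ 0 := by
    intro h0
    have h0' : ((Q (v 0) (v 1) (v 2) : ℤ) : ℝ) = 0 := by exact_mod_cast h0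
    simp only [hQ] at h0'
    push_cast at h0'
    rw [hdiag] at h0'
    have p1 : 0 ≤ ((a : ℝ) * v 0 + b * v 1 + v 2) ^ 2 / a := by positivity
    have p2 : 0 ≤ ((d : ℝ) * v 1 - b * v 2) ^ 2 / (a * d) := by positivity
    have p3 : 0 ≤ ((v 2 : ℝ)) ^ 2 / d := by positivity
    have e3 : ((v 2 : ℝ)) ^ 2 / d = 0 := by linarith
    have e2 : ((d : ℝ) * v 1 - b * v 2) ^ 2 / (a * d) = 0 := by linarith
    have e1 : ((a : ℝ) * v 0 + b * v 1 + v 2) ^ 2 / a = 0 := by linarith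
    have z2 : (v 2 : ℝ) = 0 := by simpa [hdR.ne'] using e3
    have z1 : (v 1 : ℝ) = 0 := by simpa [hdR.ne', haR.ne', z2] using e2
    have z0 : (v 0 : ℝ) = 0 := by simpa [hdR.ne', haR.ne', z2, z1] using e1
    apply hv0
    ext i
    fin_cases i
    · exact_mod_cast z0
    · exact_mod_cast z1
    · exact_mod_cast z2
  have hQ1 : Q (v 0) (v 1) (v 2) = 1 := by
    have := hQpos (v 0) (v 1) (v 2)
    omega
  set x := v 0
  set y := v 1
  set z := v 2
  -- the linear form dual to `v`
  set β1 := a * x + b * y + z with hβ1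
  set β2 := b * x + c * y with hβ2
  set β3 := x + n * z with hβ3
  have hβv : β1 * x + β2 * y + β3 * z = 1 := by
    rw [← hQ1]; simp only [hQ, hβ1, hβ2, hβ3]; ring
  -- Pythagoras for the third basis vector, written as `β3 • v` plus a vector orthogonal to `v`.
  have hnβ : n = β3 ^ 2 + Q (-β3 * x) (-β3 * y) (1 - β3 * z) := by
    have : Q (-β3 * x) (-β3 * y) (1 - β3 * z) = β3 ^ 2 * Q x y z - 2 * β3 * β3 + n := by
      simp only [hQ, hβ3]; ring
    rw [this, hQ1]; ring
  -- the component orthogonal to `v`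
  by_cases hw : -β3 * x = 0 ∧ -β3 * y = 0 ∧ 1 - β3 * z = 0
  · refine ⟨β3, 0, 0, ?_⟩
    rw [hw.1, hw.2.1, hw.2.2] at hnβ
    rw [hnβ]; simp [hQ]
  set w1 := -β3 * x with hw1
  set w2 := -β3 * y with hw2
  set w3 := 1 - β3 * z with hw3
  have hβw : β1 * w1 + β2 * w2 + β3 * w3 = 0 := by
    rw [hw1, hw2, hw3]
    linear_combination (-β3) * hβv
  obtain ⟨g, y1, y2, y3, s1, s2, s3, hg, e1, e2, e3, hs⟩ : ∃ g y1 y2 y3 s1 s2 s3 : ℤ, g ≠ 0 ∧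
      w1 = g * y1 ∧ w2 = g * y2 ∧ w3 = g * y3 ∧ s1 * y1 + s2 * y2 + s3 * y3 = 1 := by
    set g1 := (Int.gcd w1 w2 : ℤ) with hg1
    set g := (Int.gcd g1 w3 : ℤ) with hg
    have dg1 : g ∣ g1 := Int.gcd_dvd_left ..
    have d1 : g ∣ w1 := dg1.trans (Int.gcd_dvd_left ..)
    have d2 : g ∣ w2 := dg1.trans (Int.gcd_dvd_right ..)
    have d3 : g ∣ w3 := Int.gcd_dvd_right ..
    have b1 : g1 = w1 * Int.gcdA w1 w2 + w2 * Int.gcdB w1 w2 := Int.gcd_eq_gcd_ab _ _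
    have b2 : g = g1 * Int.gcdA g1 w3 + w3 * Int.gcdB g1 w3 := Int.gcd_eq_gcd_ab _ _
    obtain ⟨y1, e1⟩ := d1
    obtain ⟨y2, e2⟩ := d2
    obtain ⟨y3, e3⟩ := d3
    have hg0 : g ≠ 0 := by
      intro h; apply hw
      rw [e1, e2, e3, h]; simp
    refine ⟨g, y1, y2, y3, Int.gcdA w1 w2 * Int.gcdA g1 w3, Int.gcdB w1 w2 * Int.gcdA g1 w3,
      Int.gcdB g1 w3, hg0, e1, e2, e3, ?_⟩
    apply mul_left_cancel₀ hg0
    linear_combination (-Int.gcdA w1 w2 * Int.gcdA g1 w3) * e1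
      - Int.gcdB w1 w2 * Int.gcdA g1 w3 * e2 - Int.gcdB g1 w3 * e3
      - Int.gcdA g1 w3 * b1 - b2
  have hβy : β1 * y1 + β2 * y2 + β3 * y3 = 0 := by
    apply mul_left_cancel₀ hg
    rw [e1, e2, e3] at hβw
    linear_combination hβw
  -- complete `v, y` to a basis by the vector `β × s`
  set z1 := β2 * s3 - β3 * s2 with hz1
  set z2 := β3 * s1 - β1 * s3 with hz2
  set z3 := β1 * s2 - β2 * s1 with hz3
  have hdet : x * (y2 * z3 - y3 * z2) - y * (y1 * z3 - y3 * z1) + z * (y1 * z2 - y2 * z1) = 1 := by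
    have : x * (y2 * z3 - y3 * z2) - y * (y1 * z3 - y3 * z1) + z * (y1 * z2 - y2 * z1)
        = (β1 * x + β2 * y + β3 * z) * (s1 * y1 + s2 * y2 + s3 * y3)
          - (β1 * y1 + β2 * y2 + β3 * y3) * (s1 * x + s2 * y + s3 * z) := by
      rw [hz1, hz2, hz3]; ring
    rw [this, hβv, hs, hβy]; ring
  set bz := β1 * z1 + β2 * z2 + β3 * z3 with hbz
  set byz := y1 * (a * z1 + b * z2 + z3) + y2 * (b * z1 + c * z2) + y3 * (z1 + n * z3) with hbyz
  -- The Gram determinant of three vectors is the determinant of the form times the square of their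
  -- determinant. With `Q v = 1` and `y` orthogonal to `v` it becomes `Q y * (Q z - bz²) - byz² =
  -- 1`.
  have hgram : Q x y z * (Q y1 y2 y3 * Q z1 z2 z3 - byz ^ 2)
      - (β1 * y1 + β2 * y2 + β3 * y3) * ((β1 * y1 + β2 * y2 + β3 * y3) * Q z1 z2 z3 - byz * bz)
      + bz * ((β1 * y1 + β2 * y2 + β3 * y3) * byz - Q y1 y2 y3 * bz)
      = (n * (a * c - b ^ 2) - c) *
        (x * (y2 * z3 - y3 * z2) - y * (y1 * z3 - y3 * z1) + z * (y1 * z2 - y2 * z1)) ^ 2 := by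
    rw [hbz, hbyz, hβ1, hβ2, hβ3]
    clear_value z1 z2 z3
    simp only [hQ]
    ring
  rw [hdet, habc, hn, hQ1, hβy] at hgram
  obtain ⟨p, q, hpq⟩ := isSumSq_of_mul_sub_sq_eq_one (g := g) (q := Q y1 y2 y3)
    (c := Q z1 z2 z3 - bz ^ 2) (b := byz) (hQpos _ _ _) (by linear_combination hgram)
  refine ⟨β3, p, q, ?_⟩
  have : Q w1 w2 w3 = g ^ 2 * Q y1 y2 y3 := by
    rw [e1, e2, e3]; simp only [hQ]; ring
  rw [this, hpq] at hnβ
  linarith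

/-- Dirichlet's reduction: take `c = dn - 1` and let `a` be the quotient, so that `ac - b² = d`.
What remains is to choose `d` with `-d` a square modulo `dn - 1`. -/
theorem exists_sum_three_sq_of_dvd {n d : ℕ} {b : ℤ} (hd : 0 < d) (hnd : 2 ≤ d * n)
    (h : (d * n - 1 : ℤ) ∣ b ^ 2 + d) : ∃ x y z : ℤ, (n : ℤ) = x ^ 2 + y ^ 2 + z ^ 2 := by
  obtain ⟨a, ha⟩ := h
  have hnd' : (2 : ℤ) ≤ d * n := by exact_mod_cast hnd
  have hd' : (0 : ℤ) < d := by exact_mod_cast hd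
  refine exists_sum_three_sq_of_form (a := a) (b := b) (c := d * n - 1) (d := d) ?_ hd' ?_ (by ring)
  · by_contra! h0
    have : (0 : ℤ) < b ^ 2 + d := by positivity
    nlinarith
  · linear_combination -ha

theorem exists_prime_eq_add_mul {q a : ℕ} (hq : 0 < q) (h : Nat.Coprime a q) (haq : a < q) :
    ∃ p j : ℕ, p.Prime ∧ p = a + q * j ∧ q < p := by
  have : NeZero q := ⟨hq.ne'⟩
  obtain ⟨p, hp, hpp, he⟩ := Nat.forall_exists_prime_gt_and_eq_mod
    ((ZMod.isUnit_iff_coprime a q).2 h) q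
  rw [ZMod.natCast_eq_natCast_iff] at he
  obtain ⟨j, hj⟩ := (Nat.modEq_iff_dvd' (haq.le.trans hp.le)).1 he.symm
  exact ⟨p, j, hpp, by omega, hp⟩

theorem exists_int_sq_add_dvd_of_jacobiSym {p d : ℕ} (hp : p.Prime)
    (h : jacobiSym (-(d : ℤ)) p = 1) : ∃ b : ℤ, (p : ℤ) ∣ b ^ 2 + d := by
  have := Fact.mk hp
  obtain ⟨r, hr⟩ := ZMod.isSquare_of_jacobiSym_eq_one h
  obtain ⟨b, rfl⟩ := ZMod.intCast_surjective r
  refine ⟨b, (ZMod.intCast_zmod_eq_zero_iff_dvd _ _).1 ?_⟩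
  push_cast at hr ⊢
  rw [pow_two, ← hr]; ring

/-- Dirichlet's theorem on primes provides `d = 4j + 1` with `p = dn - 1` prime. Here `p ≡ 1` modulo
4 and `p ≡ -1` modulo `d`, so by reciprocity `(-d/p) = (d/p) = (p/d) = (-1/d) = 1`. -/
theorem exists_sum_three_sq_of_mod_four {n : ℕ} (hn : n % 4 = 2) :
    ∃ x y z : ℤ, (n : ℤ) = x ^ 2 + y ^ 2 + z ^ 2 := by
  have hcop : Nat.Coprime (n - 1) (4 * n) := by
    refine Nat.Coprime.mul_right ?_ ?_
    · exact Nat.Coprime.pow_right 2 (Nat.coprime_two_right.2 (Nat.odd_iff.2 (by omega)))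
    · rw [Nat.coprime_comm]
      have := (Nat.coprime_self_add_right (m := n - 1) (n := 1)).2 (by simp)
      rw [Nat.sub_add_cancel (by omega)] at this
      exact this.symm
  obtain ⟨p, j, hp, hpj, hlt⟩ := exists_prime_eq_add_mul (by omega) hcop (by omega)
  have hpd : p + 1 = (4 * j + 1) * n := by
    rw [hpj]; zify [show 1 ≤ n by omega]; ring
  have hp4 : p % 4 = 1 := by
    rw [hpj, mul_assoc, Nat.add_mul_mod_self_left]; omega
  have hd4 : (4 * j + 1) % 4 = 1 := by omega
  have hpo : Odd p := Nat.odd_iff.2 (by omega)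
  have hdo : Odd (4 * j + 1) := Nat.odd_iff.2 (by omega)
  have hJ : jacobiSym (-((4 * j + 1 : ℕ) : ℤ)) p = 1 := by
    rw [jacobiSym.neg _ hpo, ZMod.χ₄_nat_one_mod_four hp4, one_mul,
      jacobiSym.quadratic_reciprocity_one_mod_four hd4 hpo,
      jacobiSym.mod_left' (a₂ := -1) (by
        apply Int.ModEq.eq
        apply Int.ModEq.symm
        rw [Int.modEq_iff_dvd]
        exact ⟨n, by rw [sub_neg_eq_add]; exact_mod_cast hpd⟩),
      jacobiSym.at_neg_one hdo, ZMod.χ₄_nat_one_mod_four hd4]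
  obtain ⟨b, hb⟩ := exists_int_sq_add_dvd_of_jacobiSym hp hJ
  have hp2 := hp.two_le
  refine exists_sum_three_sq_of_dvd (d := 4 * j + 1) (b := b) (by omega) (by omega) ?_
  have : (((4 * j + 1 : ℕ) : ℤ) * n - 1) = p := by
    have : ((p + 1 : ℕ) : ℤ) = ((4 * j + 1) * n : ℕ) := by rw [hpd]
    push_cast at this ⊢
    linarith
  rwa [this]

/-- Now `dn - 1 = 2p` with `p` prime and `d ≡ 1` or `3` modulo 8. As `-2p ≡ 1` modulo `d` and
`(-2/d) = 1`, also `(p/d) = 1`, and reciprocity gives `(-d/p) = 1`. -/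
theorem exists_sum_three_sq_of_odd {n : ℕ} (hn : n % 8 = 1 ∨ n % 8 = 3 ∨ n % 8 = 5) :
    ∃ x y z : ℤ, (n : ℤ) = x ^ 2 + y ^ 2 + z ^ 2 := by
  -- `c` is the residue of `d` modulo 8 and `a` that of `p` modulo `4n`. When `p ≡ 3` modulo 4 one
  -- needs `d ≡ 3` as well, so that the signs in `(-1/p)` and in reciprocity cancel.
  obtain ⟨c, a, hca, hc, hca4, ha⟩ : ∃ c a : ℕ, c * n = 2 * a + 1 ∧ (c = 1 ∨ c = 3) ∧
      (a % 4 = 1 ∨ a % 4 = 3 ∧ c = 3) ∧ a < 4 * n := by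
    rcases hn with h | h | h
    · exact ⟨3, (3 * n - 1) / 2, by omega, by omega, by omega, by omega⟩
    · exact ⟨1, (n - 1) / 2, by omega, by omega, by omega, by omega⟩
    · exact ⟨3, (3 * n - 1) / 2, by omega, by omega, by omega, by omega⟩
  have hcop : Nat.Coprime a (4 * n) := by
    refine Nat.Coprime.mul_right ?_ ?_
    · exact Nat.Coprime.pow_right 2 (Nat.coprime_two_right.2 (Nat.odd_iff.2 (by omega)))
    · have h1 : Nat.Coprime (2 * a) (c * n) := by rw [hca]; simp
      exact (h1.coprime_dvd_left (Dvd.intro_left 2 rfl)).coprime_dvd_right (Dvd.intro_left c rfl)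
  obtain ⟨p, j, hp, hpj, hlt⟩ := exists_prime_eq_add_mul (by omega) hcop ha
  have hpd : 2 * p + 1 = (8 * j + c) * n := by
    rw [hpj, add_mul, hca]; ring
  have hp4 : p % 4 = a % 4 := by
    rw [hpj, mul_assoc, Nat.add_mul_mod_self_left]
  have hpo : Odd p := Nat.odd_iff.2 (by omega)
  have hdo : Odd (8 * j + c) := Nat.odd_iff.2 (by omega)
  have hpJ : jacobiSym (p : ℤ) (8 * j + c) = 1 := by
    have h2 : jacobiSym (-2 : ℤ) (8 * j + c) * jacobiSym (p : ℤ) (8 * j + c) = 1 := by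
      rw [← jacobiSym.mul_left, jacobiSym.mod_left' (a₂ := 1) (by
        apply Int.ModEq.eq
        rw [Int.modEq_iff_dvd]
        refine ⟨n, ?_⟩
        have : ((2 * p + 1 : ℕ) : ℤ) = ((8 * j + c) * n : ℕ) := by rw [hpd]
        push_cast at this ⊢
        linarith), jacobiSym.one_left]
    have h3 : jacobiSym (-2 : ℤ) (8 * j + c) = 1 := by
      rw [jacobiSym.at_neg_two hdo, ZMod.χ₈'_nat_eq_if_mod_eight]
      have : (8 * j + c) % 8 = c := by omega
      rw [this]
      rcases hc with rfl | rfl <;> norm_num <;> omega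
    rwa [h3, one_mul] at h2
  have hJ : jacobiSym (-((8 * j + c : ℕ) : ℤ)) p = 1 := by
    rw [jacobiSym.neg _ hpo]
    rcases hca4 with h | ⟨h, h'⟩
    · rw [ZMod.χ₄_nat_one_mod_four (by omega), one_mul,
        jacobiSym.quadratic_reciprocity_one_mod_four' hdo (by omega), hpJ]
    · rw [ZMod.χ₄_nat_three_mod_four (by omega),
        jacobiSym.quadratic_reciprocity_three_mod_four (by omega) (by omega), hpJ]
      norm_num
  obtain ⟨b, hb⟩ := exists_int_sq_add_dvd_of_jacobiSym hp hJ
  have hp2 := hp.two_le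
  -- Divisibility by 2 requires `b` odd, since `d` is odd; adding the odd `p` changes the parity of
  -- `b` and not its class modulo `p`.
  obtain ⟨b', hb', hodd⟩ : ∃ b' : ℤ, (p : ℤ) ∣ b' ^ 2 + (8 * j + c : ℕ) ∧ Odd b' := by
    rcases Int.even_or_odd b with he | ho
    · refine ⟨b + p, ?_, he.add_odd (by exact_mod_cast hpo)⟩
      have : (b + p) ^ 2 + ((8 * j + c : ℕ) : ℤ)
          = (b ^ 2 + ((8 * j + c : ℕ) : ℤ)) + p * (2 * b + p) := by ring
      rw [this]
      exact dvd_add hb (Dvd.intro _ rfl)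
    · exact ⟨b, hb, ho⟩
  refine exists_sum_three_sq_of_dvd (d := 8 * j + c) (b := b') (by omega) (by omega) ?_
  have : (((8 * j + c : ℕ) : ℤ) * n - 1) = 2 * p := by
    have : ((2 * p + 1 : ℕ) : ℤ) = ((8 * j + c) * n : ℕ) := by rw [hpd]
    push_cast at this ⊢
    linarith
  rw [this]
  refine IsCoprime.mul_dvd ?_ ?_ hb'
  · rw [Int.isCoprime_iff_gcd_eq_one]
    exact_mod_cast Nat.coprime_two_left.2 hpo
  · have : Even (b' ^ 2 + ((8 * j + c : ℕ) : ℤ)) := by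
      refine hodd.pow.add_odd ?_
      exact_mod_cast hdo
    exact this.two_dvd

theorem exists_sum_three_sq_of_mod_eight {n : ℕ}
    (hn : n % 8 = 1 ∨ n % 8 = 2 ∨ n % 8 = 3 ∨ n % 8 = 5 ∨ n % 8 = 6) :
    ∃ v : Fin 3 → ℤ, ∑ i, v i ^ 2 = (n : ℤ) := by
  obtain ⟨x, y, z, h⟩ : ∃ x y z : ℤ, (n : ℤ) = x ^ 2 + y ^ 2 + z ^ 2 := by
    by_cases h4 : n % 4 = 2
    · exact exists_sum_three_sq_of_mod_four h4
    · exact exists_sum_three_sq_of_odd (by omega)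
  exact ⟨![x, y, z], by simp [Fin.sum_univ_three, h]⟩

/-! ### Power sums over the sums of three squares in a window -/

/-- In terms of a cube root all the exponents that occur become integers, and inequalities between
powers become polynomial. -/
theorem exists_cbrt {t : ℝ} (ht : 0 ≤ t) : ∃ a : ℝ, 0 ≤ a ∧ (0 < t → 0 < a) ∧ t = a ^ 3 ∧
    t ^ (-(1 / 3) : ℝ) = a⁻¹ ∧ t ^ (-(4 / 3) : ℝ) = (a ^ 4)⁻¹ ∧ t ^ (2 / 3 : ℝ) = a ^ 2 := by
  refine ⟨t ^ (1 / 3 : ℝ), by positivity, fun h => by positivity, ?_, ?_, ?_, ?_⟩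
  · rw [← Real.rpow_natCast, ← Real.rpow_mul ht]; norm_num
  · rw [Real.rpow_neg ht]
  · rw [Real.rpow_neg ht, ← Real.rpow_natCast, ← Real.rpow_mul ht]; norm_num
  · rw [← Real.rpow_natCast, ← Real.rpow_mul ht]; norm_num

/-- The left side is the mean of `s ^ (-4/3)` over `[t, t + 8]`, and that function decreases. The
next lemma is the same for `s ^ (-1/3)`. -/
theorem rpow_neg_four_thirds_ge {t : ℝ} (ht : 0 < t) :
    -(3 / 8) * (t + 8) ^ (-(1 / 3) : ℝ) - -(3 / 8) * t ^ (-(1 / 3) : ℝ) ≤ t ^ (-(4 / 3) : ℝ) := by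
  obtain ⟨a, -, ha, h1, h2, h3, -⟩ := exists_cbrt ht.le
  obtain ⟨b, -, hb, k1, k2, k3, -⟩ := exists_cbrt (show 0 ≤ t + 8 by linarith)
  have ha := ha ht
  have hb := hb (by linarith)
  have hab : a < b := lt_of_pow_lt_pow_left₀ 3 hb.le (by linarith)
  rw [h2, h3, k2, show -(3 / 8) * b⁻¹ - -(3 / 8) * a⁻¹ = 3 / 8 * (b - a) / (a * b) by
    field_simp; ring, div_le_iff₀ (by positivity), inv_mul_eq_div, le_div_iff₀ (by positivity)]
  have h8 : (8 : ℝ) = b ^ 3 - a ^ 3 := by linarith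
  have : 3 * (b - a) * a ^ 4 ≤ (b ^ 3 - a ^ 3) * (a * b) := by
    have hf : (b ^ 3 - a ^ 3) * (a * b) - 3 * (b - a) * a ^ 4
        = a * (b - a) * (b * (b - a) * (b + 2 * a) + 3 * a ^ 2 * (b - a)) := by ring
    have : 0 ≤ a * (b - a) * (b * (b - a) * (b + 2 * a) + 3 * a ^ 2 * (b - a)) := by
      have : 0 < b - a := by linarith
      positivity
    linarith
  rw [← h8] at this
  linarith

theorem rpow_neg_one_third_ge {t : ℝ} (ht : 0 < t) :
    3 / 16 * (t + 8) ^ (2 / 3 : ℝ) - 3 / 16 * t ^ (2 / 3 : ℝ) ≤ t ^ (-(1 / 3) : ℝ) := by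
  obtain ⟨a, -, ha, h1, h2, -, h3⟩ := exists_cbrt ht.le
  obtain ⟨b, -, hb, k1, k2, -, k3⟩ := exists_cbrt (show 0 ≤ t + 8 by linarith)
  have ha := ha ht
  have hb := hb (by linarith)
  have hab : a < b := lt_of_pow_lt_pow_left₀ 3 hb.le (by linarith)
  rw [h2, h3, k3, ← one_div, le_div_iff₀ ha]
  have h8 : (8 : ℝ) = b ^ 3 - a ^ 3 := by linarith
  have : 0 ≤ (b - a) ^ 2 * (2 * b + a) := by positivity
  nlinarith

/-- The value at the right end of `[t, t + 1]` is at most the integral of a decreasing function.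
With step 1 this gives upper bounds that count every integer. -/
theorem rpow_neg_four_thirds_le {t : ℝ} (ht : 0 < t) :
    (t + 1) ^ (-(4 / 3) : ℝ) ≤ 3 * t ^ (-(1 / 3) : ℝ) - 3 * (t + 1) ^ (-(1 / 3) : ℝ) := by
  obtain ⟨a, -, ha, h1, h2, h3, -⟩ := exists_cbrt ht.le
  obtain ⟨b, -, hb, k1, k2, k3, -⟩ := exists_cbrt (show 0 ≤ t + 1 by linarith)
  have ha := ha ht
  have hb := hb (by linarith)
  have hab : a < b := lt_of_pow_lt_pow_left₀ 3 hb.le (by linarith)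
  rw [h2, k3, k2, show 3 * a⁻¹ - 3 * b⁻¹ = 3 * (b - a) / (a * b) by
    field_simp, le_div_iff₀ (by positivity), inv_mul_eq_div, div_le_iff₀ (by positivity)]
  have h8 : (1 : ℝ) = b ^ 3 - a ^ 3 := by linarith
  have : (b ^ 3 - a ^ 3) * (a * b) ≤ 3 * (b - a) * b ^ 4 := by
    have hf : 3 * (b - a) * b ^ 4 - (b ^ 3 - a ^ 3) * (a * b)
        = b * (b - a) * ((b - a) * (3 * b ^ 2 + 2 * a * b + a ^ 2)) := by ring
    have : 0 ≤ b * (b - a) * ((b - a) * (3 * b ^ 2 + 2 * a * b + a ^ 2)) := by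
      have : 0 < b - a := by linarith
      positivity
    linarith
  rw [← h8] at this
  linarith

theorem rpow_neg_one_third_le {t : ℝ} (ht : 0 ≤ t) :
    (t + 1) ^ (-(1 / 3) : ℝ) ≤ 3 / 2 * (t + 1) ^ (2 / 3 : ℝ) - 3 / 2 * t ^ (2 / 3 : ℝ) := by
  obtain ⟨a, ha, -, h1, h2, -, h3⟩ := exists_cbrt ht
  obtain ⟨b, -, hb, k1, k2, -, k3⟩ := exists_cbrt (show 0 ≤ t + 1 by linarith)
  have hb := hb (by linarith)
  have hab : a < b := lt_of_pow_lt_pow_left₀ 3 hb.le (by linarith)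
  rw [k2, h3, k3, ← one_div, div_le_iff₀ hb]
  have h8 : (1 : ℝ) = b ^ 3 - a ^ 3 := by linarith
  have : 0 ≤ (b - a) ^ 2 * (b + 2 * a) := by positivity
  nlinarith

/-- `n` is a sum of three integer squares. -/
def IsSumThreeSq (n : ℕ) : Prop := ∃ v : Fin 3 → ℤ, ∑ i, v i ^ 2 = (n : ℤ)

open Classical in
/-- The sums of three squares in `[m, N]`. -/
noncomputable def threeSqWindow (m : ℝ) (N : ℕ) : Finset ℕ :=
  (Finset.range (N + 1)).filter fun n : ℕ => m ≤ n ∧ IsSumThreeSq n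

theorem mem_threeSqWindow {m : ℝ} {N n : ℕ} :
    n ∈ threeSqWindow m N ↔ n ≤ N ∧ m ≤ n ∧ IsSumThreeSq n := by
  simp [threeSqWindow]

/-- Telescoping over an arithmetic progression of step `8`. -/
theorem sub_le_sum_residue {f F : ℝ → ℝ} (hf : ∀ t, 0 < t → 0 ≤ f t)
    (hF : MonotoneOn F (Ioi 0)) (hfF : ∀ t, 0 < t → F (t + 8) - F t ≤ f t)
    {m : ℝ} (hm : 1 ≤ m) {N k : ℕ} (hk : m ≤ k) (hN : 0 < N) :
    F N - F k ≤ ∑ n ∈ (Finset.range (N + 1)).filter (fun n : ℕ => m ≤ n ∧ n % 8 = k % 8), f n := by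
  have hk0 : (0 : ℝ) < k := by linarith
  have hpos : ∀ n ∈ (Finset.range (N + 1)).filter (fun n : ℕ => m ≤ n ∧ n % 8 = k % 8),
      0 ≤ f n := by
    intro n hn
    simp only [Finset.mem_filter] at hn
    exact hf _ (by linarith)
  rcases lt_or_ge N k with h | h
  · have : F N ≤ F k := hF (by simpa using hN) hk0 (by exact_mod_cast h.le)
    linarith [Finset.sum_nonneg hpos]
  · have htel : ∀ J : ℕ, F ((k + 8 * J : ℕ) : ℝ) - F k
        ≤ ∑ j ∈ Finset.range J, f ((k + 8 * j : ℕ) : ℝ) := by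
      intro J
      induction J with
      | zero => simp
      | succ J ih =>
        rw [Finset.sum_range_succ]
        have := hfF ((k + 8 * J : ℕ) : ℝ) (by push_cast; positivity)
        have e : (((k + 8 * (J + 1) : ℕ)) : ℝ) = ((k + 8 * J : ℕ) : ℝ) + 8 := by push_cast; ring
        rw [e]; linarith
    set J := (N - k) / 8 + 1 with hJ
    have h1 : F N ≤ F ((k + 8 * J : ℕ) : ℝ) := by
      refine hF (by simpa using hN) (by simp only [mem_Ioi]; push_cast; positivity) ?_
      exact_mod_cast (show N ≤ k + 8 * J by omega)
    have h2 : ∑ j ∈ Finset.range J, f ((k + 8 * j : ℕ) : ℝ)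
        ≤ ∑ n ∈ (Finset.range (N + 1)).filter (fun n : ℕ => m ≤ n ∧ n % 8 = k % 8), f n := by
      rw [← Finset.sum_image (f := fun n : ℕ => f (n : ℝ)) (g := fun j => k + 8 * j)
        (s := Finset.range J) (by intro a _ b _ h; simpa using h)]
      refine Finset.sum_le_sum_of_subset_of_nonneg ?_ fun n hn _ => hpos n hn
      intro n hn
      simp only [Finset.mem_image, Finset.mem_range, Finset.mem_filter] at hn ⊢
      obtain ⟨j, hj, rfl⟩ := hn
      refine ⟨by omega, ?_, by omega⟩
      push_cast
      have : (0 : ℝ) ≤ 8 * j := by positivity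
      linarith
    linarith [htel J]

/-- The five classes are disjoint and consist of sums of three squares. -/
theorem sum_residues_le_sum_window {f : ℝ → ℝ} (hf : ∀ t, 0 < t → 0 ≤ f t) {m : ℝ} (hm : 1 ≤ m)
    (N : ℕ) :
    ∑ r ∈ ({1, 2, 3, 5, 6} : Finset ℕ),
      ∑ n ∈ (Finset.range (N + 1)).filter (fun n : ℕ => m ≤ n ∧ n % 8 = r), f n
    ≤ ∑ n ∈ threeSqWindow m N, f n := by
  classical
  have h1 : ∀ r ∈ ({1, 2, 3, 5, 6} : Finset ℕ),
      ∑ n ∈ (Finset.range (N + 1)).filter (fun n : ℕ => m ≤ n ∧ n % 8 = r), f n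
      = ∑ n ∈ threeSqWindow m N, if n % 8 = r then f n else 0 := by
    intro r hr
    rw [← Finset.sum_filter]
    congr 1
    ext n
    simp only [Finset.mem_filter, mem_threeSqWindow, Finset.mem_range, Nat.lt_succ_iff]
    constructor
    · rintro ⟨a, b, c⟩
      refine ⟨⟨a, b, exists_sum_three_sq_of_mod_eight ?_⟩, c⟩
      simp only [Finset.mem_insert, Finset.mem_singleton] at hr
      omega
    · rintro ⟨⟨a, b, -⟩, c⟩
      exact ⟨a, b, c⟩
  rw [Finset.sum_congr rfl h1, Finset.sum_comm]
  refine Finset.sum_le_sum fun n hn => ?_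
  rw [Finset.sum_ite_eq]
  split_ifs
  · exact le_rfl
  · have := (mem_threeSqWindow.1 hn).2.1
    exact hf _ (by linarith)

/-- Each of the five classes has a first element `k ≥ m` with `k ≤ m + 8`, from which the
telescoping starts. -/
theorem sum_window_ge {f F : ℝ → ℝ} (hf : ∀ t, 0 < t → 0 ≤ f t)
    (hF : MonotoneOn F (Ioi 0)) (hfF : ∀ t, 0 < t → F (t + 8) - F t ≤ f t)
    {m : ℝ} (hm : 1 ≤ m) {N : ℕ} (hN : 0 < N) :
    5 * (F N - F (m + 8)) ≤ ∑ n ∈ threeSqWindow m N, f n := by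
  refine le_trans ?_ (sum_residues_le_sum_window hf hm N)
  have : ∑ r ∈ ({1, 2, 3, 5, 6} : Finset ℕ), (F N - F (m + 8)) = 5 * (F N - F (m + 8)) := by
    simp only [Finset.sum_const]; norm_num
  rw [← this]
  refine Finset.sum_le_sum fun r hr => ?_
  have hr8 : r < 8 := by
    simp only [Finset.mem_insert, Finset.mem_singleton] at hr; omega
  set c := ⌈m⌉₊
  have hc1 : m ≤ c := Nat.le_ceil m
  have hc2 : (c : ℝ) < m + 1 := Nat.ceil_lt_add_one (by linarith)
  obtain ⟨k, hkr, hk1, hk2⟩ : ∃ k, k % 8 = r ∧ c ≤ k ∧ k ≤ c + 7 :=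
    ⟨c + (r + 7 * c) % 8, by omega, by omega, by omega⟩
  have hk1' : (c : ℝ) ≤ k := by exact_mod_cast hk1
  have hk2' : (k : ℝ) ≤ c + 7 := by exact_mod_cast hk2
  have := sub_le_sum_residue hf hF hfF hm (N := N) (k := k) (by linarith) hN
  rw [hkr] at this
  have h2 : F k ≤ F (m + 8) :=
    hF (by simp only [mem_Ioi]; linarith) (by simp only [mem_Ioi]; linarith) (by linarith)
  linarith

/-- For `m` close to 1 the start `m + 8` is too wasteful. The classes 2, 3, 5, 6 start at their own
residue, and the class of 1 at 9 since 1 may lie below `m`. -/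
theorem sum_window_ge_of_lt_two {f F : ℝ → ℝ} (hf : ∀ t, 0 < t → 0 ≤ f t)
    (hF : MonotoneOn F (Ioi 0)) (hfF : ∀ t, 0 < t → F (t + 8) - F t ≤ f t)
    {m : ℝ} (hm : 1 ≤ m) (hm2 : m < 2) {N : ℕ} (hN : 0 < N) :
    5 * F N - 4 * F 6 - F 9 ≤ ∑ n ∈ threeSqWindow m N, f n := by
  refine le_trans ?_ (sum_residues_le_sum_window hf hm N)
  have h := fun k hk => sub_le_sum_residue hf hF hfF hm (N := N) (k := k) hk hN
  have h9 := h 9 (by norm_num; linarith)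
  have h2 := h 2 (by norm_num; linarith)
  have h3 := h 3 (by norm_num; linarith)
  have h5 := h 5 (by norm_num; linarith)
  have h6 := h 6 (by norm_num; linarith)
  have m2 : F 2 ≤ F 6 := hF (by norm_num) (by norm_num) (by norm_num)
  have m3 : F 3 ≤ F 6 := hF (by norm_num) (by norm_num) (by norm_num)
  have m5 : F 5 ≤ F 6 := hF (by norm_num) (by norm_num) (by norm_num)
  simp only [Nat.cast_ofNat, Nat.reduceMod] at h9 h2 h3 h5 h6
  rw [Finset.sum_insert (by simp), Finset.sum_insert (by simp), Finset.sum_insert (by simp),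
    Finset.sum_insert (by simp), Finset.sum_singleton]
  linarith

theorem monotoneOn_rpow_neg_one_third :
    MonotoneOn (fun t : ℝ => -(3 / 8) * t ^ (-(1 / 3) : ℝ)) (Ioi 0) := by
  intro a ha b _ hab
  have := Real.rpow_le_rpow_of_nonpos ha hab (show (-(1 / 3) : ℝ) ≤ 0 by norm_num)
  simp only
  linarith

theorem le_rpow_neg_one_third {a t : ℝ} (ha : 0 < a) (ht : 0 < t) (h : t * a ^ 3 ≤ 1) :
    a ≤ t ^ (-(1 / 3) : ℝ) := by
  obtain ⟨b, -, hb, k1, k2, -, -⟩ := exists_cbrt ht.le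
  have hb := hb ht
  rw [k2, ← one_div, le_div_iff₀ hb]
  have : (a * b) ^ 3 ≤ 1 ^ 3 := by rw [k1] at h; nlinarith
  exact le_of_pow_le_pow_left₀ (by norm_num) zero_le_one this

/-- The asymptotic coefficient `5·3/8 = 15/8` of `m ^ (-1/3)` is lowered to 1 to cover small `m`.
For `m < 2` the starting terms contribute at least `3/8·(4·0.55 + 0.48) > 1`; for `m ≥ 2` one has `m
+ 8 ≤ 5m` and `5·(8/15)³ < 1`. -/
theorem sum_window_rpow_neg_four_thirds_ge {m : ℝ} (hm : 1 ≤ m) {N : ℕ} (hN : 0 < N) :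
    m ^ (-(1 / 3) : ℝ) - 15 / 8 * (N : ℝ) ^ (-(1 / 3) : ℝ)
      ≤ ∑ n ∈ threeSqWindow m N, (n : ℝ) ^ (-(4 / 3) : ℝ) := by
  have hf : ∀ t : ℝ, 0 < t → 0 ≤ t ^ (-(4 / 3) : ℝ) := fun t ht => by positivity
  rcases lt_or_ge m 2 with h | h
  · have := sum_window_ge_of_lt_two hf monotoneOn_rpow_neg_one_third
      (fun t ht => rpow_neg_four_thirds_ge ht) hm h hN
    have h6 : (0.55 : ℝ) ≤ 6 ^ (-(1 / 3) : ℝ) :=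
      le_rpow_neg_one_third (by norm_num) (by norm_num) (by norm_num)
    have h9 : (0.48 : ℝ) ≤ 9 ^ (-(1 / 3) : ℝ) :=
      le_rpow_neg_one_third (by norm_num) (by norm_num) (by norm_num)
    have h1 : m ^ (-(1 / 3) : ℝ) ≤ 1 := Real.rpow_le_one_of_one_le_of_nonpos hm (by norm_num)
    linarith
  · have := sum_window_ge hf monotoneOn_rpow_neg_one_third
      (fun t ht => rpow_neg_four_thirds_ge ht) hm hN
    have h8 : 8 / 15 * m ^ (-(1 / 3) : ℝ) ≤ (m + 8) ^ (-(1 / 3) : ℝ) := by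
      refine le_rpow_neg_one_third (by positivity) (by linarith) ?_
      obtain ⟨b, -, hb, k1, k2, -, -⟩ := exists_cbrt (show 0 ≤ m by linarith)
      have hb := hb (by linarith)
      rw [k2, mul_pow, inv_pow, ← k1, ← mul_assoc, ← div_eq_mul_inv, div_le_one (by linarith)]
      norm_num; linarith
    linarith

theorem sum_window_rpow_neg_one_third_ge {m : ℝ} (hm : 1 ≤ m) {N : ℕ} (hN : 0 < N) :
    15 / 16 * ((N : ℝ) ^ (2 / 3 : ℝ) - 5 * m ^ (2 / 3 : ℝ))
      ≤ ∑ n ∈ threeSqWindow m N, (n : ℝ) ^ (-(1 / 3) : ℝ) := by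
  have hf : ∀ t : ℝ, 0 < t → 0 ≤ t ^ (-(1 / 3) : ℝ) := fun t ht => by positivity
  have hF : MonotoneOn (fun t : ℝ => 3 / 16 * t ^ (2 / 3 : ℝ)) (Ioi 0) := by
    intro a ha b _ hab
    have := Real.rpow_le_rpow (le_of_lt ha) hab (show (0 : ℝ) ≤ 2 / 3 by norm_num)
    simp only
    linarith
  have := sum_window_ge hf hF (fun t ht => rpow_neg_one_third_ge ht) hm hN
  have h9 : (m + 8) ^ (2 / 3 : ℝ) ≤ 5 * m ^ (2 / 3 : ℝ) := by
    calc (m + 8) ^ (2 / 3 : ℝ) ≤ (9 * m) ^ (2 / 3 : ℝ) :=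
          Real.rpow_le_rpow (by linarith) (by linarith) (by norm_num)
      _ = 9 ^ (2 / 3 : ℝ) * m ^ (2 / 3 : ℝ) := Real.mul_rpow (by norm_num) (by linarith)
      _ ≤ 5 * m ^ (2 / 3 : ℝ) := by
          gcongr
          obtain ⟨b, hb, -, k1, -, -, k2⟩ := exists_cbrt (show (0 : ℝ) ≤ 9 by norm_num)
          rw [k2]
          by_contra! h
          have : b ≤ 2.1 := le_of_pow_le_pow_left₀ (n := 3) (by norm_num) (by norm_num)
            (by rw [← k1]; norm_num)
          nlinarith
  linarith

/-- The element `N` alone suffices when `N - m ≤ 16`; beyond that the five classes give `5(N - m -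
8)/8`. The crude constant 16 makes one bound valid for every length of the window. -/
theorem card_window_ge {m : ℝ} (hm : 1 ≤ m) {N : ℕ} (hmN : m < N) (hS : IsSumThreeSq N) :
    (N - m) / 16 ≤ ((threeSqWindow m N).card : ℝ) := by
  have hN : 0 < N := by
    have : (0 : ℝ) < N := by linarith
    exact_mod_cast this
  have h1 : (1 : ℝ) ≤ (threeSqWindow m N).card := by
    have : 0 < (threeSqWindow m N).card :=
      Finset.card_pos.2 ⟨N, mem_threeSqWindow.2 ⟨le_rfl, hmN.le, hS⟩⟩
    exact_mod_cast this
  have h2 := sum_window_ge (f := fun _ => 1) (F := fun t => t / 8) (fun _ _ => zero_le_one)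
    (fun a _ b _ h => by simp only; linarith) (fun t _ => by linarith) hm hN
  simp only [Finset.sum_const, nsmul_eq_mul, mul_one] at h2
  by_cases h : N - m ≤ 16
  · linarith
  · linarith

theorem sum_window_ge_of_antitone {p : ℝ} (hp : p ≤ 0) {m : ℝ} (hm : 1 ≤ m) {N : ℕ} (hmN : m < N)
    (hS : IsSumThreeSq N) :
    (N - m) / 16 * (N : ℝ) ^ p ≤ ∑ n ∈ threeSqWindow m N, (n : ℝ) ^ p := by
  calc (N - m) / 16 * (N : ℝ) ^ p ≤ (threeSqWindow m N).card * (N : ℝ) ^ p := by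
        have : (0 : ℝ) ≤ (N : ℝ) ^ p := by positivity
        exact mul_le_mul_of_nonneg_right (card_window_ge hm hmN hS) this
    _ = ∑ n ∈ threeSqWindow m N, (N : ℝ) ^ p := by simp
    _ ≤ _ := by
        refine Finset.sum_le_sum fun n hn => ?_
        obtain ⟨h1, h2, -⟩ := mem_threeSqWindow.1 hn
        exact Real.rpow_le_rpow_of_nonpos (by linarith) (by exact_mod_cast h1) hp

/-- The sum over all integers from `⌈m⌉` on telescopes to `3 m^(-1/3)`; the first term costs one
more `m^(-1/3)`. -/
theorem sum_window_rpow_neg_four_thirds_le {m : ℝ} (hm : 1 ≤ m) (N : ℕ) :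
    ∑ n ∈ threeSqWindow m N, (n : ℝ) ^ (-(4 / 3) : ℝ) ≤ 4 * m ^ (-(1 / 3) : ℝ) := by
  set c := ⌈m⌉₊ with hc
  have hc1 : m ≤ c := Nat.le_ceil m
  have hc0 : (1 : ℝ) ≤ c := by linarith
  have hsum : ∀ J : ℕ, ∑ j ∈ Finset.range (J + 1), ((c + j : ℕ) : ℝ) ^ (-(4 / 3) : ℝ)
      ≤ 4 * (c : ℝ) ^ (-(1 / 3) : ℝ) - 3 * ((c + J : ℕ) : ℝ) ^ (-(1 / 3) : ℝ) := by
    intro J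
    induction J with
    | zero =>
      simp only [zero_add, Finset.range_one, Finset.sum_singleton, add_zero]
      have := Real.rpow_le_rpow_of_exponent_le hc0 (show (-(4 / 3) : ℝ) ≤ -(1 / 3) by norm_num)
      linarith
    | succ J ih =>
      rw [Finset.sum_range_succ]
      have := rpow_neg_four_thirds_le (t := ((c + J : ℕ) : ℝ)) (by push_cast; positivity)
      have e : ((c + (J + 1) : ℕ) : ℝ) = ((c + J : ℕ) : ℝ) + 1 := by push_cast; ring
      rw [e]; linarith
  calc ∑ n ∈ threeSqWindow m N, (n : ℝ) ^ (-(4 / 3) : ℝ)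
      ≤ ∑ n ∈ (Finset.range (N + 1)).image (fun j => c + j), (n : ℝ) ^ (-(4 / 3) : ℝ) := by
        refine Finset.sum_le_sum_of_subset_of_nonneg ?_ fun n _ _ => by positivity
        intro n hn
        obtain ⟨h1, h2, -⟩ := mem_threeSqWindow.1 hn
        have : c ≤ n := Nat.ceil_le.2 h2
        exact Finset.mem_image.2 ⟨n - c, Finset.mem_range.2 (by omega), by omega⟩
    _ = ∑ j ∈ Finset.range (N + 1), ((c + j : ℕ) : ℝ) ^ (-(4 / 3) : ℝ) := by
        rw [Finset.sum_image (by intro a _ b _ h; simpa using h)]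
    _ ≤ 4 * (c : ℝ) ^ (-(1 / 3) : ℝ) := by
        have : 0 ≤ ((c + N : ℕ) : ℝ) ^ (-(1 / 3) : ℝ) := by positivity
        linarith [hsum N]
    _ ≤ 4 * m ^ (-(1 / 3) : ℝ) := by
        have := Real.rpow_le_rpow_of_nonpos (by linarith) hc1 (show (-(1 / 3) : ℝ) ≤ 0 by norm_num)
        linarith

theorem sum_window_rpow_neg_one_third_le {m : ℝ} (hm : 1 ≤ m) (N : ℕ) :
    ∑ n ∈ threeSqWindow m N, (n : ℝ) ^ (-(1 / 3) : ℝ) ≤ 3 / 2 * (N : ℝ) ^ (2 / 3 : ℝ) := by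
  have hsum : ∀ J : ℕ, ∑ j ∈ Finset.range J, ((j + 1 : ℕ) : ℝ) ^ (-(1 / 3) : ℝ)
      ≤ 3 / 2 * (J : ℝ) ^ (2 / 3 : ℝ) := by
    intro J
    induction J with
    | zero => simp
    | succ J ih =>
      rw [Finset.sum_range_succ]
      have := rpow_neg_one_third_le (t := (J : ℝ)) (by positivity)
      push_cast at ih ⊢
      linarith
  refine le_trans ?_ (hsum N)
  rw [← Finset.sum_image (f := fun n : ℕ => (n : ℝ) ^ (-(1 / 3) : ℝ)) (g := fun j => j + 1)
    (by intro a _ b _ h; simpa using h)]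
  refine Finset.sum_le_sum_of_subset_of_nonneg ?_ fun n _ _ => by positivity
  intro n hn
  obtain ⟨h1, h2, -⟩ := mem_threeSqWindow.1 hn
  have : 1 ≤ n := by
    have : (1 : ℝ) ≤ n := by linarith
    exact_mod_cast this
  exact Finset.mem_image.2 ⟨n - 1, Finset.mem_range.2 (by omega), by omega⟩

/-- A lower bound for the energy of the spectrum `n ^ (-4/3)` in a window of Reynolds number `x`. -/
noncomputable def energyConst (x : ℝ) : ℝ :=
  if 10 ^ 4 ≤ x then 49 / 50 else (1 - 1 / x) / (16 * Real.sqrt x)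

/-- A lower bound for the enstrophy of the spectrum `n ^ (-4/3)` in a window of Reynolds number
`x`. -/
noncomputable def enstrophyConst (x : ℝ) : ℝ :=
  if 10 ^ 4 ≤ x then 9 / 10 else (1 - 1 / x) / 16

theorem energyConst_pos {x : ℝ} (hx : 1 < x) : 0 < energyConst x := by
  have : 1 / x < 1 := (div_lt_one (by linarith)).2 hx
  have : 0 < 1 - 1 / x := by linarith
  unfold energyConst
  split_ifs <;> positivity

theorem enstrophyConst_pos {x : ℝ} (hx : 1 < x) : 0 < enstrophyConst x := by
  have : 1 / x < 1 := (div_lt_one (by linarith)).2 hx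
  have : 0 < 1 - 1 / x := by linarith
  unfold enstrophyConst
  split_ifs <;> positivity

/-- For `x ≥ 10⁴` the ends satisfy `N^(1/3) ≥ 100 m^(1/3)`, so the boundary terms of the telescoped
sums are negligible. For smaller `x` those bounds may be void, and the number of terms times the
smallest term replaces them. -/
theorem window_bounds {m : ℝ} (hm : 1 ≤ m) {N : ℕ} (hmN : m < N) (hS : IsSumThreeSq N) {x : ℝ}
    (hx : (N : ℝ) ^ (2 / 3 : ℝ) = x * m ^ (2 / 3 : ℝ)) :
    energyConst x * m ^ (-(1 / 3) : ℝ) ≤ ∑ n ∈ threeSqWindow m N, (n : ℝ) ^ (-(4 / 3) : ℝ) ∧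
    enstrophyConst x * (N : ℝ) ^ (2 / 3 : ℝ)
      ≤ ∑ n ∈ threeSqWindow m N, (n : ℝ) ^ (-(1 / 3) : ℝ) := by
  have hN0 : (0 : ℝ) < N := by linarith
  have hN : 0 < N := by exact_mod_cast hN0
  have hm0 : 0 < m := by linarith
  have e1 := sum_window_rpow_neg_four_thirds_ge hm hN
  have e2 := sum_window_rpow_neg_one_third_ge hm hN
  have e3 := sum_window_ge_of_antitone (p := -(4 / 3)) (by norm_num) hm hmN hS
  have e4 := sum_window_ge_of_antitone (p := -(1 / 3)) (by norm_num) hm hmN hS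
  obtain ⟨a, -, ha, a1, a2, a3, a4⟩ := exists_cbrt hm0.le
  obtain ⟨b, -, hb, b1, b2, b3, b4⟩ := exists_cbrt hN0.le
  have ha := ha hm0
  have hb := hb hN0
  rw [a2, b2] at e1
  rw [a4, b4] at e2
  rw [b3] at e3
  rw [b2] at e4
  rw [a4, b4] at hx
  rw [a2, b4]
  have hx0 : 0 < x := by
    by_contra! h
    have : 0 < b ^ 2 := by positivity
    nlinarith [sq_nonneg a]
  have hsx : Real.sqrt x = b / a := by
    rw [show x = (b / a) ^ 2 by rw [div_pow, hx]; field_simp, Real.sqrt_sq (by positivity)]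
  have hab : a < b := lt_of_pow_lt_pow_left₀ 3 hb.le (by linarith)
  have hx1 : 1 < x := by
    have : a ^ 2 < b ^ 2 := by nlinarith
    rw [hx] at this
    nlinarith [sq_nonneg a]
  have hxinv : 1 / x = a ^ 2 / b ^ 2 := by rw [hx]; field_simp
  have hcr : (1 - 1 / x) / 16 * b ^ 3 ≤ (N - m) / 16 := by
    rw [hxinv, b1, a1]
    have : (1 - a ^ 2 / b ^ 2) / 16 * b ^ 3 = (b ^ 3 - a ^ 2 * b) / 16 := by field_simp
    rw [this]
    have : a ^ 2 * a ≤ a ^ 2 * b := by gcongr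
    linarith [show a ^ 2 * a = a ^ 3 by ring]
  unfold energyConst enstrophyConst
  split_ifs with h
  · constructor
    · refine le_trans ?_ e1
      have h100 : 100 ≤ b / a := by
        rw [← hsx]; exact Real.le_sqrt_of_sq_le (by norm_num at h ⊢; exact h)
      rw [le_div_iff₀ ha] at h100
      have : b⁻¹ ≤ a⁻¹ / 100 := by
        rw [← one_div, div_le_iff₀ hb]
        have : a⁻¹ / 100 * b = b / (100 * a) := by field_simp
        rw [this, le_div_iff₀ (by positivity)]; linarith
      have : 0 < a⁻¹ := by positivity
      linarith
    · refine le_trans ?_ e2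
      have : 10 ^ 4 * a ^ 2 ≤ b ^ 2 := by rw [hx]; gcongr
      nlinarith [sq_nonneg a]
  · constructor
    · refine le_trans (le_trans (le_of_eq ?_) (mul_le_mul_of_nonneg_right hcr
        (show 0 ≤ (b ^ 4)⁻¹ by positivity))) e3
      rw [hsx]; field_simp
    · refine le_trans (le_trans (le_of_eq ?_) (mul_le_mul_of_nonneg_right hcr
        (show 0 ≤ b⁻¹ by positivity))) e4
      field_simp

/-! ### Fourier analysis on the torus -/

namespace K41

noncomputable section

variable {L : ℝ} [Fact (0 < L)]

instance factZeroLtOne : Fact ((0 : ℝ) < 1) := ⟨one_pos⟩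

/-- The product of the normalized Haar measures on the unit torus. -/
def unitHaar : Measure (Torus 1) := Measure.pi fun _ => AddCircle.haarAddCircle

/-- Parseval's identity on the unit torus. -/
theorem hasSum_sq_unit {g : Torus 1 → ℂ} (hg : MemLp g 2 unitHaar) :
    HasSum (fun k : Fin 3 → ℤ => ‖∫ t, (∏ i, fourier (-(k i)) (t i)) * g t ∂unitHaar‖ ^ 2)
      (∫ t, ‖g t‖ ^ 2 ∂unitHaar) := by
  have h := UnitAddTorus.hasSum_sq_mFourierCoeff (d := Fin 3) (hg.toLp g)
  have h1 : ∀ k, UnitAddTorus.mFourierCoeff (hg.toLp g) k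
      = ∫ t, (∏ i, fourier (-(k i)) (t i)) * g t ∂unitHaar := by
    intro k
    refine integral_congr_ae ?_
    filter_upwards [hg.coeFn_toLp] with t ht
    rw [ht]; rfl
  have h2 : ∫ t, ‖hg.toLp g t‖ ^ 2 ∂unitHaar = ∫ t, ‖g t‖ ^ 2 ∂unitHaar := by
    refine integral_congr_ae ?_
    filter_upwards [hg.coeFn_toLp] with t ht
    rw [ht]
  have h3 : HasSum (fun k => ‖UnitAddTorus.mFourierCoeff (hg.toLp g) k‖ ^ 2)
    (∫ t, ‖hg.toLp g t‖ ^ 2 ∂unitHaar) := h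
  rw [h2] at h3
  exact (funext fun k => by rw [h1] : (fun k => ‖UnitAddTorus.mFourierCoeff (hg.toLp g) k‖ ^ 2) =
    _) ▸ h3

/-- The rescaling of the torus of side `L` to the unit torus. -/
def rescale (L : ℝ) [hL : Fact (0 < L)] : Torus L ≃ₜ Torus 1 :=
  Homeomorph.piCongrRight fun _ => AddCircle.homeomorphAddCircle L 1 hL.out.ne' one_ne_zero

theorem map_rescale_circle :
    (volume : Measure (AddCircle L)).map
      (AddCircle.homeomorphAddCircle L 1 (Fact.out : 0 < L).ne' one_ne_zero)
      = ENNReal.ofReal L • AddCircle.haarAddCircle := by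
  have hL : 0 < L := Fact.out
  have h : MeasurePreserving (AddCircle.equivAddCircle L 1 hL.ne' one_ne_zero).toAddMonoidHom
      (AddCircle.haarAddCircle (T := L)) (AddCircle.haarAddCircle (T := 1)) :=
    AddMonoidHom.measurePreserving
      (AddCircle.homeomorphAddCircle L 1 hL.ne' one_ne_zero).continuous
      (AddCircle.homeomorphAddCircle L 1 hL.ne' one_ne_zero).surjective (by simp)
  rw [AddCircle.volume_eq_smul_haarAddCircle, Measure.map_smul]
  congr 1
  exact h.map_eq

theorem measurePreserving_rescale :
    MeasurePreserving (rescale L) volume (ENNReal.ofReal L ^ 3 • unitHaar) := by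
  have h : MeasurePreserving (rescale L) volume
      (Measure.pi fun _ : Fin 3 => ENNReal.ofReal L • AddCircle.haarAddCircle (T := 1)) := by
    have : IsFiniteMeasure (ENNReal.ofReal L • AddCircle.haarAddCircle (T := 1)) :=
      Measure.smul_finite _ (by finiteness)
    exact measurePreserving_pi _ _ fun _ => ⟨(AddCircle.homeomorphAddCircle L 1 _ _).measurable, map_rescale_circle⟩
  convert h
  symm
  have : IsFiniteMeasure (ENNReal.ofReal L • AddCircle.haarAddCircle (T := 1)) :=
      Measure.smul_finite _ (by finiteness)
  refine Measure.pi_eq fun s hs => ?_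
  rw [Measure.smul_apply, unitHaar, Measure.pi_pi]
  simp [Fin.prod_univ_three]
  ring

theorem fourier_rescale (n : ℤ) (x : AddCircle L) :
    fourier n (AddCircle.homeomorphAddCircle L 1 (Fact.out : 0 < L).ne' one_ne_zero x)
      = fourier n x := by
  induction x using QuotientAddGroup.induction_on with
  | H y =>
    rw [AddCircle.homeomorphAddCircle_apply_mk, fourier_coe_apply, fourier_coe_apply]
    congr 1
    push_cast
    ring

/-- Parseval's identity on the torus of side `L`. -/
theorem hasSum_sq_fourierCoef {f : Torus L → ℝ} (hf : MemLp f 2) :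
    HasSum (fun k => ‖fourierCoef f k‖ ^ 2) (L ^ 3 * ∫ x, f x ^ 2) := by
  have hL : 0 < L := Fact.out
  have hmp := measurePreserving_rescale (L := L)
  have hemb : MeasurableEmbedding (rescale L) := (rescale L).toMeasurableEquiv.measurableEmbedding
  have hint : ∀ h : Torus 1 → ℂ, ∫ x, h (rescale L x) = L ^ 3 • ∫ t, h t ∂unitHaar := by
    intro h
    rw [hmp.integral_comp hemb, integral_smul_measure, ENNReal.toReal_pow,
      ENNReal.toReal_ofReal hL.le]
  have hintR : ∀ h : Torus 1 → ℝ, ∫ x, h (rescale L x) = L ^ 3 * ∫ t, h t ∂unitHaar := by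
    intro h
    rw [hmp.integral_comp hemb, integral_smul_measure, ENNReal.toReal_pow,
      ENNReal.toReal_ofReal hL.le, smul_eq_mul]
  set g : Torus 1 → ℂ := fun t => (f ((rescale L).symm t) : ℂ) with hg
  have hgmem : MemLp g 2 unitHaar := by
    have h1 : MemLp g 2 (ENNReal.ofReal L ^ 3 • unitHaar) := by
      rw [← hmp.map_eq, hemb.memLp_map_measure_iff]
      have : g ∘ rescale L = fun x => (f x : ℂ) := by
        ext x; simp [hg]
      rw [this]
      exact hf.ofReal
    have h2 := h1.smul_measure (c := (ENNReal.ofReal L ^ 3)⁻¹) (by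
      simp [hL])
    rwa [smul_smul, ENNReal.inv_mul_cancel (by simp [hL]) (by finiteness), one_smul] at h2
  have h := (hasSum_sq_unit hgmem).mul_left ((L ^ 3) ^ 2)
  have hf2 : L ^ 3 * ∫ x, f x ^ 2 = (L ^ 3) ^ 2 * ∫ t, ‖g t‖ ^ 2 ∂unitHaar := by
    rw [pow_two (L ^ 3), mul_assoc, ← hintR]
    simp [hg]
  have hk : ∀ k : Fin 3 → ℤ, ‖fourierCoef f k‖ ^ 2
      = (L ^ 3) ^ 2 * ‖∫ t, (∏ i, fourier (-(k i)) (t i)) * g t ∂unitHaar‖ ^ 2 := by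
    intro k
    have : fourierCoef f k = L ^ 3 • ∫ t, (∏ i, fourier (-(k i)) (t i)) * g t ∂unitHaar := by
      rw [← hint, fourierCoef]
      congr 1
      ext x
      congr 1
      · exact Finset.prod_congr rfl fun i _ => (fourier_rescale _ _).symm
      · simp [hg]
    rw [this, norm_smul, mul_pow, Real.norm_of_nonneg (by positivity)]
  rw [hf2]
  simpa only [hk] using h

theorem torusVolume_eq : torusVolume L = L ^ 3 := by
  have hL : 0 < L := Fact.out
  rw [torusVolume, Measure.real, volume_pi, Measure.pi_univ]
  simp [hL.le]

/-- The character `x ↦ e^{-i𝐤·x}` of the torus, `𝐤 = 2πL⁻¹k`. -/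
def torusChar (k : Fin 3 → ℤ) (x : Torus L) : ℂ := ∏ i, fourier (-(k i)) (x i)

theorem continuous_torusChar (k : Fin 3 → ℤ) : Continuous (torusChar (L := L) k) := by
  unfold torusChar
  fun_prop

theorem norm_torusChar (k : Fin 3 → ℤ) (x : Torus L) : ‖torusChar k x‖ = 1 := by
  simp only [torusChar, norm_prod, fourier_apply, Circle.norm_coe, Finset.prod_const_one]

theorem torusChar_zero (x : Torus L) : torusChar 0 x = 1 := by
  simp [torusChar]

theorem fourierCoef_eq (f : Torus L → ℝ) (k : Fin 3 → ℤ) :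
    fourierCoef f k = ∫ x, torusChar k x * (f x : ℂ) := rfl

theorem integrable_torusChar_mul {f : Torus L → ℝ} (hf : Integrable f) (k : Fin 3 → ℤ) :
    Integrable fun x => torusChar k x * (f x : ℂ) :=
  hf.ofReal.bdd_mul (c := 1) (continuous_torusChar k).aestronglyMeasurable
    (ae_of_all _ fun x => (norm_torusChar k x).le)

theorem isSmoothOnTorus_char (c : ℂ) (k : Fin 3 → ℤ) :
    IsSmoothOnTorus fun x : Torus L => (c * torusChar k x).re := by
  unfold IsSmoothOnTorus torusChar
  simp only [fourier_coe_apply]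
  refine Complex.reCLM.contDiff.comp (contDiff_const.mul (contDiff_prod fun i _ => ?_))
  refine ContDiff.cexp (ContDiff.div_const (contDiff_const.mul ?_) _)
  exact Complex.ofRealCLM.contDiff.comp (contDiff_apply ℝ ℝ i)

theorem torusChar_add_single (k : Fin 3 → ℤ) (x : Torus L) (i : Fin 3) (s : AddCircle L) :
    torusChar k (x + Pi.single i s) = torusChar k x * fourier (-(k i)) s := by
  have hadd : ∀ (n : ℤ) (a b : AddCircle L), fourier n (a + b) = fourier n a * fourier n b := by
    intro n a b
    simp only [fourier_apply, smul_add, AddCircle.toCircle_add, Circle.coe_mul]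
  simp only [torusChar, Pi.add_apply, hadd, Finset.prod_mul_distrib]
  congr 1
  rw [Finset.prod_eq_single i]
  · simp
  · intro j _ hj
    rw [Pi.single_eq_of_ne hj]
    exact fourier_eval_zero _
  · simp

theorem torusPartial_char (c : ℂ) (k : Fin 3 → ℤ) (i : Fin 3) (x : Torus L) :
    torusPartial i (fun x => (c * torusChar k x).re) x
      = (c * (-2 * Real.pi * Complex.I * k i / L) * torusChar k x).re := by
  unfold torusPartial
  simp only [torusChar_add_single]
  have h := hasDerivAt_fourier_neg L (k i) 0
  have h2 := (h.const_mul (c * torusChar k x))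
  have h3 := (Complex.reCLM.hasFDerivAt.comp_hasDerivAt (0 : ℝ) h2).deriv
  have e : (fun s : ℝ => (c * (torusChar k x * fourier (-(k i)) (s : AddCircle L))).re)
      = Complex.reCLM ∘ fun y : ℝ => c * torusChar k x * fourier (-(k i)) (y : AddCircle L) := by
    ext s; simp [mul_assoc]
  rw [e, h3, AddCircle.coe_zero, fourier_eval_zero]
  simp only [Complex.reCLM_apply]
  congr 1
  ring

theorem integral_mul_re_char {f : Torus L → ℝ} (hf : Integrable f) (c : ℂ) (k : Fin 3 → ℤ) :
    ∫ x, f x * (c * torusChar k x).re = (c * fourierCoef f k).re := by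
  rw [fourierCoef_eq, ← integral_const_mul]
  have := Complex.reCLM.integral_comp_comm ((integrable_torusChar_mul hf k).const_mul c)
  simp only [Complex.reCLM_apply] at this
  rw [← this]
  congr 1
  ext x
  rw [← mul_assoc, Complex.re_mul_ofReal]
  ring

theorem eq_of_forall_re_mul {a b : ℂ} (h : ∀ c : ℂ, (c * a).re = (c * b).re) : a = b := by
  apply Complex.ext
  · simpa using h 1
  · simpa using h (-Complex.I)

/-- Test functions are real, so the weak identity is tested with `Re (c e^{-i𝐤·x})` for every
complex `c`; this determines the complex coefficient. -/
theorem IsWeakPartial.fourierCoef_eq {i : Fin 3} {f g : Torus L → ℝ} (h : IsWeakPartial i f g)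
    (hf : Integrable f) (hg : Integrable g) (k : Fin 3 → ℤ) :
    fourierCoef g k = (2 * Real.pi * Complex.I * k i / L) * fourierCoef f k := by
  refine eq_of_forall_re_mul fun c => ?_
  have h1 := h _ (isSmoothOnTorus_char c k)
  simp only [torusPartial_char] at h1
  rw [integral_mul_re_char hf, integral_mul_re_char hg] at h1
  rw [← neg_eq_iff_eq_neg] at h1
  rw [← h1, ← Complex.neg_re]
  congr 1
  ring

theorem IsDivFree.sum_fourierCoef {v : Torus L → E3} (h : IsDivFree v)
    (hv : ∀ j, Integrable fun x => v x j) (k : Fin 3 → ℤ) :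
    ∑ i, (k i : ℂ) * fourierCoef (fun x => v x i) k = 0 := by
  have hL : (L : ℂ) ≠ 0 := by exact_mod_cast (Fact.out : 0 < L).ne'
  have key : (-2 * Real.pi * Complex.I / L) * ∑ i, (k i : ℂ) * fourierCoef (fun x => v x i) k
      = 0 := by
    refine eq_of_forall_re_mul fun c => ?_
    have h1 := h _ (isSmoothOnTorus_char c k)
    simp only [torusPartial_char] at h1
    rw [integral_finsetSum] at h1
    · simp only [integral_mul_re_char (hv _)] at h1
      rw [mul_zero, Complex.zero_re, ← h1, Finset.mul_sum, Finset.mul_sum, Complex.re_sum]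
      refine Finset.sum_congr rfl fun i _ => ?_
      congr 1
      ring
    · intro i _
      refine (hv i).mul_bdd (c := ‖c * (-2 * Real.pi * Complex.I * k i / L)‖) ?_ ?_
      · exact (Complex.continuous_re.comp
          (continuous_const.mul (continuous_torusChar k))).aestronglyMeasurable
      · refine ae_of_all _ fun x => (Complex.abs_re_le_norm _).trans ?_
        rw [norm_mul, norm_torusChar, mul_one]
  refine (mul_eq_zero.1 key).resolve_left ?_
  simp [hL, Real.pi_ne_zero]

theorem memLp_coord {v : Torus L → E3} (hv : MemLp v 2) (j : Fin 3) :
    MemLp (fun x => v x j) 2 :=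
  (EuclideanSpace.proj (𝕜 := ℝ) j).comp_memLp' hv

theorem integrable_of_memLp_two {f : Torus L → ℝ} (hf : MemLp f 2) : Integrable f :=
  hf.integrable (by norm_num)

theorem weakPartial_spec {i : Fin 3} {f : Torus L → ℝ} (h : HasWeakPartial i f) :
    MemLp (weakPartial i f) 2 ∧ IsWeakPartial i f (weakPartial i f) := by
  rw [weakPartial, dif_pos h]
  exact h.choose_spec

/-- The energy `∑ⱼ |v̂ⱼ(k)|²` of the mode `k`. -/
def modeSq (v : Torus L → E3) (k : Fin 3 → ℤ) : ℝ := ∑ j, ‖fourierCoef (fun x => v x j) k‖ ^ 2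

theorem modeSq_nonneg (v : Torus L → E3) (k : Fin 3 → ℤ) : 0 ≤ modeSq v k :=
  Finset.sum_nonneg fun _ _ => by positivity

theorem normSq_eq_sum {v : Torus L → E3} (hv : MemLp v 2) :
    normSq v = ∑ j, ∫ x, v x j ^ 2 := by
  unfold normSq
  rw [← integral_finsetSum _ fun j _ => (memLp_coord hv j).integrable_sq]
  congr 1
  ext x
  rw [EuclideanSpace.norm_sq_eq]
  simp

theorem hasSum_modeSq {v : Torus L → E3} (hv : MemLp v 2) :
    HasSum (modeSq v) (L ^ 3 * normSq v) := by
  rw [normSq_eq_sum hv, Finset.mul_sum]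
  exact hasSum_sum fun j _ => hasSum_sq_fourierCoef (memLp_coord hv j)

theorem norm_sq_freq (z : ℤ) (w : ℂ) :
    ‖(2 * Real.pi * Complex.I * z / L : ℂ) * w‖ ^ 2 = (2 * Real.pi / L) ^ 2 * z ^ 2 * ‖w‖ ^ 2 := by
  have hL : 0 < L := Fact.out
  simp only [norm_mul, norm_div, Complex.norm_real, Complex.norm_I, Complex.norm_intCast,
    Complex.norm_ofNat, Real.norm_eq_abs, abs_of_pos hL, abs_of_pos Real.pi_pos, mul_one, mul_pow,
    div_pow, sq_abs]
  ring

theorem hasSum_gradSq {v : Torus L → E3} (hv : MemLp v 2)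
    (hd : ∀ i j, HasWeakPartial i fun x => v x j) :
    HasSum (fun k : Fin 3 → ℤ => (2 * Real.pi / L) ^ 2 * (∑ i, (k i : ℝ) ^ 2) * modeSq v k)
      (L ^ 3 * gradSq v) := by
  have h : HasSum (fun k : Fin 3 → ℤ => ∑ i, ∑ j,
      ‖fourierCoef (weakPartial i fun y => v y j) k‖ ^ 2) (L ^ 3 * gradSq v) := by
    rw [gradSq, Finset.mul_sum]
    refine hasSum_sum fun i _ => ?_
    rw [Finset.mul_sum]
    exact hasSum_sum fun j _ => hasSum_sq_fourierCoef (weakPartial_spec (hd i j)).1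
  convert! h using 1
  ext k
  rw [modeSq, mul_assoc, Finset.sum_mul, Finset.mul_sum]
  refine Finset.sum_congr rfl fun i _ => ?_
  rw [Finset.mul_sum, Finset.mul_sum]
  refine Finset.sum_congr rfl fun j _ => ?_
  rw [(weakPartial_spec (hd i j)).2.fourierCoef_eq (integrable_of_memLp_two (memLp_coord hv j))
    (integrable_of_memLp_two (weakPartial_spec (hd i j)).1), norm_sq_freq]
  ring

theorem fourierCoef_sub {f g : Torus L → ℝ} (hf : Integrable f) (hg : Integrable g)
    (k : Fin 3 → ℤ) : fourierCoef (fun x => f x - g x) k = fourierCoef f k - fourierCoef g k := by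
  simp only [fourierCoef_eq]
  rw [← integral_sub (integrable_torusChar_mul hf k) (integrable_torusChar_mul hg k)]
  congr 1
  ext x
  push_cast
  ring

/-- For a vector orthogonal to a real vector `k`, the antisymmetrized product with `k` has twice
the square norm. -/
theorem sum_norm_sq_antisymm {k : Fin 3 → ℤ} {w : Fin 3 → ℂ} (h : ∑ i, (k i : ℂ) * w i = 0) :
    ∑ i, ∑ j, ‖(k i : ℂ) * w j - k j * w i‖ ^ 2
      = 2 * ((∑ i, (k i : ℝ) ^ 2) * ∑ j, ‖w j‖ ^ 2) := by
  have hre := congrArg Complex.re h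
  have him := congrArg Complex.im h
  simp only [Fin.sum_univ_three, ← Complex.normSq_eq_norm_sq, Complex.normSq_apply, Complex.add_re,
    Complex.add_im, Complex.sub_re, Complex.sub_im, Complex.mul_re, Complex.mul_im,
    Complex.intCast_re, Complex.intCast_im, zero_mul, sub_zero, add_zero, Complex.zero_re,
    Complex.zero_im] at hre him ⊢
  linear_combination (-2) * (k 0 * (w 0).re + k 1 * (w 1).re + k 2 * (w 2).re) * hre
    + (-2) * (k 0 * (w 0).im + k 1 * (w 1).im + k 2 * (w 2).im) * him

/-- Mode by mode: the divergence condition makes the Fourier coefficient orthogonal to `k`, and the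
antisymmetrized product then has twice the square norm of the full one. -/
theorem vorticitySq_eq {v : Torus L → E3} (hv : MemLp v 2)
    (hd : ∀ i j, HasWeakPartial i fun x => v x j) (hdiv : IsDivFree v) :
    vorticitySq v = 2 * gradSq v := by
  have hL : 0 < L := Fact.out
  have hi : ∀ j, Integrable fun x => v x j := fun j => integrable_of_memLp_two (memLp_coord hv j)
  have hw : ∀ i j, Integrable (weakPartial i fun x => v x j) := fun i j =>
    integrable_of_memLp_two (weakPartial_spec (hd i j)).1
  have h : HasSum (fun k : Fin 3 → ℤ => ∑ i, ∑ j,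
      ‖fourierCoef (fun x => weakPartial i (fun y => v y j) x - weakPartial j (fun y => v y i) x) k‖
        ^ 2) (L ^ 3 * vorticitySq v) := by
    rw [vorticitySq, Finset.mul_sum]
    refine hasSum_sum fun i _ => ?_
    rw [Finset.mul_sum]
    exact hasSum_sum fun j _ =>
      hasSum_sq_fourierCoef ((weakPartial_spec (hd i j)).1.sub (weakPartial_spec (hd j i)).1)
  have h2 := (hasSum_gradSq hv hd).mul_left 2
  have : L ^ 3 * vorticitySq v = 2 * (L ^ 3 * gradSq v) := by
    refine h.unique ?_
    convert! h2 using 1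
    ext k
    have e : ∀ i j, fourierCoef
        (fun x => weakPartial i (fun y => v y j) x - weakPartial j (fun y => v y i) x) k
        = (2 * Real.pi * Complex.I * (1 : ℤ) / L : ℂ) * ((k i : ℂ) * fourierCoef (fun x => v x j) k
          - k j * fourierCoef (fun x => v x i) k) := by
      intro i j
      rw [fourierCoef_sub (hw i j) (hw j i),
        (weakPartial_spec (hd i j)).2.fourierCoef_eq (hi j) (hw i j),
        (weakPartial_spec (hd j i)).2.fourierCoef_eq (hi i) (hw j i)]
      push_cast
      ring
    simp only [e, norm_sq_freq, ← Finset.mul_sum]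
    rw [sum_norm_sq_antisymm (hdiv.sum_fourierCoef hi k), modeSq]
    push_cast
    ring
  have hL3 : L ^ 3 ≠ 0 := by positivity
  apply mul_left_cancel₀ hL3
  linarith

/-- The triangle inequality is applied to one `ℂ³`-valued integral rather than to each coordinate,
so no dimensional factor is lost. -/
theorem modeSq_le {v : Torus L → E3} (hv : MemLp v 2) (k : Fin 3 → ℤ) :
    modeSq v k ≤ (∫ x, ‖v x‖) ^ 2 := by
  have hi : ∀ j, Integrable fun x => v x j := fun j => integrable_of_memLp_two (memLp_coord hv j)
  set F : Torus L → EuclideanSpace ℂ (Fin 3) := fun x =>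
    WithLp.toLp 2 fun j => torusChar k x * (v x j : ℂ) with hF
  have hFint : Integrable F := by
    have : Integrable fun x => fun j => torusChar k x * (v x j : ℂ) :=
      Integrable.of_eval fun j => integrable_torusChar_mul (hi j) k
    exact (PiLp.continuousLinearEquiv 2 ℂ (fun _ : Fin 3 => ℂ)).symm.toContinuousLinearMap.integrable_comp this
  have hFn : ∀ x, ‖F x‖ = ‖v x‖ := by
    intro x
    simp [hF, EuclideanSpace.norm_eq, norm_torusChar]
  have hcoord : ∀ j, (∫ x, F x) j = fourierCoef (fun x => v x j) k := by
    intro j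
    exact ((EuclideanSpace.proj (𝕜 := ℂ) j).integral_comp_comm hFint).symm
  have h1 : modeSq v k = ‖∫ x, F x‖ ^ 2 := by
    rw [EuclideanSpace.norm_sq_eq, modeSq]
    simp only [hcoord]
  rw [h1]
  have := norm_integral_le_integral_norm (μ := volume) F
  simp only [hFn] at this
  gcongr

/-- Cauchy-Schwarz, read off from Parseval for `|v|` by keeping only the mode 0. -/
theorem sq_integral_norm_le {v : Torus L → E3} (hv : MemLp v 2) :
    (∫ x, ‖v x‖) ^ 2 ≤ L ^ 3 * normSq v := by
  have h := (hasSum_sq_fourierCoef hv.norm)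
  have h0 := le_hasSum h 0 fun k _ => by positivity
  have e : fourierCoef (fun x => ‖v x‖) 0 = ((∫ x, ‖v x‖ : ℝ) : ℂ) := by
    rw [fourierCoef_eq, ← integral_complex_ofReal]
    simp [torusChar_zero]
  rw [e] at h0
  simpa [normSq] using h0

/-- Term-by-term integration of a series of nonnegative functions. -/
theorem hasSum_integral_of_nonneg {α ι : Type*} [MeasurableSpace α] [Countable ι] {τ : Measure α}
    {F : ι → α → ℝ} {G : α → ℝ} (hF : ∀ i, Integrable (F i) τ) (hG : Integrable G τ)
    (h0 : ∀ i t, 0 ≤ F i t) (hs : ∀ᵐ t ∂τ, HasSum (fun i => F i t) (G t)) :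
    HasSum (fun i => ∫ t, F i t ∂τ) (∫ t, G t ∂τ) := by
  have hsum : Summable fun i => ∫ t, ‖F i t‖ ∂τ := by
    refine summable_of_sum_le (c := ∫ t, G t ∂τ)
      (fun i => integral_nonneg fun t => norm_nonneg _) fun s => ?_
    rw [← integral_finsetSum _ fun i _ => (hF i).norm]
    refine integral_mono_ae (integrable_finsetSum _ fun i _ => (hF i).norm) hG ?_
    filter_upwards [hs] with t ht
    simp only [Real.norm_of_nonneg (h0 _ t)]
    exact sum_le_hasSum s (fun i _ => h0 i t) ht
  have h := hasSum_integral_of_summable_integral_norm hF hsum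
  have e : ∫ t, G t ∂τ = ∫ t, ∑' i, F i t ∂τ := by
    refine integral_congr_ae ?_
    filter_upwards [hs] with t ht
    exact ht.tsum_eq.symm
  rw [e]
  exact h

theorem normSq_nonneg (v : Torus L → E3) : 0 ≤ normSq v :=
  integral_nonneg fun x => by positivity

/-! ### Time averages of the mode energies -/

section Leray

variable {u : ℝ → Torus L → E3} {T₀ T₁ : ℝ}

theorem ae_restrict_Ioc {p : ℝ → Prop} (h₀ : 0 ≤ T₀)
    (h : ∀ᵐ t ∂(volume.restrict (Ioi (0 : ℝ))), p t) :
    ∀ᵐ t ∂(volume.restrict (Ioc T₀ T₁)), p t :=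
  ae_mono (Measure.restrict_mono (fun _ ht => lt_of_le_of_lt h₀ ht.1) le_rfl) h

theorem MemLeraySpace.aestronglyMeasurable_Ioc (hu : MemLeraySpace u) (h₀ : 0 ≤ T₀) :
    AEStronglyMeasurable (fun p : ℝ × Torus L => u p.1 p.2)
      ((volume.restrict (Ioc T₀ T₁)).prod volume) := by
  refine hu.measurable.mono_measure ?_
  exact Measure.prod_mono (Measure.restrict_mono (fun _ ht => lt_of_le_of_lt h₀ ht.1) le_rfl) le_rfl

theorem MemLeraySpace.integrable_normSq (hu : MemLeraySpace u) (h₀ : 0 ≤ T₀) :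
    Integrable (fun t => normSq (u t)) (volume.restrict (Ioc T₀ T₁)) := by
  obtain ⟨M, hM⟩ := hu.bounded
  have hm : AEStronglyMeasurable (fun t => normSq (u t)) (volume.restrict (Ioc T₀ T₁)) :=
    ((hu.aestronglyMeasurable_Ioc h₀).norm.pow 2).integral_prod_right'
  refine Integrable.of_bound hm M ?_
  filter_upwards [ae_restrict_Ioc h₀ hM] with t ht
  rw [Real.norm_of_nonneg (normSq_nonneg _)]
  exact ht.2

theorem MemLeraySpace.integrable_sq_integral_norm (hu : MemLeraySpace u) (h₀ : 0 ≤ T₀) :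
    Integrable (fun t => (∫ x, ‖u t x‖) ^ 2) (volume.restrict (Ioc T₀ T₁)) := by
  obtain ⟨M, hM⟩ := hu.bounded
  refine ((hu.integrable_normSq h₀).const_mul (L ^ 3)).mono'
    ((hu.aestronglyMeasurable_Ioc h₀).norm.integral_prod_right'.pow 2) ?_
  filter_upwards [ae_restrict_Ioc h₀ hM] with t ht
  rw [Real.norm_of_nonneg (by positivity)]
  exact sq_integral_norm_le ht.1

theorem MemLeraySpace.aestronglyMeasurable_fourierCoef (hu : MemLeraySpace u) (h₀ : 0 ≤ T₀)
    (j : Fin 3) (k : Fin 3 → ℤ) :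
    AEStronglyMeasurable (fun t => fourierCoef (fun x => u t x j) k)
      (volume.restrict (Ioc T₀ T₁)) := by
  have h1 : AEStronglyMeasurable (fun p : ℝ × Torus L => u p.1 p.2 j)
      ((volume.restrict (Ioc T₀ T₁)).prod volume) :=
    (EuclideanSpace.proj (𝕜 := ℝ) j).continuous.comp_aestronglyMeasurable
      (hu.aestronglyMeasurable_Ioc h₀)
  have h2 : AEStronglyMeasurable (fun p : ℝ × Torus L => torusChar k p.2 * (u p.1 p.2 j : ℂ))
      ((volume.restrict (Ioc T₀ T₁)).prod volume) :=
    ((continuous_torusChar k).comp continuous_snd).aestronglyMeasurable.mul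
      (Complex.continuous_ofReal.comp_aestronglyMeasurable h1)
  exact h2.integral_prod_right'

theorem MemLeraySpace.integrable_modeSq (hu : MemLeraySpace u) (h₀ : 0 ≤ T₀) (k : Fin 3 → ℤ) :
    Integrable (fun t => modeSq (u t) k) (volume.restrict (Ioc T₀ T₁)) := by
  obtain ⟨M, hM⟩ := hu.bounded
  refine (hu.integrable_sq_integral_norm h₀).mono' ?_ ?_
  · refine Finset.aestronglyMeasurable_fun_sum _ fun j _ => ?_
    exact (hu.aestronglyMeasurable_fourierCoef h₀ j k).norm.pow 2
  · filter_upwards [ae_restrict_Ioc h₀ hM] with t ht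
    rw [Real.norm_of_nonneg (modeSq_nonneg _ _)]
    exact modeSq_le ht.1 k

theorem timeAverage_eq (h : T₀ < T₁) (f : ℝ → ℝ) :
    timeAverage T₀ T₁ f = 1 / (T₁ - T₀) * ∫ t, f t ∂(volume.restrict (Ioc T₀ T₁)) := by
  rw [timeAverage, intervalIntegral.integral_of_le h.le]

theorem timeAverage_mono (h : T₀ < T₁) {f g : ℝ → ℝ}
    (hf : Integrable f (volume.restrict (Ioc T₀ T₁)))
    (hg : Integrable g (volume.restrict (Ioc T₀ T₁)))
    (hfg : ∀ᵐ t ∂(volume.restrict (Ioc T₀ T₁)), f t ≤ g t) :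
    timeAverage T₀ T₁ f ≤ timeAverage T₀ T₁ g := by
  rw [timeAverage_eq h, timeAverage_eq h]
  have : 0 < T₁ - T₀ := sub_pos.2 h
  exact mul_le_mul_of_nonneg_left (integral_mono_ae hf hg hfg) (by positivity)

theorem timeAverage_nonneg (h : T₀ < T₁) {f : ℝ → ℝ} (hf : ∀ t, 0 ≤ f t) :
    0 ≤ timeAverage T₀ T₁ f := by
  rw [timeAverage_eq h]
  have : 0 < T₁ - T₀ := sub_pos.2 h
  exact mul_nonneg (by positivity) (integral_nonneg hf)

theorem timeAverage_const_mul (c : ℝ) (f : ℝ → ℝ) :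
    timeAverage T₀ T₁ (fun t => c * f t) = c * timeAverage T₀ T₁ f := by
  rw [timeAverage, timeAverage, intervalIntegral.integral_const_mul]; ring

/-- The time average of the energy of the mode `k`. -/
def modeAvg (u : ℝ → Torus L → E3) (T₀ T₁ : ℝ) (k : Fin 3 → ℤ) : ℝ :=
  timeAverage T₀ T₁ fun t => modeSq (u t) k

theorem modeAvg_nonneg (h : T₀ < T₁) (k : Fin 3 → ℤ) : 0 ≤ modeAvg u T₀ T₁ k :=
  timeAverage_nonneg h fun _ => modeSq_nonneg _ _

theorem MemLeraySpace.hasSum_modeAvg (hu : MemLeraySpace u) (h₀ : 0 ≤ T₀) (h : T₀ < T₁) :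
    HasSum (modeAvg u T₀ T₁) (L ^ 3 * timeAverage T₀ T₁ fun t => normSq (u t)) := by
  obtain ⟨M, hM⟩ := hu.bounded
  rw [← timeAverage_const_mul]
  unfold modeAvg
  simp only [timeAverage_eq h]
  refine HasSum.mul_left _ ?_
  refine hasSum_integral_of_nonneg (fun k => hu.integrable_modeSq h₀ k)
    ((hu.integrable_normSq h₀).const_mul _) (fun k t => modeSq_nonneg _ _) ?_
  filter_upwards [ae_restrict_Ioc h₀ hM] with t ht
  exact hasSum_modeSq ht.1

theorem MemLeraySpace.hasSum_modeAvg_grad (hu : MemLeraySpace u) (h₀ : 0 ≤ T₀) (h : T₀ < T₁) :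
    HasSum (fun k : Fin 3 → ℤ => (2 * Real.pi / L) ^ 2 * (∑ i, (k i : ℝ) ^ 2) * modeAvg u T₀ T₁ k)
      (L ^ 3 * timeAverage T₀ T₁ fun t => gradSq (u t)) := by
  obtain ⟨M, hM⟩ := hu.bounded
  rw [← timeAverage_const_mul]
  unfold modeAvg
  simp only [← timeAverage_const_mul]
  simp only [timeAverage_eq h]
  refine HasSum.mul_left _ ?_
  refine hasSum_integral_of_nonneg (fun k => (hu.integrable_modeSq h₀ k).const_mul _)
    (Integrable.const_mul ?_ _) (fun k t => ?_) ?_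
  · exact hu.grad_integrable.mono_set fun _ ht => lt_of_le_of_lt h₀ ht.1
  · have := modeSq_nonneg (u t) k
    have : 0 ≤ ∑ i, (k i : ℝ) ^ 2 := Finset.sum_nonneg fun _ _ => sq_nonneg _
    positivity
  · filter_upwards [ae_restrict_Ioc h₀ hM, ae_restrict_Ioc h₀ hu.weakDiff] with t ht hd
    exact hasSum_gradSq ht.1 hd

theorem MemLeraySpace.modeAvg_le (hu : MemLeraySpace u) (h₀ : 0 ≤ T₀) (h : T₀ < T₁)
    (k : Fin 3 → ℤ) : modeAvg u T₀ T₁ k ≤ timeAverage T₀ T₁ fun t => (∫ x, ‖u t x‖) ^ 2 := by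
  obtain ⟨M, hM⟩ := hu.bounded
  refine timeAverage_mono h (hu.integrable_modeSq h₀ k) (hu.integrable_sq_integral_norm h₀) ?_
  filter_upwards [ae_restrict_Ioc h₀ hM] with t ht
  exact modeSq_le ht.1 k

end Leray

/-! ### Conservation of the mean velocity -/

theorem torusPartial_const (i : Fin 3) (c : ℝ) :
    torusPartial (L := L) i (fun _ => c) = fun _ => 0 := by
  ext x
  simp [torusPartial]

/-- The spatially constant test field `χ(t) eⱼ`. -/
theorem isTestField_const {χ : ℝ → ℝ} (hχ : ContDiff ℝ (⊤ : ℕ∞) χ) {R : ℝ}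
    (hR : ∀ t, R ≤ t → χ t = 0) (j : Fin 3) :
    IsTestField (L := L) fun t _ i => if i = j then χ t else 0 where
  smooth i := by
    by_cases h : i = j
    · simp only [h, if_true]
      exact hχ.comp contDiff_fst
    · simp only [h, if_false]
      exact contDiff_const
  vanish := ⟨R, fun t ht => by ext x i; simp [hR t ht]⟩
  divFree t x := by
    simp [torusPartial_const]

/-- The primitive is normalized to vanish for large times, as a test field must; it need not vanish
at time 0, and this is how the initial data enter. -/
theorem exists_smooth_primitive {θ : ℝ → ℝ} (hθ : ContDiff ℝ (⊤ : ℕ∞) θ)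
    (hc : HasCompactSupport θ) :
    ∃ χ : ℝ → ℝ, ContDiff ℝ (⊤ : ℕ∞) χ ∧ deriv χ = θ ∧ ∃ R, ∀ t, R ≤ t → χ t = 0 := by
  obtain ⟨R, hR⟩ := hc.isCompact.bddAbove
  have hzero : ∀ t, R + 1 ≤ t → θ t = 0 := fun t ht => by
    by_contra h
    have := hR (subset_tsupport _ h)
    linarith
  have hd : ∀ t, HasDerivAt (fun t => ∫ s in (R + 1)..t, θ s) (θ t) t := fun t =>
    intervalIntegral.integral_hasDerivAt_right (hθ.continuous.intervalIntegrable _ _)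
      hθ.continuous.stronglyMeasurable.stronglyMeasurableAtFilter hθ.continuous.continuousAt
  have hderiv : deriv (fun t => ∫ s in (R + 1)..t, θ s) = θ := funext fun t => (hd t).deriv
  refine ⟨_, contDiff_infty_iff_deriv.2 ⟨fun t => (hd t).differentiableAt, ?_⟩, hderiv, R + 1, ?_⟩
  · rw [hderiv]; exact hθ
  · intro t ht
    rw [intervalIntegral.integral_of_le ht]
    exact setIntegral_eq_zero_of_forall_eq_zero fun s hs => hzero s hs.1.le

/-- For a test field constant in space the viscous and convective terms disappear, leaving the
derivative of the mean against time. -/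
theorem IsWeakSolutionNS.integral_mean_mul {ν : ℝ} {u₀ : Torus L → E3} {u : ℝ → Torus L → E3}
    (h : IsWeakSolutionNS ν u₀ u) {θ : ℝ → ℝ} (hθ : ContDiff ℝ (⊤ : ℕ∞) θ)
    (hc : HasCompactSupport θ) (j : Fin 3) (h0 : ∫ x, u₀ x j = 0) :
    ∫ t in Ioi (0 : ℝ), θ t * ∫ x, u t x j = 0 := by
  obtain ⟨χ, hχ, hd, R, hR⟩ := exists_smooth_primitive hθ hc
  have h1 := h _ (isTestField_const hχ hR j)
  have hder : ∀ (i : Fin 3) (t : ℝ),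
      deriv (fun s => if i = j then χ s else 0) t = if i = j then θ t else 0 := by
    intro i t
    split_ifs
    · rw [hd]
    · simp
  simp only [torusPartial_const, hder, Finset.sum_const_zero, mul_zero, add_zero, mul_ite,
    Finset.sum_ite_eq', Finset.mem_univ, if_true, integral_mul_const] at h1
  rw [h0, zero_mul, add_zero] at h1
  simpa only [mul_comm] using h1

theorem fourierCoef_zero {f : Torus L → ℝ} :
    fourierCoef f 0 = ((∫ x, f x : ℝ) : ℂ) := by
  rw [fourierCoef_eq, ← integral_complex_ofReal]
  simp [torusChar_zero]

/-- The spatial mean is orthogonal to all test functions of time on `(0, ∞)`, hence zero almost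
everywhere. -/
theorem IsLeraySolution.ae_modeSq_zero {ν ρ : ℝ} {u₀ : Torus L → E3} {u : ℝ → Torus L → E3}
    (h : IsLeraySolution ν u₀ u) (hρ : 0 < ρ) (h0 : ∫ x, ρ • u₀ x = 0) :
    ∀ᵐ t ∂(volume.restrict (Ioi (0 : ℝ))), modeSq (u t) 0 = 0 := by
  have hmean : ∀ j, ∫ x, u₀ x j = 0 := by
    intro j
    rw [integral_smul] at h0
    have h1 : ∫ x, u₀ x = 0 := (smul_eq_zero.1 h0).resolve_left hρ.ne'
    have h2 := (EuclideanSpace.proj (𝕜 := ℝ) j).integral_comp_comm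
      (h.initial_memLp.integrable (by norm_num))
    rw [h1, map_zero] at h2
    exact h2
  have hj : ∀ j, ∀ᵐ t ∂(volume.restrict (Ioi (0 : ℝ))), ∫ x, u t x j = 0 := by
    intro j
    rw [ae_restrict_iff' measurableSet_Ioi]
    refine isOpen_Ioi.ae_eq_zero_of_integral_contDiff_smul_eq_zero ?_ ?_
    · rw [locallyIntegrableOn_iff isOpen_Ioi.isLocallyClosed]
      intro K hK hKc
      obtain ⟨R, hR⟩ := hKc.bddAbove
      have hint : IntegrableOn (fun t => ∫ x, u t x j) (Ioc 0 R) := by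
        -- Uses `|y| ≤ 1 + y²` for the mean `y`, whose square is bounded by the mode 0.
        refine Integrable.mono' (g := fun t => 1 + modeSq (u t) 0)
          ((integrable_const _).add (h.leraySpace.integrable_modeSq le_rfl 0)) ?_ ?_
        · have := (h.leraySpace.aestronglyMeasurable_fourierCoef (T₁ := R) le_rfl j 0)
          have h2 := Complex.continuous_re.comp_aestronglyMeasurable this
          simpa only [fourierCoef_zero, Complex.ofReal_re] using h2
        · refine ae_of_all _ fun t => ?_
          have h1 : ‖fourierCoef (fun x => u t x j) 0‖ ^ 2 ≤ modeSq (u t) 0 :=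
            Finset.single_le_sum (f := fun j => ‖fourierCoef (fun x => u t x j) 0‖ ^ 2)
              (fun _ _ => by positivity) (Finset.mem_univ j)
          rw [fourierCoef_zero, Complex.norm_real] at h1
          nlinarith [sq_nonneg (‖∫ x, u t x j‖ - 1)]
      exact hint.mono_set fun t ht => ⟨hK ht, hR ht⟩
    · intro g hg hgc hgs
      have := h.weakSolution.integral_mean_mul hg hgc j (hmean j)
      rw [setIntegral_eq_integral_of_forall_compl_eq_zero] at this
      · simpa only [smul_eq_mul] using this
      · intro t ht
        rw [image_eq_zero_of_notMem_tsupport fun h' => ht (hgs h'), zero_mul]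
  filter_upwards [ae_all_iff.2 hj] with t ht
  simp [modeSq, fourierCoef_zero, ht]

theorem IsLeraySolution.modeAvg_zero {ν ρ : ℝ} {u₀ : Torus L → E3} {u : ℝ → Torus L → E3}
    (h : IsLeraySolution ν u₀ u) (hρ : 0 < ρ) (h0 : ∫ x, ρ • u₀ x = 0) {T₀ T₁ : ℝ} (h₀ : 0 ≤ T₀)
    (h₁ : T₀ < T₁) : modeAvg u T₀ T₁ 0 = 0 := by
  rw [modeAvg, timeAverage_eq h₁, integral_eq_zero_of_ae, mul_zero]
  exact ae_restrict_Ioc h₀ (h.ae_modeSq_zero hρ h0)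

/-! ### Energy shells -/

/-- `|k|²` as a natural number. -/
def sqNat (k : Fin 3 → ℤ) : ℕ := (∑ i, k i ^ 2).toNat

theorem sqNat_cast (k : Fin 3 → ℤ) : (sqNat k : ℤ) = ∑ i, k i ^ 2 :=
  Int.toNat_of_nonneg (Finset.sum_nonneg fun _ _ => sq_nonneg _)

theorem sqNat_cast_real (k : Fin 3 → ℤ) : (sqNat k : ℝ) = ∑ i, (k i : ℝ) ^ 2 := by
  have := congrArg (Int.cast : ℤ → ℝ) (sqNat_cast k)
  push_cast at this
  exact this

theorem isSumThreeSq_sqNat (k : Fin 3 → ℤ) : IsSumThreeSq (sqNat k) := ⟨k, (sqNat_cast k).symm⟩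

theorem sqNat_eq_zero {k : Fin 3 → ℤ} (h : sqNat k = 0) : k = 0 := by
  have h1 := sqNat_cast k
  rw [h, Nat.cast_zero, eq_comm, Finset.sum_eq_zero_iff_of_nonneg fun _ _ => sq_nonneg _] at h1
  ext i
  simpa using h1 i (Finset.mem_univ i)

theorem sq_le_sqNat (k : Fin 3 → ℤ) (i : Fin 3) : k i ^ 2 ≤ sqNat k := by
  rw [sqNat_cast]
  exact Finset.single_le_sum (f := fun i => k i ^ 2) (fun _ _ => sq_nonneg _) (Finset.mem_univ i)

theorem finite_sqNat_eq (n : ℕ) : Finite {k : Fin 3 → ℤ // sqNat k = n} := by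
  refine (Set.finite_Icc (fun _ : Fin 3 => -(n : ℤ)) (fun _ => (n : ℤ))).subset ?_
  intro k hk
  have hk' : sqNat k = n := hk
  have h : ∀ i, k i ^ 2 ≤ n := fun i => hk' ▸ sq_le_sqNat k i
  refine ⟨fun i => ?_, fun i => ?_⟩
  · nlinarith [h i, Int.le_self_sq (k i), Int.le_self_sq (-k i)]
  · nlinarith [h i, Int.le_self_sq (k i)]

theorem freqNorm_eq (k : Fin 3 → ℤ) : freqNorm L k = 2 * Real.pi / L * Real.sqrt (sqNat k) := by
  rw [freqNorm, sqNat_cast_real]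

theorem unitFreq_pos : 0 < 2 * Real.pi / L := by
  have hL : 0 < L := Fact.out
  positivity

theorem freq_le_iff {a b : ℝ} (ha : 0 ≤ b) :
    2 * Real.pi / L * Real.sqrt a ≤ 2 * Real.pi / L * Real.sqrt b ↔ a ≤ b := by
  rw [mul_le_mul_iff_right₀ unitFreq_pos, Real.sqrt_le_sqrt_iff ha]

theorem freq_injective {a b : ℕ} (h : 2 * Real.pi / L * Real.sqrt a = 2 * Real.pi / L * Real.sqrt b) :
    a = b := by
  have h1 := (freq_le_iff (L := L) (a := a) (b := b) (by positivity)).1 h.le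
  have h2 := (freq_le_iff (L := L) (a := b) (b := a) (by positivity)).1 h.ge
  exact_mod_cast le_antisymm h1 h2

theorem mem_stokesSpectrum {K : ℝ} :
    K ∈ stokesSpectrum L ↔ ∃ n : ℕ, IsSumThreeSq n ∧ 2 * Real.pi / L * Real.sqrt n = K := by
  constructor
  · rintro ⟨k, rfl⟩
    exact ⟨sqNat k, isSumThreeSq_sqNat k, (freqNorm_eq k).symm⟩
  · rintro ⟨n, ⟨k, hk⟩, rfl⟩
    refine ⟨k, ?_⟩
    rw [freqNorm_eq]
    congr 3
    rw [← sqNat_cast] at hk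
    exact_mod_cast hk

theorem measurableSet_stokesSpectrum : MeasurableSet (stokesSpectrum L) :=
  (Set.countable_range _).measurableSet

theorem countable_stokesSpectrumStar : Countable (stokesSpectrumStar L) :=
  ((Set.countable_range (freqNorm L)).mono sdiff_subset).to_subtype

/-- The enumeration of `Σ*` by the positive sums of three squares. -/
def shellEquiv (L : ℝ) [Fact (0 < L)] :
    {n : ℕ // 0 < n ∧ IsSumThreeSq n} ≃ stokesSpectrumStar L :=
  Equiv.ofBijective
    (fun n => ⟨2 * Real.pi / L * Real.sqrt n.1, mem_stokesSpectrum.2 ⟨n.1, n.2.2, rfl⟩, by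
      have : (0 : ℝ) < n.1 := by exact_mod_cast n.2.1
      have := unitFreq_pos (L := L)
      simp only [mem_singleton_iff]
      positivity⟩)
    ⟨fun a b h => Subtype.ext (freq_injective (congrArg Subtype.val h)), by
      rintro ⟨K, hK, hK0⟩
      obtain ⟨n, hn, rfl⟩ := mem_stokesSpectrum.1 hK
      refine ⟨⟨n, ?_, hn⟩, rfl⟩
      rcases Nat.eq_zero_or_pos n with rfl | h
      · simp at hK0
      · exact h⟩

theorem shellEquiv_apply (n : {n : ℕ // 0 < n ∧ IsSumThreeSq n}) :
    (shellEquiv L n : ℝ) = 2 * Real.pi / L * Real.sqrt n.1 := rfl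

/-- At `K = κ√n` the weight `κ · 2π/(KL)` of the measure is `κ/√n`. -/
theorem lintegral_spectralMeasure {S : Set ℝ} (hS : MeasurableSet S) (F : ℝ → ENNReal) :
    ∫⁻ K in S, F K ∂(spectralMeasure L) = ∑' n : {n : ℕ // 0 < n ∧ IsSumThreeSq n},
      ENNReal.ofReal (2 * Real.pi / L / Real.sqrt n) *
        S.indicator F (2 * Real.pi / L * Real.sqrt n) := by
  have := countable_stokesSpectrumStar (L := L)
  have hL : 0 < L := Fact.out
  rw [← lintegral_indicator hS, spectralMeasure, lintegral_sum_measure, ← (shellEquiv L).tsum_eq]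
  refine tsum_congr fun n => ?_
  have hn : (0 : ℝ) < n.1 := by exact_mod_cast n.2.1
  rw [lintegral_smul_measure, lintegral_dirac, shellEquiv_apply, smul_eq_mul]
  congr 2
  have : Real.sqrt n.1 ≠ 0 := by positivity
  field_simp [Real.pi_ne_zero]

section Shell

variable (ρ : ℝ) (u : ℝ → Torus L → E3) (T₀ T₁ : ℝ)

/-- The mean energy of the shell `|k|² = n`. -/
def shellEnergy (n : ℕ) : ℝ := ρ / L ^ 3 * ∑' k : {k : Fin 3 → ℤ // sqNat k = n}, modeAvg u T₀ T₁ k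

variable {ρ u T₀ T₁}

theorem shellEnergy_nonneg (hρ : 0 < ρ) (h : T₀ < T₁) (n : ℕ) : 0 ≤ shellEnergy ρ u T₀ T₁ n := by
  have hL : 0 < L := Fact.out
  exact mul_nonneg (by positivity) (tsum_nonneg fun k => modeAvg_nonneg h _)

theorem shellEnergy_of_not {n : ℕ} (hn : ¬ IsSumThreeSq n) : shellEnergy ρ u T₀ T₁ n = 0 := by
  have : IsEmpty {k : Fin 3 → ℤ // sqNat k = n} :=
    ⟨fun k => hn (k.2 ▸ isSumThreeSq_sqNat k.1)⟩
  rw [shellEnergy, tsum_empty, mul_zero]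

theorem shellEnergy_zero : shellEnergy ρ u T₀ T₁ 0 = ρ / L ^ 3 * modeAvg u T₀ T₁ 0 := by
  have : Unique {k : Fin 3 → ℤ // sqNat k = 0} :=
    { default := ⟨0, by simp [sqNat]⟩
      uniq := fun k => Subtype.ext (sqNat_eq_zero k.2) }
  rw [shellEnergy, tsum_eq_single default fun b hb => (hb (Subsingleton.elim _ _)).elim]
  congr 2
  exact sqNat_eq_zero (default : {k : Fin 3 → ℤ // sqNat k = 0}).2

theorem MemLeraySpace.hasSum_shellEnergy (hu : MemLeraySpace u) (h₀ : 0 ≤ T₀) (h : T₀ < T₁) :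
    HasSum (shellEnergy ρ u T₀ T₁) (meanEnergy ρ u T₀ T₁) := by
  have hL : 0 < L := Fact.out
  have h1 := ((hu.hasSum_modeAvg h₀ h).tsum_fiberwise sqNat).mul_left (ρ / L ^ 3)
  have e : ρ / L ^ 3 * (L ^ 3 * timeAverage T₀ T₁ fun t => normSq (u t))
      = meanEnergy ρ u T₀ T₁ := by
    rw [meanEnergy, timeAverage_const_mul]; field_simp
  rw [e] at h1
  exact h1

theorem MemLeraySpace.hasSum_shellEnergy_grad (hu : MemLeraySpace u) (h₀ : 0 ≤ T₀)
    (h : T₀ < T₁) :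
    HasSum (fun n : ℕ => (2 * Real.pi / L) ^ 2 * n * shellEnergy ρ u T₀ T₁ n)
      (ρ * timeAverage T₀ T₁ fun t => gradSq (u t)) := by
  have hL : 0 < L := Fact.out
  have h1 := ((hu.hasSum_modeAvg_grad h₀ h).tsum_fiberwise sqNat).mul_left (ρ / L ^ 3)
  have e : ρ / L ^ 3 * (L ^ 3 * timeAverage T₀ T₁ fun t => gradSq (u t))
      = ρ * timeAverage T₀ T₁ fun t => gradSq (u t) := by
    field_simp
  rw [e] at h1
  convert! h1 using 1
  ext n
  have e2 : ∀ k : sqNat ⁻¹' {n}, (2 * Real.pi / L) ^ 2 * (∑ i, ((k : Fin 3 → ℤ) i : ℝ) ^ 2) *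
      modeAvg u T₀ T₁ k = (2 * Real.pi / L) ^ 2 * n * modeAvg u T₀ T₁ k := by
    intro k
    rw [← sqNat_cast_real, show sqNat (k : Fin 3 → ℤ) = n from k.2]
  rw [tsum_congr e2, tsum_mul_left, shellEnergy]
  change _ = ρ / L ^ 3 * ((2 * Real.pi / L) ^ 2 * n *
    ∑' k : {k : Fin 3 → ℤ // sqNat k = n}, modeAvg u T₀ T₁ k)
  ring

/-- The dictionary between the two spectra: the factor `√n` turns the exponent `-5/3` in `K`, that
is `-5/6` in `n`, into `-4/3` for the shell energy. -/
theorem MemLeraySpace.meanSpectrum_eq (hu : MemLeraySpace u) (h₀ : 0 ≤ T₀) (h : T₀ < T₁) (n : ℕ) :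
    meanSpectrum ρ u T₀ T₁ (2 * Real.pi / L * Real.sqrt n)
      = Real.sqrt n / (2 * Real.pi / L) * shellEnergy ρ u T₀ T₁ n := by
  have hL : 0 < L := Fact.out
  have hfin := finite_sqNat_eq n
  have := Fintype.ofFinite {k : Fin 3 → ℤ // sqNat k = n}
  have e : ∀ v : Torus L → E3, energySpectrum ρ v (2 * Real.pi / L * Real.sqrt n)
      = 1 / (2 * Real.pi) ^ 2 * ρ * ((2 * Real.pi / L * Real.sqrt n) / L) *
        ∑ k : {k : Fin 3 → ℤ // sqNat k = n}, modeSq v k := by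
    intro v
    rw [energySpectrum, ← tsum_fintype (L := .unconditional _)]
    congr 1
    let φ : {k : Fin 3 → ℤ // freqNorm L k = 2 * Real.pi / L * Real.sqrt n} ≃
        {k : Fin 3 → ℤ // sqNat k = n} := Equiv.subtypeEquivRight fun k => by
      rw [freqNorm_eq]
      exact ⟨fun h => freq_injective h, fun h => by rw [h]⟩
    rw [← φ.tsum_eq]
    rfl
  rw [meanSpectrum]
  simp only [e]
  rw [timeAverage_const_mul, shellEnergy, tsum_fintype, timeAverage_eq h,
    integral_finsetSum _ fun k _ => hu.integrable_modeSq h₀ _, Finset.mul_sum]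
  simp only [modeAvg, timeAverage_eq h]
  field_simp [Real.pi_ne_zero]

/-- The weight `κ/√n` of the measure cancels the factor `√n/κ` of the spectrum. The indicator allows
any measurable `S`. -/
theorem MemLeraySpace.meanEnstrophy_eq (hu : MemLeraySpace u) (h₀ : 0 ≤ T₀) (h : T₀ < T₁)
    (hρ : 0 < ρ) {S : Set ℝ} (hS : MeasurableSet S) :
    meanEnstrophy ρ u T₀ T₁ S = ∑' n : ℕ, ENNReal.ofReal
      ({n : ℕ | 2 * Real.pi / L * Real.sqrt n ∈ S}.indicator
        (fun n : ℕ => (2 * Real.pi / L) ^ 2 * n * shellEnergy ρ u T₀ T₁ n) n) := by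
  have hL : 0 < L := Fact.out
  rw [meanEnstrophy, lintegral_spectralMeasure hS]
  have hsupp : Function.support (fun n : ℕ => ENNReal.ofReal
      ({n : ℕ | 2 * Real.pi / L * Real.sqrt n ∈ S}.indicator
        (fun n : ℕ => (2 * Real.pi / L) ^ 2 * n * shellEnergy ρ u T₀ T₁ n) n))
      ⊆ {n : ℕ | 0 < n ∧ IsSumThreeSq n} := by
    intro n hn
    simp only [Function.mem_support, indicator] at hn
    refine ⟨?_, ?_⟩
    · rcases Nat.eq_zero_or_pos n with rfl | h
      · simp at hn
      · exact h
    · by_contra hn'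
      simp [shellEnergy_of_not hn'] at hn
  rw [← tsum_subtype_eq_of_support_subset hsupp]
  refine tsum_congr fun n => ?_
  have hn : (0 : ℝ) < n.1 := by exact_mod_cast n.2.1
  simp only [indicator, mem_ofPred_eq]
  split_ifs
  · rw [← ENNReal.ofReal_mul (by positivity), hu.meanSpectrum_eq h₀ h]
    congr 1
    have hsq : Real.sqrt n.1 ^ 2 = n.1 := Real.sq_sqrt hn.le
    have : Real.sqrt n.1 ≠ 0 := by positivity
    field_simp [Real.pi_ne_zero]
    rw [hsq, mul_comm]
  · simp

theorem MemLeraySpace.meanEnstrophy_spectrum (hu : MemLeraySpace u) (h₀ : 0 ≤ T₀) (h : T₀ < T₁)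
    (hρ : 0 < ρ) : meanEnstrophy ρ u T₀ T₁ (stokesSpectrum L)
      = ENNReal.ofReal (ρ * timeAverage T₀ T₁ fun t => gradSq (u t)) := by
  have hs := hu.hasSum_shellEnergy_grad (ρ := ρ) h₀ h
  rw [hu.meanEnstrophy_eq h₀ h hρ measurableSet_stokesSpectrum, ← hs.tsum_eq,
    ENNReal.ofReal_tsum_of_nonneg _ hs.summable]
  · refine tsum_congr fun n => ?_
    congr 1
    rw [indicator_apply_eq_self]
    intro hn
    rw [shellEnergy_of_not, mul_zero]
    exact fun h' => hn (mem_stokesSpectrum.2 ⟨n, h', rfl⟩)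
  · intro n
    have := shellEnergy_nonneg (u := u) hρ h n
    positivity

theorem MemLeraySpace.meanEnstrophy_Icc (hu : MemLeraySpace u) (h₀ : 0 ≤ T₀) (h : T₀ < T₁)
    (hρ : 0 < ρ) {m : ℝ} (hm : 0 ≤ m) (N : ℕ) :
    meanEnstrophy ρ u T₀ T₁
      (Icc (2 * Real.pi / L * Real.sqrt m) (2 * Real.pi / L * Real.sqrt N))
      = ENNReal.ofReal ((2 * Real.pi / L) ^ 2 *
        ∑ n ∈ threeSqWindow m N, n * shellEnergy ρ u T₀ T₁ n) := by
  rw [hu.meanEnstrophy_eq h₀ h hρ measurableSet_Icc, Finset.mul_sum,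
    ENNReal.ofReal_sum_of_nonneg]
  · have hmem : ∀ n : ℕ, 2 * Real.pi / L * Real.sqrt n ∈
        Icc (2 * Real.pi / L * Real.sqrt m) (2 * Real.pi / L * Real.sqrt N) ↔ m ≤ n ∧ n ≤ N := by
      intro n
      rw [mem_Icc, freq_le_iff (by positivity), freq_le_iff (by positivity), Nat.cast_le]
    rw [tsum_eq_sum (s := threeSqWindow m N)]
    · refine Finset.sum_congr rfl fun n hn => ?_
      obtain ⟨h1, h2, -⟩ := mem_threeSqWindow.1 hn
      have hin : n ∈ {n : ℕ | 2 * Real.pi / L * Real.sqrt n ∈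
          Icc (2 * Real.pi / L * Real.sqrt m) (2 * Real.pi / L * Real.sqrt N)} :=
        (hmem n).2 ⟨h2, h1⟩
      rw [indicator_of_mem hin, mul_assoc]
    · intro n hn
      rw [ENNReal.ofReal_eq_zero]
      refine le_of_eq (indicator_apply_eq_zero.2 fun h' => ?_)
      obtain ⟨h2, h1⟩ := (hmem n).1 h'
      rw [shellEnergy_of_not, mul_zero]
      exact fun h3 => hn (mem_threeSqWindow.2 ⟨h1, h2, h3⟩)
  · intro n _
    have := shellEnergy_nonneg (u := u) hρ h n
    positivity

end Shell

/-! ### The power law in the inertial range -/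

section Range

variable {ρ : ℝ} {u : ℝ → Torus L → E3} {T₀ T₁ : ℝ}

theorem finite_stokesSpectrum_Iic (N : ℕ) :
    {K ∈ stokesSpectrum L | K ≤ 2 * Real.pi / L * Real.sqrt N}.Finite := by
  refine ((Set.finite_Iic N).image fun n : ℕ => 2 * Real.pi / L * Real.sqrt n).subset ?_
  rintro K ⟨hK, hKN⟩
  obtain ⟨n, -, rfl⟩ := mem_stokesSpectrum.1 hK
  rw [freq_le_iff (by positivity)] at hKN
  exact ⟨n, by exact_mod_cast hKN, rfl⟩

/-- The supremum is a genuine upper bound because only finitely many frequencies lie below the upper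
end; the supremum of an unbounded set would be 0 by convention. -/
theorem le_spectralPrecision {a : ℝ} {N : ℕ} {K K' : ℝ} (hK : K ∈ stokesSpectrum L)
    (hK' : K' ∈ stokesSpectrum L) (ha : a ≤ K) (hlt : K < K')
    (hN : K' ≤ 2 * Real.pi / L * Real.sqrt N) (hc : ∀ κ ∈ stokesSpectrum L, ¬(K < κ ∧ κ < K')) :
    |Real.log (meanSpectrum ρ u T₀ T₁ K' / meanSpectrum ρ u T₀ T₁ K) / Real.log (K' / K) + 5 / 3|
      ≤ spectralPrecision ρ u T₀ T₁ a (2 * Real.pi / L * Real.sqrt N) := by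
  refine le_csSup (Set.Finite.bddAbove ?_) ⟨K, hK, K', hK', ha, hlt, hN, hc, rfl⟩
  have hfin := finite_stokesSpectrum_Iic (L := L) N
  refine ((hfin.prod hfin).image fun p : ℝ × ℝ => |Real.log (meanSpectrum ρ u T₀ T₁ p.2 /
    meanSpectrum ρ u T₀ T₁ p.1) / Real.log (p.2 / p.1) + 5 / 3|).subset ?_
  rintro g ⟨K, hK, K', hK', -, h1, h2, -, rfl⟩
  exact ⟨(K, K'), ⟨⟨hK, h1.le.trans h2⟩, ⟨hK', h2⟩⟩, rfl⟩

theorem spectralPrecision_nonneg (a b : ℝ) : 0 ≤ spectralPrecision ρ u T₀ T₁ a b := by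
  refine Real.sSup_nonneg ?_
  rintro g ⟨K, -, K', -, -, -, -, -, rfl⟩
  exact abs_nonneg _

/-- The compensated logarithm `log (e(n) n^{4/3})` varies along the window by at most
`γ/2 · log (N/n)`. -/
theorem MemLeraySpace.abs_log_shellEnergy_sub_le (hu : MemLeraySpace u) (h₀ : 0 ≤ T₀)
    (h : T₀ < T₁) {m : ℝ} (hm : 1 ≤ m) {N : ℕ} (hS : IsSumThreeSq N)
    (hpos : ∀ n ∈ threeSqWindow m N, 0 < shellEnergy ρ u T₀ T₁ n) {n : ℕ}
    (hn : n ∈ threeSqWindow m N) :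
    |(Real.log (shellEnergy ρ u T₀ T₁ N) + 4 / 3 * Real.log N)
        - (Real.log (shellEnergy ρ u T₀ T₁ n) + 4 / 3 * Real.log n)|
      ≤ spectralPrecision ρ u T₀ T₁ (2 * Real.pi / L * Real.sqrt m) (2 * Real.pi / L * Real.sqrt N)
        / 2 * (Real.log N - Real.log n) := by
  classical
  set γ := spectralPrecision ρ u T₀ T₁ (2 * Real.pi / L * Real.sqrt m)
    (2 * Real.pi / L * Real.sqrt N)
  set e := shellEnergy ρ u T₀ T₁
  have hκ := unitFreq_pos (L := L)
  induction hd : N - n using Nat.strong_induction_on generalizing n with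
  | _ d ih =>
  obtain ⟨hnN, hmn, hSn⟩ := mem_threeSqWindow.1 hn
  rcases hnN.eq_or_lt with rfl | hlt
  · simp
  -- The least sum of three squares above `n` gives the next element of `Σ`, and the induction runs
  -- downwards from `N`.
  have hex : ∃ k, n < k ∧ IsSumThreeSq k := ⟨N, hlt, hS⟩
  obtain ⟨hlt', hS'⟩ := Nat.find_spec hex
  have hmin : ∀ k, n < k → IsSumThreeSq k → Nat.find hex ≤ k := fun k h1 h2 =>
    Nat.find_min' hex ⟨h1, h2⟩
  set n' := Nat.find hex
  have hn'N : n' ≤ N := hmin N hlt hS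
  have hltR : (n : ℝ) < n' := by exact_mod_cast hlt'
  have hn' : n' ∈ threeSqWindow m N := mem_threeSqWindow.2 ⟨hn'N, by linarith, hS'⟩
  have hind := ih (N - n') (by omega) hn' rfl
  have hn0 : (0 : ℝ) < n := by linarith
  have hn'0 : (0 : ℝ) < n' := by linarith
  have hsn : 0 < Real.sqrt n := Real.sqrt_pos.2 hn0
  have hsn' : 0 < Real.sqrt n' := Real.sqrt_pos.2 hn'0
  have hstep : |(Real.log (e n') + 4 / 3 * Real.log n') - (Real.log (e n) + 4 / 3 * Real.log n)|
      ≤ γ / 2 * (Real.log n' - Real.log n) := by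
    have hle := le_spectralPrecision (ρ := ρ) (u := u) (T₀ := T₀) (T₁ := T₁)
      (a := 2 * Real.pi / L * Real.sqrt m) (N := N)
      (mem_stokesSpectrum.2 ⟨n, hSn, rfl⟩) (mem_stokesSpectrum.2 ⟨n', hS', rfl⟩)
      ((freq_le_iff hn0.le).2 hmn)
      (mul_lt_mul_of_pos_left (Real.sqrt_lt_sqrt hn0.le hltR) hκ)
      ((freq_le_iff (by positivity)).2 (by exact_mod_cast hn'N)) (by
        rintro K hK ⟨h1, h2⟩
        obtain ⟨k, hk, rfl⟩ := mem_stokesSpectrum.1 hK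
        rw [← not_le, freq_le_iff (by positivity), not_le, Nat.cast_lt] at h1 h2
        exact absurd (hmin k h1 hk) (not_le.2 h2))
    rw [hu.meanSpectrum_eq h₀ h, hu.meanSpectrum_eq h₀ h] at hle
    have he := hpos n hn
    have he' := hpos n' hn'
    have hD : 0 < Real.log n' - Real.log n := sub_pos.2 (Real.log_lt_log hn0 hltR)
    have l1 : Real.log (Real.sqrt n' / (2 * Real.pi / L) * e n' /
        (Real.sqrt n / (2 * Real.pi / L) * e n))
        = (Real.log (e n') - Real.log (e n)) + (Real.log n' - Real.log n) / 2 := by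
      rw [show Real.sqrt n' / (2 * Real.pi / L) * e n' / (Real.sqrt n / (2 * Real.pi / L) * e n)
        = (e n' / e n) * (Real.sqrt n' / Real.sqrt n) by
          rw [mul_div_mul_comm, div_div_div_cancel_right₀ hκ.ne', mul_comm],
        Real.log_mul (div_ne_zero he'.ne' he.ne') (by positivity),
        Real.log_div he'.ne' he.ne', Real.log_div hsn'.ne' hsn.ne', Real.log_sqrt hn'0.le,
        Real.log_sqrt hn0.le]
      ring
    have l2 : Real.log (2 * Real.pi / L * Real.sqrt n' / (2 * Real.pi / L * Real.sqrt n))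
        = (Real.log n' - Real.log n) / 2 := by
      rw [mul_div_mul_left _ _ hκ.ne', Real.log_div hsn'.ne' hsn.ne', Real.log_sqrt hn'0.le,
        Real.log_sqrt hn0.le]
      ring
    rw [l1, l2] at hle
    set D := Real.log n' - Real.log n with hDdef
    -- Frequencies being square roots, `log (K'/K) = D/2`; the `D/2` from the spectrum and `5/3 ·
    -- D/2` add up to `4/3 · D`.
    have e1 : (Real.log (e n') + 4 / 3 * Real.log n') - (Real.log (e n) + 4 / 3 * Real.log n)
        = ((Real.log (e n') - Real.log (e n) + D / 2) / (D / 2) + 5 / 3) * (D / 2) := by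
      field_simp
      rw [hDdef]; ring
    rw [e1, abs_mul, abs_of_pos (half_pos hD), show γ / 2 * D = γ * (D / 2) by ring]
    exact mul_le_mul_of_nonneg_right hle (half_pos hD).le
  calc |(Real.log (e N) + 4 / 3 * Real.log N) - (Real.log (e n) + 4 / 3 * Real.log n)|
      ≤ |(Real.log (e N) + 4 / 3 * Real.log N) - (Real.log (e n') + 4 / 3 * Real.log n')|
        + |(Real.log (e n') + 4 / 3 * Real.log n') - (Real.log (e n) + 4 / 3 * Real.log n)| :=
        abs_sub_le _ _ _
    _ ≤ γ / 2 * (Real.log N - Real.log n') + γ / 2 * (Real.log n' - Real.log n) :=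
        add_le_add hind hstep
    _ = _ := by ring

/-- Shell energies in the window are comparable to `n^{-4/3}`. -/
theorem MemLeraySpace.shellEnergy_bounds (hu : MemLeraySpace u) (h₀ : 0 ≤ T₀)
    (h : T₀ < T₁) {m : ℝ} (hm : 1 ≤ m) {N : ℕ} (hS : IsSumThreeSq N) (hmN : m < N)
    (hpos : ∀ n ∈ threeSqWindow m N, 0 < shellEnergy ρ u T₀ T₁ n) {G p : ℝ}
    (hG : G = Real.exp (spectralPrecision ρ u T₀ T₁ (2 * Real.pi / L * Real.sqrt m)
      (2 * Real.pi / L * Real.sqrt N) / 2 * Real.log (N / m)))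
    (hp : p = shellEnergy ρ u T₀ T₁ N * (N : ℝ) ^ (4 / 3 : ℝ)) {n : ℕ}
    (hn : n ∈ threeSqWindow m N) :
    G⁻¹ * p * (n : ℝ) ^ (-(4 / 3) : ℝ) ≤ shellEnergy ρ u T₀ T₁ n ∧
      shellEnergy ρ u T₀ T₁ n ≤ G * p * (n : ℝ) ^ (-(4 / 3) : ℝ) := by
  have hN : N ∈ threeSqWindow m N := mem_threeSqWindow.2 ⟨le_rfl, hmN.le, hS⟩
  have hle := hu.abs_log_shellEnergy_sub_le h₀ h hm hS hpos hn
  obtain ⟨hnN, hmn, hSn⟩ := mem_threeSqWindow.1 hn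
  have hn0 : (0 : ℝ) < n := by linarith
  have hN0 : (0 : ℝ) < N := by linarith
  have he := hpos n hn
  have heN := hpos N hN
  set γ := spectralPrecision ρ u T₀ T₁ (2 * Real.pi / L * Real.sqrt m)
    (2 * Real.pi / L * Real.sqrt N)
  have hγ : 0 ≤ γ := spectralPrecision_nonneg _ _
  have hlogG : Real.log G = γ / 2 * Real.log (N / m) := by rw [hG, Real.log_exp]
  have hG0 : 0 < G := hG ▸ Real.exp_pos _
  have hp0 : 0 < p := by rw [hp]; positivity
  have hlogp : Real.log p = Real.log (shellEnergy ρ u T₀ T₁ N) + 4 / 3 * Real.log N := by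
    rw [hp, Real.log_mul heN.ne' (by positivity), Real.log_rpow hN0]
  have hmono : γ / 2 * (Real.log N - Real.log n) ≤ γ / 2 * Real.log (N / m) := by
    rw [Real.log_div hN0.ne' (by linarith)]
    have := Real.log_le_log (by linarith) hmn
    gcongr
  have h2 := abs_le.1 (hle.trans hmono)
  rw [← hlogp, ← hlogG] at h2
  constructor
  · rw [← Real.log_le_log_iff (by positivity) he, Real.log_mul (by positivity) (by positivity),
      Real.log_mul (by positivity) hp0.ne', Real.log_inv, Real.log_rpow hn0]
    linarith [h2.2]
  · rw [← Real.log_le_log_iff he (by positivity), Real.log_mul (by positivity) (by positivity),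
      Real.log_mul (by positivity) hp0.ne', Real.log_rpow hn0]
    linarith [h2.1]

/-- The number of modes in a ball of radius `√m` is at most `27 m^{3/2}`. -/
theorem sum_shellEnergy_low_le (hu : MemLeraySpace u) (h₀ : 0 ≤ T₀) (h : T₀ < T₁) (hρ : 0 < ρ)
    {m : ℝ} (hm : 1 ≤ m) (s : Finset ℕ) (hs : ∀ n ∈ s, (n : ℝ) < m) :
    ∑ n ∈ s, shellEnergy ρ u T₀ T₁ n
      ≤ ρ / L ^ 3 * (27 * Real.sqrt m ^ 3 * timeAverage T₀ T₁ fun t => (∫ x, ‖u t x‖) ^ 2) := by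
  classical
  have hL : 0 < L := Fact.out
  set A := timeAverage T₀ T₁ fun t => (∫ x, ‖u t x‖) ^ 2
  have hA : 0 ≤ A := timeAverage_nonneg h fun _ => by positivity
  have hsm : 1 ≤ Real.sqrt m := Real.one_le_sqrt.2 hm
  set r : ℤ := ⌊Real.sqrt m⌋
  have hr : (r : ℝ) ≤ Real.sqrt m := Int.floor_le _
  have hr0 : 0 ≤ r := Int.floor_nonneg.2 (by positivity)
  set B : Finset (Fin 3 → ℤ) := Fintype.piFinset fun _ => Finset.Icc (-r) r with hB
  have hBcard : (B.card : ℝ) ≤ 27 * Real.sqrt m ^ 3 := by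
    rw [hB, Fintype.card_piFinset_const, Int.card_Icc]
    have : (((r + 1 - -r).toNat : ℕ) : ℝ) = 2 * r + 1 := by
      have h1 : (((r + 1 - -r).toNat : ℕ) : ℤ) = 2 * r + 1 := by omega
      exact_mod_cast h1
    push_cast [Fintype.card_fin]
    rw [this]
    have hr0' : (0 : ℝ) ≤ r := by exact_mod_cast hr0
    calc (2 * (r : ℝ) + 1) ^ 3 ≤ (3 * Real.sqrt m) ^ 3 := by gcongr; linarith
      _ = _ := by ring
  have hmem : ∀ n ∈ s, ∀ k, sqNat k = n → k ∈ B := by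
    intro n hn k hk
    rw [hB, Fintype.mem_piFinset]
    intro i
    have h1 : ((k i : ℤ) : ℝ) ^ 2 ≤ m := by
      have h2 := sq_le_sqNat k i
      rw [hk] at h2
      have h3 : ((k i : ℤ) : ℝ) ^ 2 ≤ n := by exact_mod_cast h2
      exact h3.trans (hs n hn).le
    have h2 : |((k i : ℤ) : ℝ)| ≤ Real.sqrt m := Real.abs_le_sqrt h1
    rw [Finset.mem_Icc, ← abs_le]
    exact Int.le_floor.2 (by push_cast; exact h2)
  have hshell : ∀ n ∈ s, ∑' k : {k : Fin 3 → ℤ // sqNat k = n}, modeAvg u T₀ T₁ k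
      = ∑ k ∈ B.filter fun k => sqNat k = n, modeAvg u T₀ T₁ k := by
    intro n hn
    rw [← Finset.tsum_subtype]
    let φ : {k : Fin 3 → ℤ // sqNat k = n} ≃ {k // k ∈ B.filter fun k => sqNat k = n} :=
      Equiv.subtypeEquivRight fun k => by
        rw [Finset.mem_filter]
        exact ⟨fun h => ⟨hmem n hn k h, h⟩, fun h => h.2⟩
    rw [← φ.tsum_eq]
    rfl
  simp only [shellEnergy]
  rw [← Finset.mul_sum]
  refine mul_le_mul_of_nonneg_left ?_ (by positivity)
  calc ∑ n ∈ s, ∑' k : {k : Fin 3 → ℤ // sqNat k = n}, modeAvg u T₀ T₁ k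
      = ∑ n ∈ s, ∑ k ∈ B.filter fun k => sqNat k = n, modeAvg u T₀ T₁ k :=
        Finset.sum_congr rfl hshell
    _ ≤ ∑ k ∈ B, modeAvg u T₀ T₁ k :=
        Finset.sum_fiberwise_le_sum_of_sum_fiber_nonneg fun n _ =>
          Finset.sum_nonneg fun k _ => modeAvg_nonneg h k
    _ ≤ ∑ k ∈ B, A := Finset.sum_le_sum fun k _ => hu.modeAvg_le h₀ h k
    _ = B.card * A := by simp
    _ ≤ _ := by gcongr

end Range

/-- The algebra behind the estimates: `s³` is the dissipation rate, `c³` the lowest frequency,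
`a³` and `b³` the ends of the window, `G` the deviation from the power law. -/
theorem spectral_algebra {ν α c s p G a b cE cB E D W₀ W₁ : ℝ} (hν : 0 < ν) (hα : 0 < α)
    (hc : 0 < c) (hs : 0 < s) (hp : 0 < p) (hG : 0 < G) (ha : 0 < a) (hb : 0 < b) (hcE : 0 < cE)
    (hcB : 0 < cB) (hαp : α * s ^ 2 = p * c ^ 2) (hsD : s ^ 3 = 2 * ν * D)
    (hD₁ : c ^ 6 * W₁ ≤ D) (hD₂ : D ≤ 3 * (c ^ 6 * W₁)) (hW₁ : p * cB * b ^ 2 ≤ G * W₁)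
    (hW₁' : W₁ ≤ G * p * (3 / 2 * b ^ 2)) (hW₀ : p * cE ≤ G * a * W₀) (hE : W₀ ≤ E)
    (hE' : E * a ≤ 8 * G * p) :
    cE ^ 2 * (2 * cB) * (b ^ 2 / a ^ 2 * α ^ 3 * ν * s ^ 3) ≤ G ^ 3 * E ^ 2 ∧
      E ^ 2 ≤ 864 * G ^ 3 * (b ^ 2 / a ^ 2 * α ^ 3 * ν * s ^ 3) ∧
      2 * cB * ν * α * c ^ 4 * b ^ 2 ≤ s * G := by
  -- `S1` and `S2` compare `ε̄ = s³` with the enstrophy of the window and trade `p` for `α` through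
  -- `hαp`. A factor `s²` cancels and an estimate of `s` alone remains.
  have S1 : 2 * cB * ν * α * c ^ 4 * b ^ 2 ≤ s * G := by
    have h1 : 2 * cB * ν * α * c ^ 4 * b ^ 2 * s ^ 2 ≤ s * G * s ^ 2 := by
      calc 2 * cB * ν * α * c ^ 4 * b ^ 2 * s ^ 2
          = 2 * ν * c ^ 6 * (p * cB * b ^ 2) := by
            linear_combination 2 * cB * ν * c ^ 4 * b ^ 2 * hαp
        _ ≤ 2 * ν * c ^ 6 * (G * W₁) := by gcongr
        _ = 2 * ν * G * (c ^ 6 * W₁) := by ring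
        _ ≤ 2 * ν * G * D := by gcongr
        _ = s * G * s ^ 2 := by linear_combination -G * hsD
    exact le_of_mul_le_mul_right h1 (by positivity)
  have S2 : s ≤ 9 * G * ν * α * c ^ 4 * b ^ 2 := by
    have h1 : s * s ^ 2 ≤ 9 * G * ν * α * c ^ 4 * b ^ 2 * s ^ 2 := by
      calc s * s ^ 2 = 2 * ν * D := by linear_combination hsD
        _ ≤ 2 * ν * (3 * (c ^ 6 * W₁)) := by gcongr
        _ ≤ 2 * ν * (3 * (c ^ 6 * (G * p * (3 / 2 * b ^ 2)))) := by gcongr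
        _ = 9 * G * ν * α * c ^ 4 * b ^ 2 * s ^ 2 := by
            linear_combination -9 * G * ν * c ^ 4 * b ^ 2 * hαp
    exact le_of_mul_le_mul_right h1 (by positivity)
  refine ⟨?_, ?_, S1⟩
  · have h1 : α * s ^ 2 * cE ≤ E * G * a * c ^ 2 := by
      calc α * s ^ 2 * cE = p * cE * c ^ 2 := by rw [hαp]; ring
        _ ≤ G * a * W₀ * c ^ 2 := by gcongr
        _ ≤ G * a * E * c ^ 2 := by gcongr
        _ = _ := by ring
    have h2 : (α * s ^ 2 * cE) ^ 2 ≤ (E * G * a * c ^ 2) ^ 2 := by gcongr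
    have h3 : cE ^ 2 * (2 * cB) * (b ^ 2 * α ^ 3 * ν * s ^ 3) * c ^ 4
        ≤ G ^ 3 * E ^ 2 * a ^ 2 * c ^ 4 := by
      calc cE ^ 2 * (2 * cB) * (b ^ 2 * α ^ 3 * ν * s ^ 3) * c ^ 4
          = α ^ 2 * s ^ 3 * cE ^ 2 * (2 * cB * ν * α * c ^ 4 * b ^ 2) := by ring
        _ ≤ α ^ 2 * s ^ 3 * cE ^ 2 * (s * G) := by gcongr
        _ = G * (α * s ^ 2 * cE) ^ 2 := by ring
        _ ≤ G * (E * G * a * c ^ 2) ^ 2 := by gcongr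
        _ = _ := by ring
    have h4 := le_of_mul_le_mul_right h3 (by positivity)
    rw [show cE ^ 2 * (2 * cB) * (b ^ 2 / a ^ 2 * α ^ 3 * ν * s ^ 3)
      = cE ^ 2 * (2 * cB) * (b ^ 2 * α ^ 3 * ν * s ^ 3) / a ^ 2 by ring, div_le_iff₀ (by positivity)]
    exact h4
  · have hE0 : 0 ≤ E := by
      have : 0 < G * a * W₀ := lt_of_lt_of_le (by positivity) hW₀
      have : 0 < W₀ := pos_of_mul_pos_right this (by positivity)
      linarith
    have h1 : E * a * c ^ 2 ≤ 8 * G * (α * s ^ 2) := by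
      rw [hαp, ← mul_assoc]; gcongr
    have h2 : (E * a * c ^ 2) ^ 2 ≤ (8 * G * (α * s ^ 2)) ^ 2 := by gcongr
    have h3 : E ^ 2 * a ^ 2 * c ^ 4 ≤ 864 * G ^ 3 * (b ^ 2 * α ^ 3 * ν * s ^ 3) * c ^ 4 := by
      calc E ^ 2 * a ^ 2 * c ^ 4 = (E * a * c ^ 2) ^ 2 := by ring
        _ ≤ (8 * G * (α * s ^ 2)) ^ 2 := h2
        _ = 64 * G ^ 2 * α ^ 2 * s ^ 3 * s := by ring
        _ ≤ 64 * G ^ 2 * α ^ 2 * s ^ 3 * (9 * G * ν * α * c ^ 4 * b ^ 2) := by gcongr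
        _ = 576 * (G ^ 3 * (b ^ 2 * α ^ 3 * ν * s ^ 3) * c ^ 4) := by ring
        _ ≤ 864 * (G ^ 3 * (b ^ 2 * α ^ 3 * ν * s ^ 3) * c ^ 4) := by
            gcongr; norm_num
        _ = _ := by ring
    have h4 := le_of_mul_le_mul_right h3 (by positivity)
    rw [show 864 * G ^ 3 * (b ^ 2 / a ^ 2 * α ^ 3 * ν * s ^ 3)
      = 864 * G ^ 3 * (b ^ 2 * α ^ 3 * ν * s ^ 3) / a ^ 2 by ring, le_div_iff₀ (by positivity)]
    exact h4

/-! ### Estimates for the whole spectrum -/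

section Range

variable {ρ : ℝ} {u : ℝ → Torus L → E3} {T₀ T₁ C Kminus Kplus : ℝ}

theorem IsInertialRange.unitFreq_le (hr : IsInertialRange ρ u T₀ T₁ C Kminus Kplus) :
    2 * Real.pi / L ≤ Kminus := by
  rcases lt_or_ge (meanVolume u T₀ T₁ / torusVolume L) (1 / (2 * Real.pi) ^ 3) with h | h
  · exact (hr.lower_of_small h).1
  · exact (hr.lower_of_large h).ge

theorem sqrt_nMinus (hK : 0 < Kminus) : Real.sqrt (nMinus L Kminus) = L * Kminus / (2 * Real.pi) := by
  have hL : 0 < L := Fact.out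
  rw [nMinus, Real.sqrt_sq (by positivity)]

theorem freq_sqrt_nMinus (hK : 0 < Kminus) :
    2 * Real.pi / L * Real.sqrt (nMinus L Kminus) = Kminus := by
  have hL : 0 < L := Fact.out
  rw [sqrt_nMinus hK]
  field_simp [Real.pi_ne_zero]

theorem IsInertialRange.one_le_nMinus (hr : IsInertialRange ρ u T₀ T₁ C Kminus Kplus) :
    1 ≤ nMinus L Kminus := by
  have hL : 0 < L := Fact.out
  have h := hr.unitFreq_le
  rw [div_le_iff₀ hL] at h
  refine one_le_pow₀ ?_
  rw [one_le_div (by positivity)]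
  linarith

/-- Frequencies below the inertial range carry at most an eighth of the mean energy. -/
theorem IsInertialRange.low_energy_le (hr : IsInertialRange ρ u T₀ T₁ C Kminus Kplus)
    (hu : MemLeraySpace u) (h0 : modeAvg u T₀ T₁ 0 = 0) (h₀ : 0 ≤ T₀) (h : T₀ < T₁) (hρ : 0 < ρ)
    (s : Finset ℕ) (hs : ∀ n ∈ s, (n : ℝ) < nMinus L Kminus) :
    ∑ n ∈ s, shellEnergy ρ u T₀ T₁ n ≤ 1 / 8 * meanEnergy ρ u T₀ T₁ := by
  have hL : 0 < L := Fact.out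
  have hK : 0 < Kminus := unitFreq_pos.trans_le hr.unitFreq_le
  have hE : 0 ≤ meanEnergy ρ u T₀ T₁ :=
    timeAverage_nonneg h fun t => mul_nonneg hρ.le (normSq_nonneg _)
  rcases lt_or_ge (meanVolume u T₀ T₁ / torusVolume L) (1 / (2 * Real.pi) ^ 3) with hV | hV
  · refine (sum_shellEnergy_low_le hu h₀ h hρ hr.one_le_nMinus s hs).trans ?_
    have hle := (hr.lower_of_small hV).2
    set A := timeAverage T₀ T₁ fun t => (∫ x, ‖u t x‖) ^ 2 with hA
    set B := timeAverage T₀ T₁ fun t => normSq (u t) with hB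
    have hA0 : 0 ≤ A := timeAverage_nonneg h fun _ => by positivity
    have hB0 : 0 ≤ B := timeAverage_nonneg h fun _ => normSq_nonneg _
    have hmv : meanVolume u T₀ T₁ = A / B := rfl
    -- A zero volume is excluded because `0 ^ (-1/3)` is `0` by convention, against `0 < Kminus`.
    have hV0 : 0 < meanVolume u T₀ T₁ := by
      refine lt_of_le_of_ne (hmv ▸ div_nonneg hA0 hB0) fun h' => ?_
      rw [← h', Real.zero_rpow (by norm_num)] at hle
      linarith
    obtain ⟨w, -, hw, w1, w2, -, -⟩ := exists_cbrt hV0.le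
    have hw := hw hV0
    rw [w2] at hle
    have hKw : Kminus * w ≤ 1 := by
      calc Kminus * w ≤ w⁻¹ * w := by gcongr
        _ = 1 := inv_mul_cancel₀ hw.ne'
    have hBne : B ≠ 0 := by
      intro hB'
      rw [hmv, hB', div_zero] at hV0
      exact lt_irrefl _ hV0
    have hAB : A = w ^ 3 * B := by
      rw [← w1, hmv]; field_simp
    have hEB : meanEnergy ρ u T₀ T₁ = ρ * B := by rw [meanEnergy, timeAverage_const_mul]
    rw [sqrt_nMinus hK, hAB, hEB]
    have hpi : (27 : ℝ) ≤ Real.pi ^ 3 := by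
      have := Real.pi_gt_three.le
      calc (27 : ℝ) = 3 ^ 3 := by norm_num
        _ ≤ _ := by gcongr
    have e : ρ / L ^ 3 * (27 * (L * Kminus / (2 * Real.pi)) ^ 3 * (w ^ 3 * B))
        = 27 / (8 * Real.pi ^ 3) * ((Kminus * w) ^ 3 * (ρ * B)) := by
      field_simp [Real.pi_ne_zero]
      norm_num
    rw [e]
    have h1 : (Kminus * w) ^ 3 ≤ 1 := pow_le_one₀ (by positivity) hKw
    have h2 : 27 / (8 * Real.pi ^ 3) ≤ 1 / 8 := by
      rw [div_le_div_iff₀ (by positivity) (by norm_num)]; linarith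
    calc 27 / (8 * Real.pi ^ 3) * ((Kminus * w) ^ 3 * (ρ * B))
        ≤ 1 / 8 * (1 * (ρ * B)) := by gcongr
      _ = _ := by ring
  -- Here the range starts at the first nonzero frequency, so only the shell 0 is below it.
  · have hm : nMinus L Kminus = 1 := by
      rw [nMinus, hr.lower_of_large hV]
      field_simp [Real.pi_ne_zero]
    refine le_trans (le_of_eq (Finset.sum_eq_zero fun n hn => ?_)) (by positivity)
    have h1 := hs n hn
    rw [hm] at h1
    have : n = 0 := by
      have : n < 1 := by exact_mod_cast h1
      omega
    rw [this, shellEnergy_zero, h0, mul_zero]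

/-- The energy is bounded by its low, window and tail parts. -/
theorem MemLeraySpace.meanEnergy_le (hu : MemLeraySpace u) (h₀ : 0 ≤ T₀) (h : T₀ < T₁)
    (hρ : 0 < ρ) {m : ℝ} {N : ℕ} (hN : 0 < N) :
    meanEnergy ρ u T₀ T₁ ≤ ∑ n ∈ (Finset.range N).filter (fun n : ℕ => (n : ℝ) < m),
        shellEnergy ρ u T₀ T₁ n + ∑ n ∈ threeSqWindow m N, shellEnergy ρ u T₀ T₁ n
      + (ρ * timeAverage T₀ T₁ (fun t => gradSq (u t)) - (2 * Real.pi / L) ^ 2 *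
        ∑ n ∈ threeSqWindow m N, n * shellEnergy ρ u T₀ T₁ n) / ((2 * Real.pi / L) ^ 2 * N) := by
  classical
  have hκ := unitFreq_pos (L := L)
  set κ := 2 * Real.pi / L
  set e := shellEnergy ρ u T₀ T₁
  have he : ∀ n, 0 ≤ e n := shellEnergy_nonneg hρ h
  have hN0 : (0 : ℝ) < N := by exact_mod_cast hN
  have hE : HasSum e (meanEnergy ρ u T₀ T₁) := hu.hasSum_shellEnergy h₀ h
  have hD : HasSum (fun n : ℕ => κ ^ 2 * n * e n) (ρ * timeAverage T₀ T₁ fun t => gradSq (u t)) :=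
    hu.hasSum_shellEnergy_grad h₀ h
  have hfin : ∀ (s : Finset ℕ) (f : ℕ → ℝ),
      HasSum (fun n => if n ∈ s then f n else 0) (∑ n ∈ s, f n) := by
    intro s f
    have h1 : ∑ n ∈ s, f n = ∑ n ∈ s, (if n ∈ s then f n else 0) :=
      Finset.sum_congr rfl fun n hn => by rw [if_pos hn]
    rw [h1]
    exact hasSum_sum_of_ne_finset_zero fun n hn => if_neg hn
  rw [Finset.mul_sum]
  refine hasSum_le (fun n => ?_) hE (((hfin ((Finset.range N).filter (fun n : ℕ => (n : ℝ) < m)) e).add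
    (hfin (threeSqWindow m N) e)).add
    ((hD.sub (hfin (threeSqWindow m N) fun n => κ ^ 2 * (n * e n))).div_const (κ ^ 2 * N)))
  have hen := he n
  by_cases hW : n ∈ threeSqWindow m N
  · simp only [if_pos hW]
    have : 0 ≤ if n ∈ (Finset.range N).filter (fun n : ℕ => (n : ℝ) < m) then e n else 0 := by
      split_ifs <;> linarith
    have h0 : (κ ^ 2 * n * e n - κ ^ 2 * (n * e n)) / (κ ^ 2 * N) = 0 := by
      rw [mul_assoc, sub_self, zero_div]
    linarith
  · simp only [if_neg hW, add_zero, sub_zero]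
    have hq : 0 ≤ κ ^ 2 * n * e n / (κ ^ 2 * N) := by positivity
    by_cases hlow : n ∈ (Finset.range N).filter (fun n : ℕ => (n : ℝ) < m)
    · rw [if_pos hlow]; linarith
    · rw [if_neg hlow, zero_add]
      by_cases hS : IsSumThreeSq n
      · have hNn : N ≤ n := by
          by_contra! hlt
          rcases lt_or_ge (n : ℝ) m with h1 | h1
          · exact hlow (Finset.mem_filter.2 ⟨Finset.mem_range.2 hlt, h1⟩)
          · exact hW (mem_threeSqWindow.2 ⟨hlt.le, h1, hS⟩)
        -- In the tail `e n ≤ (n/N) e n`, so energy is paid for by dissipation.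
        have hNn' : (N : ℝ) ≤ n := by exact_mod_cast hNn
        rw [le_div_iff₀ (by positivity)]
        calc e n * (κ ^ 2 * N) ≤ e n * (κ ^ 2 * n) := by gcongr
          _ = _ := by ring
      · have : e n = 0 := shellEnergy_of_not hS
        rw [this]; simp

end Range

theorem rpow_four_thirds_of_cbrt {t b : ℝ} (ht : 0 ≤ t) (h : t ^ (-(4 / 3) : ℝ) = (b ^ 4)⁻¹) :
    t ^ (4 / 3 : ℝ) = b ^ 4 := by
  rw [Real.rpow_neg ht] at h
  exact inv_injective h

theorem rpow_neg_five_thirds_freq {κ c t b : ℝ} (hc : 0 < c) (hκ : κ = c ^ 3) (ht : 0 < t)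
    (hb : t ^ (-(1 / 3) : ℝ) = b⁻¹) :
    (κ * Real.sqrt t) ^ (-(5 / 3) : ℝ) = (c ^ 5 * b * Real.sqrt t)⁻¹ := by
  have hκ0 : 0 < κ := by rw [hκ]; positivity
  have hs : 0 < Real.sqrt t := Real.sqrt_pos.2 ht
  have h1 : κ ^ (5 / 3 : ℝ) = c ^ 5 := by
    rw [hκ, ← Real.rpow_natCast, ← Real.rpow_mul hc.le, ← Real.rpow_natCast]
    norm_num
  have h2 : Real.sqrt t ^ (5 / 3 : ℝ) = b * Real.sqrt t := by
    have hb' : t ^ (1 / 3 : ℝ) = b := by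
      rw [Real.rpow_neg ht.le] at hb
      exact inv_injective hb
    rw [← hb', Real.sqrt_eq_rpow, ← Real.rpow_mul ht.le, ← Real.rpow_add ht]
    norm_num
  rw [Real.rpow_neg (by positivity), Real.mul_rpow hκ0.le hs.le, h1, h2, mul_assoc]

theorem reynolds_eq {κ m t a b : ℝ} (hκ : 0 < κ) (hm : 0 < m) (ht : 0 < t)
    (ha : m ^ (2 / 3 : ℝ) = a ^ 2) (hb : t ^ (2 / 3 : ℝ) = b ^ 2) :
    reynolds (κ * Real.sqrt m) (κ * Real.sqrt t) = b ^ 2 / a ^ 2 ∧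
      Real.log (t / m) = 3 / 2 * Real.log (reynolds (κ * Real.sqrt m) (κ * Real.sqrt t)) := by
  have h1 : reynolds (κ * Real.sqrt m) (κ * Real.sqrt t) = (t / m) ^ (2 / 3 : ℝ) := by
    rw [reynolds, mul_div_mul_left _ _ hκ.ne', ← Real.sqrt_div ht.le, Real.sqrt_eq_rpow,
      ← Real.rpow_mul (by positivity)]
    norm_num
  constructor
  · rw [h1, Real.div_rpow ht.le hm.le, ha, hb]
  · rw [h1, Real.log_rpow (by positivity)]; ring

set_option maxHeartbeats 1000000 in
/-- The spectral estimates for an inertial range. -/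
theorem IsInertialRange.estimates {ρ ν : ℝ} {u : ℝ → Torus L → E3} {T₀ T₁ C Kminus Kplus : ℝ}
    (hr : IsInertialRange ρ u T₀ T₁ C Kminus Kplus) (hu : MemLeraySpace u)
    (h0 : modeAvg u T₀ T₁ 0 = 0) (h₀ : 0 ≤ T₀) (h : T₀ < T₁) (hρ : 0 < ρ) (hν : 0 < ν)
    (hC₁ : 1 < C) (hC : C < 2)
    {Re γ α ε E G : ℝ} (hRe : Re = reynolds Kminus Kplus)
    (hγ : γ = spectralPrecision ρ u T₀ T₁ Kminus Kplus)
    (hα : α = kolmogorovConstant ρ ν u T₀ T₁ Kplus) (hε : ε = meanDissipation ρ ν u T₀ T₁)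
    (hE : E = meanEnergy ρ u T₀ T₁) (hG : G = Real.exp (3 / 4 * γ * Real.log Re)) :
    1 < Re ∧ 0 < α ∧ 0 < ε ∧ 0 < E ∧
      energyConst Re ^ 2 * (2 * enstrophyConst Re) * (Re * α ^ 3 * ν * ε) ≤ G ^ 3 * E ^ 2 ∧
      E ^ 2 ≤ 864 * G ^ 3 * (Re * α ^ 3 * ν * ε) ∧
      (2 * enstrophyConst Re) ^ 3 * (16 * Real.pi ^ 4) * Re ^ 3 * (α ^ 3 * ν ^ 3)
        ≤ G ^ 3 * L ^ 4 * ε := by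
  have hL : 0 < L := Fact.out
  have hκ := unitFreq_pos (L := L)
  have hK : 0 < Kminus := hκ.trans_le hr.unitFreq_le
  have hm := hr.one_le_nMinus
  have hKm := freq_sqrt_nMinus (L := L) hK
  have hlow := hr.low_energy_le hu h0 h₀ h hρ
  set m := nMinus L Kminus
  obtain ⟨N, hS, hN⟩ := mem_stokesSpectrum.1 hr.mem
  have hm0 : 0 < m := by linarith
  have hmN : m < N := by
    have := hr.lt
    rw [← hKm, ← hN] at this
    rwa [← not_le, freq_le_iff hm0.le, not_le] at this
  have hN0 : (0 : ℝ) < N := by linarith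
  have hNpos : 0 < N := by exact_mod_cast hN0
  have hle := hr.enstrophy_le
  have hpos := hr.spectrum_pos
  have hNmem := hr.mem
  clear hr
  subst hN
  rw [← hKm] at hle hpos hRe hγ
  clear_value m
  -- positivity in the window
  set e := shellEnergy ρ u T₀ T₁ with he_def
  have he : ∀ n, 0 ≤ e n := shellEnergy_nonneg hρ h
  have hepos : ∀ n ∈ threeSqWindow m N, 0 < e n := by
    intro n hn
    obtain ⟨h1, h2, h3⟩ := mem_threeSqWindow.1 hn
    have hn0 : (0 : ℝ) < n := by linarith
    have := hpos _ (mem_stokesSpectrum.2 ⟨n, h3, rfl⟩) ((freq_le_iff hn0.le).2 h2)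
      ((freq_le_iff hN0.le).2 (by exact_mod_cast h1))
    rw [hu.meanSpectrum_eq h₀ h] at this
    exact pos_of_mul_pos_right this (by positivity)
  have hNW : N ∈ threeSqWindow m N := mem_threeSqWindow.2 ⟨le_rfl, hmN.le, hS⟩
  have heN := hepos N hNW
  -- cube roots
  obtain ⟨a, -, ha, a1, a2, -, a4⟩ := exists_cbrt hm0.le
  obtain ⟨b, -, hb, b1, b2, b3, b4⟩ := exists_cbrt hN0.le
  obtain ⟨c, -, hc, c1, -, -, -⟩ := exists_cbrt hκ.le
  have ha := ha hm0
  have hb := hb hN0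
  have hc := hc hκ
  have hab : a < b := lt_of_pow_lt_pow_left₀ 3 hb.le (by linarith)
  obtain ⟨hRe', hlog⟩ := reynolds_eq hκ hm0 hN0 a4 b4
  rw [← hRe] at hRe' hlog
  have hRe1 : 1 < Re := by
    rw [hRe', one_lt_div (by positivity)]
    gcongr
  -- power law in the window
  set p := e N * b ^ 4 with hp
  have hp0 : 0 < p := by positivity
  have hG0 : 0 < G := hG ▸ Real.exp_pos _
  have hbounds : ∀ n ∈ threeSqWindow m N, G⁻¹ * p * (n : ℝ) ^ (-(4 / 3) : ℝ) ≤ e n ∧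
      e n ≤ G * p * (n : ℝ) ^ (-(4 / 3) : ℝ) := by
    intro n hn
    refine hu.shellEnergy_bounds h₀ h hm hS hmN hepos ?_ ?_ hn
    · rw [hG, ← hγ, hlog]
      congr 1
      ring
    · rw [rpow_four_thirds_of_cbrt hN0.le b3]
  have hGinv : G * (G⁻¹ * p) = p := by field_simp
  obtain ⟨w0, w1⟩ := window_bounds (x := Re) hm hmN hS (by
    rw [a4, b4, hRe']; field_simp)
  rw [a2] at w0
  rw [b4] at w1
  have w0' := sum_window_rpow_neg_four_thirds_le hm N
  have w1' := sum_window_rpow_neg_one_third_le hm N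
  rw [a2] at w0'
  rw [b4] at w1'
  set W₀ := ∑ n ∈ threeSqWindow m N, e n with hW₀
  set W₁ := ∑ n ∈ threeSqWindow m N, n * e n with hW₁
  have hmulpow : ∀ n ∈ threeSqWindow m N,
      (n : ℝ) * (n : ℝ) ^ (-(4 / 3) : ℝ) = (n : ℝ) ^ (-(1 / 3) : ℝ) := by
    intro n hn
    have hn0 : (0 : ℝ) < n := by linarith [(mem_threeSqWindow.1 hn).2.1]
    nth_rewrite 1 [← Real.rpow_one (n : ℝ)]
    rw [← Real.rpow_add hn0]
    norm_num
  have hW₀l : p * energyConst Re ≤ G * a * W₀ := by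
    have h1 : G⁻¹ * p * ∑ n ∈ threeSqWindow m N, (n : ℝ) ^ (-(4 / 3) : ℝ) ≤ W₀ := by
      rw [Finset.mul_sum]
      exact Finset.sum_le_sum fun n hn => (hbounds n hn).1
    calc p * energyConst Re = G * a * (G⁻¹ * p * (energyConst Re * a⁻¹)) := by field_simp
      _ ≤ G * a * (G⁻¹ * p * ∑ n ∈ threeSqWindow m N, (n : ℝ) ^ (-(4 / 3) : ℝ)) := by gcongr
      _ ≤ _ := by gcongr
  have hW₀u : W₀ ≤ G * p * (4 * a⁻¹) := by
    calc W₀ ≤ ∑ n ∈ threeSqWindow m N, G * p * (n : ℝ) ^ (-(4 / 3) : ℝ) :=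
          Finset.sum_le_sum fun n hn => (hbounds n hn).2
      _ = G * p * ∑ n ∈ threeSqWindow m N, (n : ℝ) ^ (-(4 / 3) : ℝ) := by rw [Finset.mul_sum]
      _ ≤ _ := by gcongr
  have hW₁l : p * enstrophyConst Re * b ^ 2 ≤ G * W₁ := by
    calc p * enstrophyConst Re * b ^ 2 = G * (G⁻¹ * p * (enstrophyConst Re * b ^ 2)) := by
          rw [← mul_assoc G, hGinv]; ring
      _ ≤ G * (G⁻¹ * p * ∑ n ∈ threeSqWindow m N, (n : ℝ) ^ (-(1 / 3) : ℝ)) := by gcongr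
      _ ≤ G * W₁ := by
          refine mul_le_mul_of_nonneg_left ?_ hG0.le
          rw [Finset.mul_sum]
          refine Finset.sum_le_sum fun n hn => ?_
          rw [← hmulpow n hn]
          calc G⁻¹ * p * ((n : ℝ) * (n : ℝ) ^ (-(4 / 3) : ℝ))
              = n * (G⁻¹ * p * (n : ℝ) ^ (-(4 / 3) : ℝ)) := by ring
            _ ≤ n * e n := by gcongr; exact (hbounds n hn).1
  have hW₁u : W₁ ≤ G * p * (3 / 2 * b ^ 2) := by
    calc W₁ ≤ ∑ n ∈ threeSqWindow m N, G * p * (n : ℝ) ^ (-(1 / 3) : ℝ) := by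
          refine Finset.sum_le_sum fun n hn => ?_
          rw [← hmulpow n hn]
          calc n * e n ≤ n * (G * p * (n : ℝ) ^ (-(4 / 3) : ℝ)) := by
                gcongr; exact (hbounds n hn).2
            _ = _ := by ring
      _ = G * p * ∑ n ∈ threeSqWindow m N, (n : ℝ) ^ (-(1 / 3) : ℝ) := by rw [Finset.mul_sum]
      _ ≤ _ := by gcongr
  -- total dissipation and total energy
  have hEsum : HasSum e (meanEnergy ρ u T₀ T₁) := hu.hasSum_shellEnergy h₀ h
  have hEW : W₀ ≤ E := by
    rw [hE]
    exact sum_le_hasSum _ (fun n _ => he n) hEsum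
  have hEpos : 0 < E := by
    refine lt_of_lt_of_le heN (le_trans ?_ hEW)
    exact Finset.single_le_sum (f := e) (fun n _ => he n) hNW
  have hDsum := hu.hasSum_shellEnergy_grad (ρ := ρ) h₀ h
  have hElow := hu.meanEnergy_le h₀ h hρ (m := m) hNpos
  rw [hu.meanEnstrophy_spectrum h₀ h hρ, hu.meanEnstrophy_Icc h₀ h hρ hm0.le,
    ← ENNReal.ofReal_mul (by linarith)] at hle
  have hεD : ε = 2 * ν * (ρ * timeAverage T₀ T₁ fun t => gradSq (u t)) := by
    rw [hε, meanDissipation, timeAverage_const_mul]; ring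
  set D := ρ * timeAverage T₀ T₁ fun t => gradSq (u t)
  have hc6 : (2 * Real.pi / L) ^ 2 = c ^ 6 := by rw [c1]; ring
  rw [hc6] at hDsum hElow hle
  have hW₁pos : 0 < W₁ := by
    have : 0 < p * enstrophyConst Re * b ^ 2 := by
      have := enstrophyConst_pos hRe1
      positivity
    exact pos_of_mul_pos_right (this.trans_le hW₁l) hG0.le
  have hD₁ : c ^ 6 * W₁ ≤ D := by
    rw [hW₁, Finset.mul_sum]
    refine le_trans (le_of_eq (Finset.sum_congr rfl fun n _ => ?_))
      (sum_le_hasSum (threeSqWindow m N) (fun n _ => ?_) hDsum)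
    · ring
    · have := he n
      positivity
  have hD₂ : D ≤ 3 * (c ^ 6 * W₁) := by
    rw [ENNReal.ofReal_le_ofReal_iff (by positivity)] at hle
    refine hle.trans ?_
    exact mul_le_mul_of_nonneg_right (by linarith) (by positivity)
  have hDpos : 0 < D := lt_of_lt_of_le (by positivity) hD₁
  have hεpos : 0 < ε := by rw [hεD]; positivity
  -- The three parts give `E ≤ E/8 + 4Gp/a + 3Gp/a`, hence the constant 8.
  have hEu : E * a ≤ 8 * G * p := by
    have hl := hlow ((Finset.range N).filter fun n : ℕ => (n : ℝ) < m) fun n hn =>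
      (Finset.mem_filter.1 hn).2
    rw [← hE] at hl hElow
    have htail : (D - c ^ 6 * W₁) / (c ^ 6 * N) ≤ 3 * (G * p * a⁻¹) := by
      rw [div_le_iff₀ (by positivity), b1]
      calc D - c ^ 6 * W₁ ≤ 2 * (c ^ 6 * W₁) := by linarith
        _ ≤ 2 * (c ^ 6 * (G * p * (3 / 2 * b ^ 2))) := by gcongr
        _ = 3 * (G * p * 1) * (c ^ 6 * b ^ 2) := by ring
        _ ≤ 3 * (G * p * (a⁻¹ * b)) * (c ^ 6 * b ^ 2) := by
            gcongr
            rw [inv_mul_eq_div, one_le_div ha]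
            exact hab.le
        _ = _ := by ring
    have h7 : E ≤ 8 * G * p * a⁻¹ := by linarith
    calc E * a ≤ 8 * G * p * a⁻¹ * a := by gcongr
      _ = _ := by field_simp
  -- the Kolmogorov constant
  obtain ⟨s, -, hs, s1, -, -, s4⟩ := exists_cbrt hεpos.le
  have hs := hs hεpos
  -- With `ε̄ = s³` and `κ = c³`, the powers of `N` in `Ē†(K₊) K₊^(5/3)` combine to `N^(4/3)`, which
  -- is the one in `p`.
  have hα' : α * s ^ 2 = p * c ^ 2 := by
    have hsq : Real.sqrt N ^ 2 = b ^ 3 := by rw [Real.sq_sqrt hN0.le, b1]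
    have hsq0 : Real.sqrt N ≠ 0 := (Real.sqrt_pos.2 hN0).ne'
    rw [hα, kolmogorovConstant, ← hε, s4, rpow_neg_five_thirds_freq hc c1 hN0 b2,
      hu.meanSpectrum_eq h₀ h, c1, hp]
    field_simp
    rw [hsq]
  have hα0 : 0 < α := by
    have : 0 < α * s ^ 2 := by rw [hα']; positivity
    exact pos_of_mul_pos_left this (by positivity)
  obtain ⟨r1, r2, r3⟩ := spectral_algebra hν hα0 hc hs hp0 hG0 ha hb (energyConst_pos hRe1)
    (enstrophyConst_pos hRe1) hα' (by rw [← s1, hεD]) hD₁ hD₂ hW₁l hW₁u hW₀l hEW hEu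
  rw [← s1, ← hRe'] at r1 r2
  refine ⟨hRe1, hα0, hεpos, hEpos, r1, r2, ?_⟩
  have hcB := enstrophyConst_pos hRe1
  have ha1 : 1 ≤ a := by
    by_contra! hlt
    have : a ^ 3 < 1 := pow_lt_one₀ ha.le hlt (by norm_num)
    linarith
  -- Since `m ≥ 1`, the Reynolds number is at most `N^(2/3)`. This replaces the window by `Re` and
  -- `L` in the last estimate.
  have hb2 : Re ≤ b ^ 2 := by
    rw [hRe']
    exact div_le_self (by positivity) (one_le_pow₀ ha1)
  have hcL : c ^ 12 * L ^ 4 = 16 * Real.pi ^ 4 := by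
    rw [show c ^ 12 = (c ^ 3) ^ 4 by ring, ← c1]
    field_simp
    norm_num
  have hcube : (2 * enstrophyConst Re * ν * α * c ^ 4 * b ^ 2) ^ 3 ≤ (s * G) ^ 3 := by gcongr
  calc (2 * enstrophyConst Re) ^ 3 * (16 * Real.pi ^ 4) * Re ^ 3 * (α ^ 3 * ν ^ 3)
      ≤ (2 * enstrophyConst Re) ^ 3 * (16 * Real.pi ^ 4) * (b ^ 2) ^ 3 * (α ^ 3 * ν ^ 3) := by
        gcongr
    _ = (2 * enstrophyConst Re * ν * α * c ^ 4 * b ^ 2) ^ 3 * L ^ 4 := by rw [← hcL]; ring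
    _ ≤ (s * G) ^ 3 * L ^ 4 := by gcongr
    _ = G ^ 3 * L ^ 4 * ε := by rw [s1]; ring

/-! ### Consequences of the energy inequality -/

section Energy

variable {ν : ℝ} {u₀ : Torus L → E3} {u : ℝ → Torus L → E3} {T₀ T₁ : ℝ}

theorem gradSq_nonneg (v : Torus L → E3) : 0 ≤ gradSq v :=
  Finset.sum_nonneg fun _ _ => Finset.sum_nonneg fun _ _ => integral_nonneg fun _ => sq_nonneg _

theorem IsLeraySolution.meanEnergy_le (hl : IsLeraySolution ν u₀ u) (hν : 0 < ν) {ρ : ℝ}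
    (hρ : 0 < ρ) (h₀ : 0 ≤ T₀) (h : T₀ < T₁) : meanEnergy ρ u T₀ T₁ ≤ ρ * normSq u₀ := by
  have hint := hl.leraySpace.integrable_normSq (T₁ := T₁) h₀
  rw [meanEnergy, timeAverage_const_mul]
  refine mul_le_mul_of_nonneg_left ?_ hρ.le
  have h1 : timeAverage T₀ T₁ (fun t => normSq (u t)) ≤ timeAverage T₀ T₁ fun _ => normSq u₀ := by
    refine timeAverage_mono h hint (integrable_const _) ?_
    have hpos : ∀ᵐ t ∂(volume.restrict (Ioi (0 : ℝ))), 0 < t :=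
      ae_restrict_mem measurableSet_Ioi
    filter_upwards [ae_restrict_Ioc h₀ hl.energy_initial, ae_restrict_Ioc h₀ hpos] with t ht h0
    have : 0 ≤ ∫ τ in (0 : ℝ)..t, gradSq (u τ) :=
      intervalIntegral.integral_nonneg h0.le fun _ _ => gradSq_nonneg _
    have : 0 ≤ 2 * ν * ∫ τ in (0 : ℝ)..t, gradSq (u τ) := by positivity
    linarith
  refine h1.trans (le_of_eq ?_)
  have : T₁ - T₀ ≠ 0 := (sub_pos.2 h).ne'
  rw [timeAverage, intervalIntegral.integral_const, smul_eq_mul]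
  field_simp

/-- The inequality from time 0 holds only at almost every time, so it is taken at some `t > T₁`; the
integrand is nonnegative. -/
theorem IsLeraySolution.dissipation_le (hl : IsLeraySolution ν u₀ u) (hν : 0 < ν)
    (h₀ : 0 ≤ T₀) (h : T₀ < T₁) : 2 * ν * ∫ t in T₀..T₁, gradSq (u t) ≤ normSq u₀ := by
  have hae : ∀ᵐ t ∂(volume.restrict (Ioi T₁)),
      normSq (u t) + 2 * ν * ∫ τ in (0 : ℝ)..t, gradSq (u τ) ≤ normSq u₀ :=
    ae_mono (Measure.restrict_mono (Ioi_subset_Ioi (h₀.trans h.le)) le_rfl) hl.energy_initial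
  have hne : (volume.restrict (Ioi T₁)) ≠ 0 := by
    rw [Ne, Measure.restrict_eq_zero]
    simp
  have : NeZero (volume.restrict (Ioi T₁)) := ⟨hne⟩
  obtain ⟨t, ht, htT⟩ := (hae.and (ae_restrict_mem measurableSet_Ioi)).exists
  have hmono : ∫ τ in T₀..T₁, gradSq (u τ) ≤ ∫ τ in (0 : ℝ)..t, gradSq (u τ) := by
    have htT' : T₁ < t := htT
    rw [intervalIntegral.integral_of_le h.le, intervalIntegral.integral_of_le (by linarith)]
    refine setIntegral_mono_set (hl.leraySpace.grad_integrable.mono_set fun x hx => hx.1)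
      (ae_of_all _ fun _ => gradSq_nonneg _) (Eventually.of_forall ?_)
    intro x hx
    exact ⟨lt_of_le_of_lt h₀ hx.1, hx.2.trans htT'.le⟩
  have := normSq_nonneg (u t)
  have : 2 * ν * ∫ t in T₀..T₁, gradSq (u t) ≤ 2 * ν * ∫ τ in (0 : ℝ)..t, gradSq (u τ) := by
    gcongr
  linarith

theorem IsLeraySolution.integral_vorticitySq (hl : IsLeraySolution ν u₀ u) (h₀ : 0 ≤ T₀)
    (h : T₀ < T₁) : ∫ t in T₀..T₁, vorticitySq (u t) = 2 * ∫ t in T₀..T₁, gradSq (u t) := by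
  obtain ⟨M, hM⟩ := hl.leraySpace.bounded
  rw [← intervalIntegral.integral_const_mul, intervalIntegral.integral_of_le h.le,
    intervalIntegral.integral_of_le h.le]
  refine integral_congr_ae ?_
  filter_upwards [ae_restrict_Ioc h₀ hM, ae_restrict_Ioc h₀ hl.leraySpace.weakDiff,
    ae_restrict_Ioc h₀ hl.divFree] with t h1 h2 h3
  exact vorticitySq_eq h1.1 h2 h3

/-- The factor 2 from the vorticity is the one in the definition of `ε`. -/
theorem IsLeraySolution.transferTime_eq (hl : IsLeraySolution ν u₀ u) (hν : 0 < ν) {ρ Kplus : ℝ}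
    (hρ : 0 < ρ) (h₀ : 0 ≤ T₀) (h : T₀ < T₁) :
    transferTime ρ ν u₀ u T₀ T₁ Kplus = kolmogorovConstant ρ ν u T₀ T₁ Kplus ^ 3 * ν *
      meanDissipation ρ ν u T₀ T₁ * (T₁ - T₀) / (ρ * normSq u₀) ^ 2 := by
  have : T₁ - T₀ ≠ 0 := (sub_pos.2 h).ne'
  rw [transferTime, hl.integral_vorticitySq h₀ h, meanDissipation, timeAverage_const_mul,
    timeAverage]
  field_simp

end Energy

/-! ### Correction factors and conclusion -/

/-- The deviation factor `exp (9/4 γ log Re)`. -/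
def deviation (p : ℝ × ℝ) : ℝ := Real.exp (9 / 4 * (p.2 * Real.log p.1))

/-- The correction in the lower bounds. -/
def lowerCorrection (p : ℝ × ℝ) : ℝ :=
  (if 10 ^ 4 ≤ p.1 then 1 else if 1 < p.1 then
    2048 / 3375 * (energyConst p.1 ^ 2 * (2 * enstrophyConst p.1)) else 1) / deviation p

/-- The correction in the upper bound of the time scale. -/
def upperCorrection (p : ℝ × ℝ) : ℝ :=
  (if 10 ^ 4 ≤ p.1 then 1 else if 1 < p.1 then
    3375 / (2048 * (2 * enstrophyConst p.1) ^ 3) else 1) * deviation p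

theorem deviation_pos (p : ℝ × ℝ) : 0 < deviation p := Real.exp_pos _

theorem lowerCorrection_pos (p : ℝ × ℝ) : 0 < lowerCorrection p := by
  refine div_pos ?_ (deviation_pos p)
  split_ifs with h1 h2
  · exact one_pos
  · have := energyConst_pos h2
    have := enstrophyConst_pos h2
    positivity
  · exact one_pos

theorem upperCorrection_pos (p : ℝ × ℝ) : 0 < upperCorrection p := by
  refine mul_pos ?_ (deviation_pos p)
  split_ifs with h1 h2
  · exact one_pos
  · have := enstrophyConst_pos h2
    positivity
  · exact one_pos

theorem tendsto_deviation : Tendsto deviation k41Regime (𝓝 1) := by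
  have h1 : Tendsto (fun p : ℝ × ℝ => p.2 * Real.log p.1) k41Regime (𝓝 0) :=
    tendsto_comap.mono_left inf_le_right
  have h2 : Tendsto deviation k41Regime (𝓝 (Real.exp (9 / 4 * 0))) :=
    (Real.continuous_exp.tendsto _).comp (h1.const_mul (9 / 4))
  simpa using h2

theorem eventually_large : ∀ᶠ p in k41Regime, (10 : ℝ) ^ 4 ≤ p.1 :=
  (tendsto_comap.mono_left inf_le_left : Tendsto (fun p : ℝ × ℝ => p.1) k41Regime atTop).eventually
    (eventually_ge_atTop _)

theorem tendsto_lowerCorrection : Tendsto lowerCorrection k41Regime (𝓝 1) := by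
  have h : Tendsto (fun p => 1 / deviation p) k41Regime (𝓝 1) := by
    simpa using tendsto_deviation.inv₀ one_ne_zero
  refine h.congr' ?_
  filter_upwards [eventually_large] with p hp
  rw [lowerCorrection, if_pos hp]

theorem tendsto_upperCorrection : Tendsto upperCorrection k41Regime (𝓝 1) := by
  refine tendsto_deviation.congr' ?_
  filter_upwards [eventually_large] with p hp
  rw [upperCorrection, if_pos hp, one_mul]

/-- For `x ≥ 10⁴` it is numerical: `0.98² · 1.8 > 3375/2048`. Below that threshold the correction is
defined to give equality. -/
theorem lowerCorrection_le {x γ : ℝ} (hx : 1 < x) :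
    3375 / 2048 * lowerCorrection (x, γ) * deviation (x, γ)
      ≤ energyConst x ^ 2 * (2 * enstrophyConst x) := by
  have hd := deviation_pos (x, γ)
  rw [lowerCorrection, mul_assoc, div_mul_cancel₀ _ hd.ne']
  simp only
  split_ifs with h
  · simp only [energyConst, enstrophyConst, if_pos h]; norm_num
  · exact le_of_eq (by ring)

/-- The spare factor `x²` leaves ample room for `x ≥ 10⁴`; for smaller `x` it is bounded below by 1.
-/
theorem le_upperCorrection {x γ : ℝ} (hx : 1 < x) :
    deviation (x, γ) / (16 * ((2 * enstrophyConst x) ^ 3 * x ^ 2))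
      ≤ 128 / 3375 * upperCorrection (x, γ) := by
  have hd := deviation_pos (x, γ)
  have hB := enstrophyConst_pos hx
  rw [upperCorrection, ← mul_assoc (128 / 3375 : ℝ), div_eq_inv_mul]
  refine mul_le_mul_of_nonneg_right ?_ hd.le
  simp only
  split_ifs with h
  · simp only [enstrophyConst, if_pos h]
    rw [inv_le_comm₀ (by positivity) (by norm_num)]
    have : (10 : ℝ) ^ 2 ≤ x ^ 2 := by
      have : (10 : ℝ) ≤ x := le_trans (by norm_num) h
      gcongr
    norm_num
    linarith
  · have hx2 : 1 ≤ x ^ 2 := one_le_pow₀ hx.le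
    calc (16 * ((2 * enstrophyConst x) ^ 3 * x ^ 2))⁻¹
        ≤ (16 * ((2 * enstrophyConst x) ^ 3 * 1))⁻¹ := by gcongr
      _ = _ := by field_simp; norm_num

end

end K41

theorem mainTheorem6 :
    ∃ C₁ C₂ C₃ C₄ : ℝ × ℝ → ℝ,
      (∀ p, 0 < C₁ p ∧ 0 < C₂ p ∧ 0 < C₃ p ∧ 0 < C₄ p) ∧
      Tendsto C₁ K41.k41Regime (𝓝 1) ∧ Tendsto C₂ K41.k41Regime (𝓝 1) ∧
      Tendsto C₃ K41.k41Regime (𝓝 1) ∧ Tendsto C₄ K41.k41Regime (𝓝 1) ∧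
      ∀ (L : ℝ) [Fact (0 < L)] (ρ ν : ℝ), 0 < ρ → 0 < ν →
      ∀ (u₀ : K41.Torus L → K41.E3) (u : ℝ → K41.Torus L → K41.E3),
        K41.IsLeraySolution ν u₀ u → (∫ x, ρ • u₀ x) = 0 →
      ∀ (T₀ T₁ C Kminus Kplus : ℝ), 0 ≤ T₀ → T₀ < T₁ →
        K41.IsK41Function ρ u T₀ T₁ C →
        K41.IsInertialRange ρ u T₀ T₁ C Kminus Kplus →
      ∀ (Re γ 𝒯 : ℝ), Re = K41.reynolds Kminus Kplus →
        γ = K41.spectralPrecision ρ u T₀ T₁ Kminus Kplus →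
        𝒯 = K41.transferTime ρ ν u₀ u T₀ T₁ Kplus →
        (3375 / 2048 * C₁ (Re, γ) * Re * 𝒯 ≤ T₁ - T₀ ∧
          T₁ - T₀ ≤ 128 * C₂ (Re, γ) / (3375 * Real.pi ^ 4) * (1 / (Re * 𝒯)) *
            ((K41.torusVolume L) ^ (4 / 3 : ℝ) / ν ^ 2)) ∧
        (K41.latticeConstant (K41.nMinus L Kminus) < 1 →
          3375 / 2048 * C₃ (Re, γ) ≤
            (K41.meanEnergy ρ u T₀ T₁ / (ρ * K41.normSq u₀)) ^ 2 * ((T₁ - T₀) / (Re * 𝒯)) ∧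
          (K41.meanEnergy ρ u T₀ T₁ / (ρ * K41.normSq u₀)) ^ 2 * ((T₁ - T₀) / (Re * 𝒯)) ≤
            864 * C₄ (Re, γ) / (1 - K41.latticeConstant (K41.nMinus L Kminus)) ^ 2) := by
  refine ⟨K41.lowerCorrection, K41.upperCorrection, K41.lowerCorrection, K41.deviation,
    fun p => ⟨K41.lowerCorrection_pos p, K41.upperCorrection_pos p, K41.lowerCorrection_pos p,
      K41.deviation_pos p⟩, K41.tendsto_lowerCorrection, K41.tendsto_upperCorrection,
    K41.tendsto_lowerCorrection, K41.tendsto_deviation, ?_⟩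
  intro L _ ρ ν hρ hν u₀ u hl hmean T₀ T₁ C Kminus Kplus h₀ h hK hr Re γ T hRe hγ hT
  have hL : 0 < L := Fact.out
  have hΔ : 0 < T₁ - T₀ := sub_pos.2 h
  have hEE := hl.meanEnergy_le hν hρ h₀ h
  have hdiss := hl.dissipation_le hν h₀ h
  rw [hl.transferTime_eq hν hρ h₀ h] at hT
  have hεΔ : K41.meanDissipation ρ ν u T₀ T₁ * (T₁ - T₀) ≤ ρ * K41.normSq u₀ := by
    have e : K41.meanDissipation ρ ν u T₀ T₁ * (T₁ - T₀)
        = ρ * (2 * ν * ∫ t in T₀..T₁, K41.gradSq (u t)) := by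
      rw [K41.meanDissipation, K41.timeAverage_const_mul, K41.timeAverage]
      field_simp
    rw [e]
    gcongr
  obtain ⟨hRe1, hα, hε, hE, hA, hB, hD⟩ := hr.estimates (ν := ν) hl.leraySpace
    (hl.modeAvg_zero hρ hmean h₀ h) h₀ h hρ hν hK.one_lt hK.lt_two hRe hγ rfl rfl rfl rfl
  have hG : Real.exp (3 / 4 * γ * Real.log Re) ^ 3 = K41.deviation (Re, γ) := by
    rw [← Real.exp_nat_mul, K41.deviation]
    congr 1
    push_cast
    ring
  rw [hG] at hA hB hD
  have hlow := K41.lowerCorrection_le (γ := γ) hRe1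
  have hup := K41.le_upperCorrection (γ := γ) hRe1
  have hGpos := K41.deviation_pos (Re, γ)
  have hcpos := K41.lowerCorrection_pos (Re, γ)
  have hCpos := K41.upperCorrection_pos (Re, γ)
  have hbpos := enstrophyConst_pos hRe1
  have hvol : (K41.torusVolume L) ^ (4 / 3 : ℝ) = L ^ 4 := by
    rw [K41.torusVolume_eq, ← Real.rpow_natCast, ← Real.rpow_mul hL.le, ← Real.rpow_natCast]
    norm_num
  rw [hvol]
  have hlat : 0 ≤ K41.latticeConstant (K41.nMinus L Kminus) := by
    unfold K41.latticeConstant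
    positivity
  generalize K41.latticeConstant (K41.nMinus L Kminus) = c at hlat ⊢
  generalize K41.kolmogorovConstant ρ ν u T₀ T₁ Kplus = α at *
  generalize K41.meanDissipation ρ ν u T₀ T₁ = ε at *
  generalize K41.meanEnergy ρ u T₀ T₁ = E at *
  generalize ρ * K41.normSq u₀ = E₀ at *
  generalize K41.deviation (Re, γ) = G at *
  generalize K41.lowerCorrection (Re, γ) = C₁ at *
  generalize K41.upperCorrection (Re, γ) = C₂ at *
  generalize energyConst Re = cE at *
  generalize enstrophyConst Re = cB at *
  have hE₀ : 0 < E₀ := hE.trans_le hEE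
  have hRe0 : 0 < Re := by linarith
  -- the lower bound of the mean energy
  have hQ : 3375 / 2048 * C₁ * (Re * α ^ 3 * ν * ε) ≤ E ^ 2 := by
    have h1 : G * (3375 / 2048 * C₁ * (Re * α ^ 3 * ν * ε)) ≤ G * E ^ 2 := by
      calc G * (3375 / 2048 * C₁ * (Re * α ^ 3 * ν * ε))
          = 3375 / 2048 * C₁ * G * (Re * α ^ 3 * ν * ε) := by ring
        _ ≤ cE ^ 2 * (2 * cB) * (Re * α ^ 3 * ν * ε) := by gcongr
        _ ≤ _ := hA
    exact le_of_mul_le_mul_left h1 hGpos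
  -- Both the duration and `E₀` cancel, so the two energy bounds `hQ` and `hB` are the second
  -- conclusion.
  have hratio : (E / E₀) ^ 2 * ((T₁ - T₀) / (Re * T)) = E ^ 2 / (Re * α ^ 3 * ν * ε) := by
    rw [hT]; field_simp
  refine ⟨⟨?_, ?_⟩, fun hc => ⟨?_, ?_⟩⟩
  · rw [hT, show 3375 / 2048 * C₁ * Re * (α ^ 3 * ν * ε * (T₁ - T₀) / E₀ ^ 2)
      = 3375 / 2048 * C₁ * (Re * α ^ 3 * ν * ε) * (T₁ - T₀) / E₀ ^ 2 by ring,
      div_le_iff₀ (by positivity), mul_comm (T₁ - T₀)]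
    gcongr
    exact hQ.trans (by gcongr)
  -- The duration also appears in `T`, so the claim is a bound for `(T₁ - T₀)² ε`. It follows from
  -- `hkey`, which supplies one more factor `ε`, and from `ε (T₁ - T₀) ≤ E₀`.
  · have hkey : Re * α ^ 3 * ν ^ 3 * Real.pi ^ 4 ≤ 128 / 3375 * C₂ * L ^ 4 * ε := by
      have h1 : Re * α ^ 3 * ν ^ 3 * Real.pi ^ 4
          ≤ G / (16 * ((2 * cB) ^ 3 * Re ^ 2)) * (L ^ 4 * ε) := by
        rw [div_mul_eq_mul_div, le_div_iff₀ (by positivity)]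
        calc Re * α ^ 3 * ν ^ 3 * Real.pi ^ 4 * (16 * ((2 * cB) ^ 3 * Re ^ 2))
            = (2 * cB) ^ 3 * (16 * Real.pi ^ 4) * Re ^ 3 * (α ^ 3 * ν ^ 3) := by ring
          _ ≤ _ := hD
          _ = _ := by ring
      refine h1.trans ?_
      calc G / (16 * ((2 * cB) ^ 3 * Re ^ 2)) * (L ^ 4 * ε)
          ≤ 128 / 3375 * C₂ * (L ^ 4 * ε) := by gcongr
        _ = _ := by ring
    rw [hT, show 128 * C₂ / (3375 * Real.pi ^ 4) *
        (1 / (Re * (α ^ 3 * ν * ε * (T₁ - T₀) / E₀ ^ 2))) * (L ^ 4 / ν ^ 2)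
      = 128 / 3375 * C₂ * L ^ 4 * E₀ ^ 2 /
        (Real.pi ^ 4 * Re * α ^ 3 * ν ^ 3 * ε * (T₁ - T₀)) by field_simp,
      le_div_iff₀ (by positivity)]
    have h2 : ε ^ 2 * (T₁ - T₀) ^ 2 ≤ E₀ ^ 2 := by rw [← mul_pow]; gcongr
    have h3 : (T₁ - T₀) * (Real.pi ^ 4 * Re * α ^ 3 * ν ^ 3 * ε * (T₁ - T₀))
        = Re * α ^ 3 * ν ^ 3 * Real.pi ^ 4 * ε * (T₁ - T₀) ^ 2 := by ring
    rw [h3]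
    calc Re * α ^ 3 * ν ^ 3 * Real.pi ^ 4 * ε * (T₁ - T₀) ^ 2
        ≤ 128 / 3375 * C₂ * L ^ 4 * ε * ε * (T₁ - T₀) ^ 2 := by gcongr
      _ = 128 / 3375 * C₂ * L ^ 4 * (ε ^ 2 * (T₁ - T₀) ^ 2) := by ring
      _ ≤ _ := by gcongr
  · rw [hratio, le_div_iff₀ (by positivity)]
    exact hQ
  · rw [hratio, div_le_iff₀ (by positivity)]
    refine hB.trans ?_
    gcongr
    -- Since `0 ≤ c < 1`, dividing by `(1 - c)²` only enlarges the bound.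
    rw [le_div_iff₀ (pow_pos (by linarith) 2)]
    have : (1 - c) ^ 2 ≤ 1 := pow_le_one₀ (by linarith) (by linarith)
    nlinarith
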